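/- Let $a>1$ be an integer and $\mu$ a finitely supported probability measure on $\mathbf Z$ with $\gcd(\operatorname{supp}\mu-\operatorname{supp}\mu)=1$. Write $(m_b)_*$ for the push-forward under $x\mapsto bx$. Let $\mu_0=\delta_0$, $\mu_n=\mu*(m_a)_*\mu_{n-1}$ for $n\ge 1$, let $H(\lambda)=\sum_x\lambda(\{x\})\log\lambda(\{x\})^{-1}$ be the entropy of a probability measure $\lambda$ on $\mathbf Z$, and let $H=\lim_{n\to\infty}\frac1nH(\mu_n)$. Let $\|\cdot\|$ and $\|\cdot\|_2$ be the $l^1$ and $l^2$ norms with respect to counting measure, and $u_q$ the uniform probability measure on $\mathbf Z/q\mathbf Z$. Make the following choices. (a) Probability measures $\nu_n$ ($n\ge 0$) with $\operatorname{supp}\nu_n\subset\operatorname{supp}\mu_n$ such that, for $n\ge 2$, $\|\mu_n-\nu_n\|=O((\log n)^2/n)$ and $\nu_n(\{x\})=\exp(-H(\mu_n)+O(n/\log n))$ for every $x\in\operatorname{supp}\nu_n$, with implied constants independent of $n$ and $x$. (b) An integer $C\ge 0$ such that $\operatorname{supp}\nu_{w-C}\subset[-a^w/2,a^w/2]$ for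 all integers $w\ge C$. (c) For each large $n$, with $w_0=\lfloor n/\log n\rfloor$, a number $k$ and positive integers $w_1,\dots,w_k\ge n^{0.1}$ (all depending on $n$) such that $w_1+\dots+w_k=n-w_0$ and, as $n\to\infty$, $k\sim(\log n)^2$ and for every integer $v\in[n^{0.2},n]$ there is $i\in\{1,\dots,k\}$ with $w_1+\dots+w_i\in[(1-o(1))v,v]$, where the $o(1)$ is uniform in $v$. With $s_i=w_0+w_1+\dots+w_i$, the pruned product measure $\pi_n$ (defined for large $n$) is the convolution of $\mu_{w_0}$ and of the measures $$(m_{a^{s_{i-1}}})_*\nu_{w_i-C}*(m_{a^{s_i-C}})_*\mu_C\qquad(i=1,\dots,k).$$ Let $\varepsilon>0$ and assume $2H\ge(1+\varepsilon)\log a$. Then choices (a), (b), (c) exist, and there is a constant $c>0$, depending only on $a,\mu,\varepsilon$, such that the following hold for all such choices. First, $\|\mu_n-\pi_n\|\le n^{-0.1+o(1)}$ as $n\to\infty$. Secondly, for all sufficiently large $n$ (depending on $a$, $\mu$, $\varepsilon$ and the choices) and all real $Q\ge 1$ with $Hn\ge(1+\varepsilon)\log Q$, $$\sum_{\substack{1\le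 q\le Q\\ \gcd(q,a)=1}}q\,\|\pi_n\bmod q-u_q\|_2^2\le Q\exp\bigl(-c(\log Q)^{0.49}\bigr).$$ -/

import Mathlib

open MeasureTheory Filter Topology Asymptotics

noncomputable section

namespace CDG

/-- The support of a measure on a countable discrete space: the set of its atoms. -/
def atoms {G : Type*} [MeasurableSpace G] (μ : Measure G) : Set G := {x | μ {x} ≠ 0}

/-- The differences `x - y` of points of the support of `μ` have greatest common divisor `1`,
i.e. `μ` is not carried by a coset of a proper subgroup of `ℤ`. -/
def GcdOne (μ : Measure ℤ) : Prop :=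
  ∀ d : ℕ, (∀ x ∈ atoms μ, ∀ y ∈ atoms μ, (d : ℤ) ∣ x - y) → d = 1

/-- The image of a measure on `ℤ` under multiplication by `b`. -/
def dilate (b : ℕ) (μ : Measure ℤ) : Measure ℤ := μ.map (fun x : ℤ => (b : ℤ) * x)

/-- The law `μ_n` of `X_n`, where `X_0 = 0` and `X_{n+1} = a X_n + b_n` with `b_n` i.i.d. of
law `μ`:  `μ_0 = δ_0` and `μ_{n+1} = μ * (m_a)_* μ_n`. -/
def law (a : ℕ) (μ : Measure ℤ) : ℕ → Measure ℤ
  | 0 => Measure.dirac 0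
  | n + 1 => Measure.conv μ (dilate a (law a μ n))

/-- Shannon entropy `H(μ) = ∑ₓ μ({x}) log (1 / μ({x}))`. -/
def entropy (μ : Measure ℤ) : ℝ := ∑' x : ℤ, Real.negMulLog (μ.real {x})

/-- The entropy rate `H(a, μ) = lim H(μ_n) / n`. -/
def entropyRate (a : ℕ) (μ : Measure ℤ) : ℝ :=
  limUnder atTop (fun n : ℕ => entropy (law a μ n) / n)

/-- The `l¹` distance `‖μ - ν‖` of two finite measures on a countable discrete space. -/
def l1Dist {G : Type*} [MeasurableSpace G] (μ ν : Measure G) : ℝ :=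
  ∑' x : G, |μ.real {x} - ν.real {x}|

/-- The squared `l²` distance `‖μ - ν‖₂²`, with respect to counting measure. -/
def l2DistSq {G : Type*} [MeasurableSpace G] (μ ν : Measure G) : ℝ :=
  ∑' x : G, (μ.real {x} - ν.real {x}) ^ 2

/-- The reduction `μ mod q`. -/
def modq (q : ℕ) (μ : Measure ℤ) : Measure (ZMod q) := μ.map (fun x : ℤ => (x : ZMod q))

/-- The uniform probability measure `u_q` on `ℤ / qℤ` (for `q ≥ 1`). -/
def unif (q : ℕ) : Measure (ZMod q) := ProbabilityTheory.uniformOn Set.univ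

/-- `ν` is a sequence of truncations of the laws `μ_n`, with `α(n) = 1 / log n`: probability
measures `ν_n`, with `supp ν_n ⊆ supp μ_n`, such that `‖μ_n - ν_n‖ = O(1 / (α(n)² n))` and
`ν_n({x}) = exp (-H(μ_n) + O(α(n) n))` for all `x ∈ supp ν_n`. -/
structure IsTruncation (a : ℕ) (μ : Measure ℤ) (ν : ℕ → Measure ℤ) : Prop where
  prob : ∀ n, IsProbabilityMeasure (ν n)
  supp : ∀ n, atoms (ν n) ⊆ atoms (law a μ n)
  asymp : ∃ A : ℝ, ∀ n : ℕ, 2 ≤ n →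
    l1Dist (law a μ n) (ν n) ≤ A * (Real.log n ^ 2 / n) ∧
    ∀ x ∈ atoms (ν n),
      |Real.log ((ν n).real {x}) + entropy (law a μ n)| ≤ A * (n / Real.log n)

/-- `supp ν_{w-C} ⊆ [-a^w / 2, a^w / 2]` for all `w ≥ C`. -/
def IsMargin (a : ℕ) (ν : ℕ → Measure ℤ) (C : ℕ) : Prop :=
  ∀ w : ℕ, C ≤ w → ∀ x ∈ atoms (ν (w - C)), |(x : ℝ)| ≤ (a : ℝ) ^ w / 2

/-- The length `w_0 = ⌊n / log n⌋` of the initial block. -/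
def initLen (n : ℕ) : ℕ := ⌊(n : ℝ) / Real.log n⌋₊

/-- For every `n`, block lengths `w n 1, …, w n (k n)` (the other values of `w n` play no role)
such that, as `n → ∞`: `k n ∼ (log n)²`; all blocks have length at least `n^0.1`; they add up to
`n - w_0`; and every `v ∈ [n^0.2, n]` admits an `i` such that
`w n 1 + ⋯ + w n i ∈ [(1 - o(1)) v, v]`. -/
structure IsBlockScheme (k : ℕ → ℕ) (w : ℕ → ℕ → ℕ) : Prop where
  count : (fun n => (k n : ℝ)) ~[atTop] (fun n : ℕ => Real.log n ^ 2)
  long : ∀ᶠ n : ℕ in atTop, ∀ i ∈ Finset.Icc 1 (k n), (n : ℝ) ^ (0.1 : ℝ) ≤ (w n i : ℝ)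
  total : ∀ᶠ n : ℕ in atTop, initLen n + ∑ i ∈ Finset.Icc 1 (k n), w n i = n
  dense : ∀ δ : ℝ, 0 < δ → ∀ᶠ n : ℕ in atTop, ∀ v : ℕ, (n : ℝ) ^ (0.2 : ℝ) ≤ (v : ℝ) → v ≤ n →
    ∃ i ∈ Finset.Icc 1 (k n),
      (1 - δ) * (v : ℝ) ≤ ((∑ j ∈ Finset.Icc 1 i, w n j : ℕ) : ℝ) ∧
      ∑ j ∈ Finset.Icc 1 i, w n j ≤ v

/-- With `s_i = w_0 + w_1 + ⋯ + w_i`, the convolution of `μ_{w_0}` and of the blocks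
`(m_{a^{s_{i-1}}})_* ν_{w_i - C} * (m_{a^{s_i - C}})_* μ_C` for `i = 1, …, k`. -/
def blockProd (a : ℕ) (μ : Measure ℤ) (ν : ℕ → Measure ℤ) (C w₀ : ℕ) (w : ℕ → ℕ) :
    ℕ → Measure ℤ
  | 0 => law a μ w₀
  | i + 1 => Measure.conv (blockProd a μ ν C w₀ w i)
      (Measure.conv
        (dilate (a ^ (w₀ + ∑ j ∈ Finset.Icc 1 i, w j)) (ν (w (i + 1) - C)))
        (dilate (a ^ (w₀ + ∑ j ∈ Finset.Icc 1 (i + 1), w j - C)) (law a μ C)))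

/-- The pruned product measure `π_n`. -/
def prunedLaw (a : ℕ) (μ : Measure ℤ) (ν : ℕ → Measure ℤ) (C : ℕ) (k : ℕ → ℕ)
    (w : ℕ → ℕ → ℕ) (n : ℕ) : Measure ℤ :=
  blockProd a μ ν C (initLen n) (w n) (k n)

end CDG

end

/-! By Parseval on ℤ/qℤ (`mul_l2DistSq_eq`) each summand is the sum of |π̂_n(b/q)|² over 0 < b < q.
Put N = ⌊Q⌋. A reduced fraction of denominator d arises from at most N/d moduli q ≤ N
(`sum_modq_le_farey`), so the task is to bound the sum of (N/d)|π̂_n(r)|² over reduced r in (0,1)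
with denominator d ≤ N prime to a. Any factor of the convolution may be dropped, as its Fourier
transform has modulus at most 1. Let X = n^0.49.

Denominators up to e^X (`sum_small_den_le`): only the initial block μ_{w₀} is kept. In every window
of about X / log a consecutive exponents j, some a^j r is far from the integers, where |μ̂| is at
most a fixed constant below 1 (`norm_ft_law_le`). There are about n^0.51 / log n disjoint windows,
and the resulting decay beats the number of fractions, at most 2e^{2X}.

Denominators in [D/2, D] with D ≥ e^X (`sum_dyadic_le`): only the truncated parts of the first i
pruned blocks are kept, of total length S with a^S ≤ D². The points a^{w₀} r are D⁻²-separated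
modulo 1, so the large sieve bounds the sum of |π̂_n(r)|² by O(D² log D) times the largest atom.
That atom is at most exp(-(H - o(1))S): ν_m is flat at height about exp(-H(μ_m)), H(μ_m) ≥ Hm, and
the margin C makes each block cost only a factor 2 (`real_blockChain_truncation_le`). The density of
the partial sums allows S close to min(2 log D / log a, n). Then 2H ≥ (1+ε) log a in the one case,
and Hn ≥ (1+ε) log Q in the other, give HS ≥ (1+ε-o(1)) log D, which leaves a saving exp(-(ε/2)X) in
each of O(n) dyadic ranges.

The distance from μ_n to π_n is at most the sum of the truncation errors of the blocks
(`l1Dist_law_blockProd_le`). Truncations exist by Chebyshev's inequality, because the information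
content -log μ_n({x}) has variance O(n) (`exists_variance_info_le`); block lengths exist by letting
the partial sums grow geometrically with ratio tending to 1. -/

noncomputable section

namespace CDG

set_option linter.unusedSectionVars false

/-! ### Measures on countable discrete spaces and their atoms. -/

section Atoms

variable {G G' : Type*} [MeasurableSpace G] [Countable G] [DiscreteMeasurableSpace G]
  [MeasurableSpace G'] [Countable G'] [DiscreteMeasurableSpace G']

lemma ae_mem_atoms (μ : Measure G) : ∀ᵐ x ∂μ, x ∈ atoms μ := by
  rw [ae_iff_of_countable]
  intro x hx
  exact hx

lemma mem_atoms_iff_real {μ : Measure G} [IsFiniteMeasure μ] {x : G} :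
    x ∈ atoms μ ↔ μ.real {x} ≠ 0 := by
  simp [atoms, Measure.real, ENNReal.toReal_eq_zero_iff]

lemma mem_atoms_iff_pos {μ : Measure G} [IsFiniteMeasure μ] {x : G} :
    x ∈ atoms μ ↔ 0 < μ.real {x} := by
  rw [mem_atoms_iff_real]
  exact ⟨fun h => lt_of_le_of_ne measureReal_nonneg h.symm, fun h => h.ne'⟩

lemma real_eq_zero_of_notMem {μ : Measure G} [IsFiniteMeasure μ] {x : G} (h : x ∉ atoms μ) :
    μ.real {x} = 0 := by
  by_contra h'
  exact h (mem_atoms_iff_real.2 h')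

lemma restrict_atoms (μ : Measure G) : μ.restrict (atoms μ) = μ :=
  Measure.restrict_eq_self_of_ae_mem (ae_mem_atoms μ)

variable {E : Type*} [NormedAddCommGroup E]

lemma integrable_of_atoms {μ : Measure G} [IsFiniteMeasure μ] (h : (atoms μ).Finite) (f : G → E) :
    Integrable f μ := by
  have := IntegrableOn.of_finite (f := f) (μ := μ) h
  rwa [IntegrableOn, restrict_atoms] at this

lemma memLp_of_atoms {μ : Measure G} [IsFiniteMeasure μ] (h : (atoms μ).Finite) (f : G → ℝ) :
    MemLp f 2 μ := by
  rw [memLp_two_iff_integrable_sq (integrable_of_atoms h f).aestronglyMeasurable]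
  exact integrable_of_atoms h _

lemma integral_eq_sum [NormedSpace ℝ E] [CompleteSpace E] {μ : Measure G} [IsFiniteMeasure μ]
    {s : Finset G} (h : atoms μ ⊆ s) (f : G → E) :
    ∫ x, f x ∂μ = ∑ x ∈ s, μ.real {x} • f x := by
  have hs := setIntegral_finset (μ := μ) s (IntegrableOn.finset (f := f))
  rw [← hs, Measure.restrict_eq_self_of_ae_mem]
  filter_upwards [ae_mem_atoms μ] with x hx using h hx

lemma integral_mono_atoms {μ : Measure G} [IsFiniteMeasure μ] (hμ : (atoms μ).Finite) {f g : G → ℝ}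
    (h : ∀ x ∈ atoms μ, f x ≤ g x) : ∫ x, f x ∂μ ≤ ∫ x, g x ∂μ := by
  refine integral_mono_ae (integrable_of_atoms hμ f) (integrable_of_atoms hμ g) ?_
  filter_upwards [ae_mem_atoms μ] with x hx using h x hx

lemma atoms_map (μ : Measure G) (f : G → G') : atoms (μ.map f) = f '' atoms μ := by
  ext y
  simp only [atoms, Set.mem_ofPred_eq, Set.mem_image]
  rw [Measure.map_apply (measurable_of_countable f) (measurableSet_singleton y)]
  constructor
  · intro h
    by_contra! h'
    apply h
    rw [measure_eq_zero_iff_ae_notMem]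
    filter_upwards [ae_mem_atoms μ] with x hx
    exact h' x hx
  · rintro ⟨x, hx, rfl⟩ h
    exact hx (measure_mono_null (by simp) h)

lemma atoms_prod (μ : Measure G) (ν : Measure G') [SFinite ν] :
    atoms (μ.prod ν) = atoms μ ×ˢ atoms ν := by
  ext ⟨x, y⟩
  simp only [atoms, Set.mem_ofPred_eq, Set.mem_prod]
  rw [← Set.singleton_prod_singleton, Measure.prod_prod]
  simp

lemma prod_real_singleton (μ : Measure G) (ν : Measure G') [SFinite ν] (x : G) (y : G') :
    (μ.prod ν).real {(x, y)} = μ.real {x} * ν.real {y} := by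
  rw [← Set.singleton_prod_singleton, measureReal_prod_prod]

lemma integral_map_countable [NormedSpace ℝ E] (μ : Measure G) (f : G → G') (g : G' → E) :
    ∫ y, g y ∂(μ.map f) = ∫ x, g (f x) ∂μ :=
  integral_map (measurable_of_countable f).aemeasurable
    (StronglyMeasurable.of_discrete).aestronglyMeasurable

lemma sum_real_eq_one {μ : Measure G} [IsProbabilityMeasure μ] {s : Finset G}
    (h : atoms μ ⊆ s) : ∑ x ∈ s, μ.real {x} = 1 := by
  have := integral_eq_sum h (fun _ => (1 : ℝ))
  simpa using this.symm

lemma exists_finset_atoms {μ : Measure G} (h : (atoms μ).Finite) :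
    ∃ s : Finset G, atoms μ = s := ⟨h.toFinset, by simp⟩

end Atoms

/-! ### Dilations, convolutions and the laws μ_n on ℤ. -/

section Integers

variable {E : Type*} [NormedAddCommGroup E] [NormedSpace ℝ E]

instance {μ : Measure ℤ} [IsProbabilityMeasure μ] (b : ℕ) : IsProbabilityMeasure (dilate b μ) :=
  Measure.isProbabilityMeasure_map (measurable_of_countable _).aemeasurable

instance {μ : Measure ℤ} [IsProbabilityMeasure μ] (a n : ℕ) : IsProbabilityMeasure (law a μ n) := by
  induction n with
  | zero => unfold law; infer_instance
  | succ n ih => unfold law; infer_instance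

lemma atoms_dilate (b : ℕ) (μ : Measure ℤ) :
    atoms (dilate b μ) = (fun x : ℤ => (b : ℤ) * x) '' atoms μ := atoms_map _ _

lemma atoms_conv (μ ν : Measure ℤ) [SFinite ν] :
    atoms (μ.conv ν) = (fun p : ℤ × ℤ => p.1 + p.2) '' (atoms μ ×ˢ atoms ν) := by
  rw [Measure.conv, atoms_map, atoms_prod]

lemma finite_atoms_dilate {b : ℕ} {μ : Measure ℤ} (h : (atoms μ).Finite) :
    (atoms (dilate b μ)).Finite := by
  rw [atoms_dilate]; exact h.image _

lemma finite_atoms_conv {μ ν : Measure ℤ} [SFinite ν] (h : (atoms μ).Finite)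
    (h' : (atoms ν).Finite) : (atoms (μ.conv ν)).Finite := by
  rw [atoms_conv]; exact (h.prod h').image _

lemma atoms_dirac_zero : atoms (Measure.dirac (0 : ℤ)) = {0} := by
  ext x
  simp [atoms, Set.indicator_apply, eq_comm]

lemma finite_atoms_law {a : ℕ} {μ : Measure ℤ} [IsProbabilityMeasure μ] (h : (atoms μ).Finite)
    (n : ℕ) : (atoms (law a μ n)).Finite := by
  induction n with
  | zero => rw [law, atoms_dirac_zero]; exact Set.finite_singleton 0
  | succ n ih => exact finite_atoms_conv h (finite_atoms_dilate ih)

lemma integral_conv_atoms [CompleteSpace E] {μ ν : Measure ℤ} [IsProbabilityMeasure μ]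
    [IsProbabilityMeasure ν] (hμ : (atoms μ).Finite) (hν : (atoms ν).Finite) (f : ℤ → E) :
    ∫ z, f z ∂(μ.conv ν) = ∫ x, ∫ y, f (x + y) ∂ν ∂μ :=
  integral_conv (integrable_of_atoms (finite_atoms_conv hμ hν) f)

lemma integral_dilate (b : ℕ) (μ : Measure ℤ) (f : ℤ → E) :
    ∫ z, f z ∂(dilate b μ) = ∫ x, f (b * x) ∂μ := integral_map_countable _ _ _

lemma dilate_one (μ : Measure ℤ) : dilate 1 μ = μ := by
  simp [dilate]

lemma dilate_dilate (b c : ℕ) (μ : Measure ℤ) : dilate b (dilate c μ) = dilate (b * c) μ := by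
  unfold dilate
  rw [Measure.map_map (measurable_of_countable _) (measurable_of_countable _)]
  congr 1
  ext x
  simp [mul_assoc]

lemma dilate_dirac_zero (b : ℕ) : dilate b (Measure.dirac 0) = Measure.dirac 0 := by
  unfold dilate
  rw [Measure.map_dirac]
  simp

lemma dilate_conv (b : ℕ) (μ ν : Measure ℤ) [IsProbabilityMeasure μ] [IsProbabilityMeasure ν] :
    dilate b (μ.conv ν) = (dilate b μ).conv (dilate b ν) := by
  have h := Measure.map_conv_addMonoidHom (μ := μ) (ν := ν) (L := AddMonoidHom.mulLeft (b : ℤ))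
    (measurable_of_countable _)
  exact h

/-- Self-similarity: the first m base-a digits and the remaining n are independent. Every
factorisation of μ_n below comes from here. -/
lemma law_add (a : ℕ) (μ : Measure ℤ) [IsProbabilityMeasure μ] (m n : ℕ) :
    law a μ (m + n) = (law a μ m).conv (dilate (a ^ m) (law a μ n)) := by
  induction m with
  | zero => simp [law, dilate_one]
  | succ m ih =>
    rw [Nat.succ_add, law, ih, dilate_conv, dilate_dilate, law, Measure.conv_assoc, pow_succ']

lemma law_one (a : ℕ) (μ : Measure ℤ) [IsProbabilityMeasure μ] : law a μ 1 = μ := by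
  rw [law, law, dilate_dirac_zero, Measure.conv_dirac_zero]

lemma exists_bound_atoms {μ : Measure ℤ} (h : (atoms μ).Finite) :
    ∃ M : ℕ, ∀ x ∈ atoms μ, |x| ≤ M := by
  obtain ⟨s, hs⟩ := exists_finset_atoms h
  refine ⟨s.sup Int.natAbs, fun x hx => ?_⟩
  rw [hs] at hx
  have : x.natAbs ≤ s.sup Int.natAbs := Finset.le_sup (f := Int.natAbs) hx
  rw [Int.abs_eq_natAbs]
  exact_mod_cast this

/-- Geometric series: M(1 + a + ⋯ + a^(n-1)) ≤ M(a^n - 1), since a ≥ 2. -/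
lemma abs_le_of_mem_atoms_law {a : ℕ} (ha : 1 < a) {μ : Measure ℤ} [IsProbabilityMeasure μ] {M : ℕ}
    (hM : ∀ x ∈ atoms μ, |x| ≤ M) (n : ℕ) :
    ∀ x ∈ atoms (law a μ n), |x| ≤ M * ((a : ℤ) ^ n - 1) := by
  induction n with
  | zero => intro x hx; rw [law, atoms_dirac_zero] at hx; simp_all
  | succ n ih =>
    intro x hx
    rw [law, atoms_conv, atoms_dilate] at hx
    obtain ⟨⟨u, v⟩, ⟨hu, ⟨y, hy, rfl⟩⟩, rfl⟩ := hx
    have h1 := hM u hu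
    have h2 := ih y hy
    have ha' : (2 : ℤ) ≤ a := by exact_mod_cast ha
    have h3 : |(a : ℤ) * y| = a * |y| := by rw [abs_mul, abs_of_nonneg (by omega)]
    calc |u + a * y| ≤ |u| + |(a : ℤ) * y| := abs_add_le _ _
      _ ≤ M + a * (M * ((a : ℤ) ^ n - 1)) := by rw [h3]; gcongr
      _ ≤ M * ((a : ℤ) ^ (n + 1) - 1) := by
        rw [pow_succ]
        nlinarith [mul_nonneg (Int.natCast_nonneg M) (show (0 : ℤ) ≤ a - 2 by omega)]

end Integers

/-! ### Fourier transforms of finitely supported measures. -/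

section Fourier

/-- The additive character `e(t) = exp (2 π i t)`. -/
def expi (t : ℝ) : ℂ := Complex.exp (2 * Real.pi * t * Complex.I)

lemma expi_add (s t : ℝ) : expi (s + t) = expi s * expi t := by
  rw [expi, expi, expi, ← Complex.exp_add]; push_cast; ring_nf

lemma norm_expi (t : ℝ) : ‖expi t‖ = 1 := by
  have : expi t = Complex.exp ((2 * Real.pi * t : ℝ) * Complex.I) := by
    rw [expi]; push_cast; rfl
  rw [this, Complex.norm_exp_ofReal_mul_I]

lemma expi_intCast (m : ℤ) : expi m = 1 := by
  rw [expi, Complex.exp_eq_one_iff]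
  exact ⟨m, by push_cast; ring⟩

lemma expi_zero : expi 0 = 1 := by simpa using expi_intCast 0

lemma conj_expi (t : ℝ) : (starRingEnd ℂ) (expi t) = expi (-t) := by
  rw [expi, expi, ← Complex.exp_conj]
  congr 1
  simp [map_ofNat (starRingEnd ℂ) 2]

lemma expi_re (t : ℝ) : (expi t).re = Real.cos (2 * Real.pi * t) := by
  have : expi t = Complex.exp ((2 * Real.pi * t : ℝ) * Complex.I) := by
    rw [expi]; push_cast; rfl
  rw [this, Complex.exp_ofReal_mul_I_re]

lemma expi_sub_int (t : ℝ) (m : ℤ) : expi (t - m) = expi t := by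
  rw [sub_eq_add_neg, expi_add, ← Int.cast_neg, expi_intCast, mul_one]

lemma expi_fract (t : ℝ) : expi (Int.fract t) = expi t := expi_sub_int t ⌊t⌋

lemma expi_natCast_mul (n : ℕ) (t : ℝ) : expi (n * t) = expi t ^ n := by
  rw [expi, expi, ← Complex.exp_nat_mul]; congr 1; push_cast; ring

/-- The Fourier transform of a measure on `ℤ`. -/
def ft (μ : Measure ℤ) (θ : ℝ) : ℂ := ∫ x : ℤ, expi (x * θ) ∂μ

lemma norm_ft_le_one (μ : Measure ℤ) [IsProbabilityMeasure μ] (θ : ℝ) : ‖ft μ θ‖ ≤ 1 := by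
  have := norm_integral_le_of_norm_le_const (μ := μ) (f := fun x : ℤ => expi (x * θ)) (C := 1)
    (Eventually.of_forall fun x => (norm_expi _).le)
  simpa [ft] using this

lemma ft_dilate (b : ℕ) (μ : Measure ℤ) (θ : ℝ) : ft (dilate b μ) θ = ft μ (b * θ) := by
  rw [ft, integral_dilate, ft]
  congr 1; ext x; congr 1; push_cast; ring

lemma ft_conv {μ ν : Measure ℤ} [IsProbabilityMeasure μ] [IsProbabilityMeasure ν]
    (hμ : (atoms μ).Finite) (hν : (atoms ν).Finite) (θ : ℝ) :
    ft (μ.conv ν) θ = ft μ θ * ft ν θ := by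
  rw [ft, integral_conv_atoms hμ hν, ft, ft, ← integral_mul_const]
  congr 1; ext x
  rw [← integral_const_mul]
  congr 1; ext y
  rw [← expi_add]; congr 1; push_cast; ring

lemma ft_dirac (θ : ℝ) : ft (Measure.dirac 0) θ = 1 := by
  rw [ft, integral_dirac]; simp [expi_zero]

lemma ft_eq_sum {μ : Measure ℤ} [IsFiniteMeasure μ] {s : Finset ℤ} (h : atoms μ ⊆ s) (θ : ℝ) :
    ft μ θ = ∑ x ∈ s, (μ.real {x} : ℂ) * expi (x * θ) := by
  rw [ft, integral_eq_sum h]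
  simp

lemma ft_add_int (μ : Measure ℤ) (θ : ℝ) (m : ℤ) : ft μ (θ + m) = ft μ θ := by
  rw [ft, ft]; congr 1; ext x
  rw [mul_add, expi_add, ← Int.cast_mul, expi_intCast, mul_one]

lemma ft_fract (μ : Measure ℤ) (θ : ℝ) : ft μ (Int.fract θ) = ft μ θ := by
  have := ft_add_int μ (Int.fract θ) ⌊θ⌋
  rw [← this, Int.fract_add_floor]

lemma continuous_ft {μ : Measure ℤ} [IsFiniteMeasure μ] (h : (atoms μ).Finite) :
    Continuous (ft μ) := by
  obtain ⟨s, hs⟩ := exists_finset_atoms h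
  have : ft μ = fun θ => ∑ x ∈ s, (μ.real {x} : ℂ) * expi (x * θ) := by
    ext θ; exact ft_eq_sum hs.le θ
  rw [this]
  unfold expi
  fun_prop

lemma normSq_ft {μ : Measure ℤ} [IsFiniteMeasure μ] {s : Finset ℤ} (h : atoms μ ⊆ s) (θ : ℝ) :
    ‖ft μ θ‖ ^ 2 = ∑ x ∈ s, ∑ y ∈ s,
      μ.real {x} * μ.real {y} * Real.cos (2 * Real.pi * ((x - y : ℤ) * θ)) := by
  have h1 : ((‖ft μ θ‖ ^ 2 : ℝ) : ℂ) = ft μ θ * (starRingEnd ℂ) (ft μ θ) := by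
    rw [Complex.mul_conj, Complex.normSq_eq_norm_sq]
  have h2 : ft μ θ * (starRingEnd ℂ) (ft μ θ) = ∑ x ∈ s, ∑ y ∈ s,
      ((μ.real {x} * μ.real {y} : ℝ) : ℂ) * expi ((x - y : ℤ) * θ) := by
    rw [ft_eq_sum h, map_sum, Finset.sum_mul_sum]
    refine Finset.sum_congr rfl fun x _ => Finset.sum_congr rfl fun y _ => ?_
    rw [map_mul, conj_expi, Complex.conj_ofReal]
    have : expi ((x - y : ℤ) * θ) = expi (x * θ) * expi (-(y * θ)) := by
      rw [← expi_add]; congr 1; push_cast; ring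
    rw [this]; push_cast; ring
  have h3 := congrArg Complex.re (h1.trans h2)
  rw [Complex.ofReal_re] at h3
  rw [h3, Complex.re_sum]
  refine Finset.sum_congr rfl fun x _ => ?_
  rw [Complex.re_sum]
  refine Finset.sum_congr rfl fun y _ => ?_
  rw [Complex.re_ofReal_mul, expi_re]

/-- The integers z with zθ ∈ ℤ form a subgroup of ℤ. Its generator divides every difference of
atoms, hence is a unit, and 1 belongs to the subgroup. -/
lemma exists_int_of_forall_mul {μ : Measure ℤ} (hgcd : GcdOne μ) {θ : ℝ}
    (h : ∀ x ∈ atoms μ, ∀ y ∈ atoms μ, ∃ m : ℤ, ((x - y : ℤ) : ℝ) * θ = m) :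
    ∃ m : ℤ, θ = m := by
  let H : AddSubgroup ℤ :=
    { carrier := {z | ∃ m : ℤ, (z : ℝ) * θ = m}
      add_mem' := by
        rintro u v ⟨m, hm⟩ ⟨n, hn⟩
        exact ⟨m + n, by push_cast; rw [add_mul, hm, hn]⟩
      zero_mem' := ⟨0, by simp⟩
      neg_mem' := by
        rintro u ⟨m, hm⟩
        exact ⟨-m, by push_cast; rw [neg_mul, hm]⟩ }
  obtain ⟨g, hg⟩ := Int.subgroup_cyclic H
  have hH : ∀ z, z ∈ H ↔ g ∣ z := by
    intro z
    rw [hg, AddSubgroup.mem_closure_singleton]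
    constructor
    · rintro ⟨n, rfl⟩; simp
    · rintro ⟨n, rfl⟩; exact ⟨n, by simp [mul_comm]⟩
  have h1 := hgcd g.natAbs (fun x hx y hy => by
    rw [Int.natAbs_dvd]
    exact (hH _).1 (h x hx y hy))
  have : (1 : ℤ) ∈ H := by
    rw [hH, ← Int.natAbs_dvd, h1]; simp
  obtain ⟨m, hm⟩ := this
  exact ⟨m, by simpa using hm⟩

/-- In the expansion of |μ̂(θ)|² as a double sum of cosines with total weight 1, the value 1 forces
every cosine to be 1. So (x - y)θ is an integer for all atoms x, y, contrary to the gcd condition.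
-/
lemma norm_ft_lt_one {μ : Measure ℤ} [IsProbabilityMeasure μ] (hfin : (atoms μ).Finite)
    (hgcd : GcdOne μ) {θ : ℝ} (hθ : ∀ m : ℤ, θ ≠ m) : ‖ft μ θ‖ < 1 := by
  refine lt_of_le_of_ne (norm_ft_le_one μ θ) fun h => ?_
  obtain ⟨s, hs⟩ := exists_finset_atoms hfin
  have h1 := normSq_ft hs.le θ
  have hp : ∀ x ∈ s, 0 < μ.real {x} := fun x hx => mem_atoms_iff_pos.1 (by rw [hs]; exact hx)
  have h2 : ∑ x ∈ s, ∑ y ∈ s,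
      μ.real {x} * μ.real {y} * (1 - Real.cos (2 * Real.pi * ((x - y : ℤ) * θ))) = 0 := by
    simp only [mul_sub, mul_one, Finset.sum_sub_distrib]
    rw [← h1, h, ← Finset.sum_mul_sum, sum_real_eq_one hs.le]
    simp
  have h3 : ∀ x ∈ s, ∀ y ∈ s, 0 ≤
      μ.real {x} * μ.real {y} * (1 - Real.cos (2 * Real.pi * ((x - y : ℤ) * θ))) := by
    intro x hx y hy
    have := Real.cos_le_one (2 * Real.pi * ((x - y : ℤ) * θ))
    have := hp x hx
    have := hp y hy
    have : 0 ≤ 1 - Real.cos (2 * Real.pi * ((x - y : ℤ) * θ)) := by linarith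
    positivity
  rw [Finset.sum_eq_zero_iff_of_nonneg (fun x hx => Finset.sum_nonneg (h3 x hx))] at h2
  obtain ⟨m, hm⟩ := exists_int_of_forall_mul hgcd (θ := θ) (fun x hx y hy => by
    rw [hs] at hx hy
    have h4 := (Finset.sum_eq_zero_iff_of_nonneg (h3 x hx)).1 (h2 x hx) y hy
    have h5 : Real.cos (2 * Real.pi * ((x - y : ℤ) * θ)) = 1 := by
      have h6 := (mul_pos (hp x hx) (hp y hy)).ne'
      have := (mul_eq_zero.1 h4).resolve_left h6
      linarith
    rw [Real.cos_eq_one_iff] at h5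
    obtain ⟨n, hn⟩ := h5
    refine ⟨n, ?_⟩
    have hpi := Real.pi_pos
    have : 2 * Real.pi * (((x - y : ℤ) : ℝ) * θ - n) = 0 := by linarith
    rcases mul_eq_zero.1 this with h | h
    · exact absurd h (by positivity)
    · linarith)
  exact hθ m hm

/-- Away from the integers the Fourier transform is bounded away from `1`. -/
lemma exists_norm_ft_le {μ : Measure ℤ} [IsProbabilityMeasure μ] (hfin : (atoms μ).Finite)
    (hgcd : GcdOne μ) {η : ℝ} (hη : 0 < η) :
    ∃ r : ℝ, 0 < r ∧ r < 1 ∧ ∀ θ : ℝ, η ≤ Int.fract θ → Int.fract θ ≤ 1 - η → ‖ft μ θ‖ ≤ r := by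
  rcases (Set.Icc η (1 - η)).eq_empty_or_nonempty with he | hne
  · refine ⟨1 / 2, by norm_num, by norm_num, fun θ h1 h2 => ?_⟩
    have : Int.fract θ ∈ Set.Icc η (1 - η) := ⟨h1, h2⟩
    simp [he] at this
  · obtain ⟨t, ht, hmax⟩ := isCompact_Icc.exists_isMaxOn hne
      (continuous_ft hfin).norm.continuousOn
    have hlt : ‖ft μ t‖ < 1 := by
      refine norm_ft_lt_one hfin hgcd fun m hm => ?_
      have h1 : (0 : ℝ) < m := by rw [← hm]; linarith [ht.1]
      have h2 : (m : ℝ) < 1 := by rw [← hm]; linarith [ht.2]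
      norm_cast at h1 h2
      omega
    refine ⟨max (1 / 2) ‖ft μ t‖, by positivity, max_lt (by norm_num) hlt, fun θ h1 h2 => ?_⟩
    rw [← ft_fract]
    exact (hmax ⟨h1, h2⟩).trans (le_max_right _ _)

end Fourier

/-! ### Decay of the Fourier transform of μ_w at rationals with denominator prime to a. -/

section Window

/-- Among `a^j θ`, `j < m`, one is at distance at least `1 / (2a)` from the integers, when `θ` is
a nontrivial fraction of denominator at most `a^m`. -/
lemma exists_far_from_int {a m : ℕ} (ha : 1 < a) {θ : ℝ} {d : ℕ} (hd0 : 0 < d)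
    (hd : d ≤ a ^ m) {b : ℤ}
    (hb : (d : ℝ) * θ = b) (hθ : ∀ z : ℤ, θ ≠ z) :
    ∃ j < m, 1 / (2 * a : ℝ) ≤ Int.fract ((a : ℝ) ^ j * θ) ∧
      Int.fract ((a : ℝ) ^ j * θ) ≤ 1 - 1 / (2 * a : ℝ) := by
  -- Otherwise all a^j θ with j < m are within 1/(2a) of an integer. Multiplication by a then never
  -- changes the nearest integer except by the factor a, so a^j z stays nearest to a^j θ, where z is
  -- nearest to θ, and a^m |θ - z| < 1/2. But d(θ - z) is a nonzero integer and d ≤ a^m.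
  by_contra! hcon
  have ha0 : (0 : ℝ) < a := by positivity
  have hclose : ∀ j < m, |(a : ℝ) ^ j * θ - round ((a : ℝ) ^ j * θ)| < 1 / (2 * a : ℝ) := by
    intro j hj
    rw [abs_sub_round_eq_min, min_lt_iff]
    by_contra! h
    have := hcon j hj h.1
    linarith [h.2]
  set z := round θ
  have hu : ∀ j ≤ m, |(a : ℝ) ^ j * (θ - z)| < 1 / 2 ∧ (j < m →
      |(a : ℝ) ^ j * (θ - z)| < 1 / (2 * a : ℝ)) := by
    have step : ∀ j ≤ m, |(a : ℝ) ^ j * (θ - z)| < 1 / 2 → |(a : ℝ) ^ j * (θ - z)| < 1 / 2 ∧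
        (j < m → |(a : ℝ) ^ j * (θ - z)| < 1 / (2 * a : ℝ)) := by
      intro j _ h
      refine ⟨h, fun hjm => ?_⟩
      have e : (a : ℝ) ^ j * (θ - z) = (a : ℝ) ^ j * θ - (((a : ℤ) ^ j * z : ℤ) : ℝ) := by
        push_cast; ring
      rw [e] at h ⊢
      set x := (a : ℝ) ^ j * θ
      set n : ℤ := (a : ℤ) ^ j * z
      have h1 := round_le x n
      have h2 : round x = n := by
        have h3 : |((round x - n : ℤ) : ℝ)| < 1 := by
          push_cast
          calc |(round x : ℝ) - n| = |(x - n) - (x - round x)| := by congr 1; ring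
            _ ≤ |x - n| + |x - round x| := abs_sub _ _
            _ < 1 := by linarith
        have h4 : |round x - n| < 1 := by exact_mod_cast h3
        have := Int.abs_lt_one_iff.1 h4
        omega
      rw [← h2]
      exact hclose j hjm
    intro j
    induction j with
    | zero =>
      intro h0
      refine step 0 h0 ?_
      have hne : |θ - z| ≤ 1 / 2 := abs_sub_round θ
      -- For m = 0 the bound d ≤ a^m leaves d = 1, and θ would be an integer.
      rcases Nat.eq_zero_or_pos m with rfl | hm
      · exfalso
        obtain rfl : d = 1 := by
          have : d ≤ 1 := by simpa using hd
          omega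
        exact hθ b (by simpa using hb)
      · have := hclose 0 hm
        simp only [pow_zero, one_mul] at this ⊢
        refine this.trans_le ?_
        rw [one_div, one_div]
        apply inv_anti₀ (by norm_num)
        have : (1 : ℝ) ≤ a := by exact_mod_cast ha.le
        linarith
    | succ j ih =>
      intro hj
      refine step _ hj ?_
      have := (ih (by omega)).2 (by omega)
      rw [pow_succ', mul_assoc, abs_mul, abs_of_pos ha0]
      calc (a : ℝ) * |(a : ℝ) ^ j * (θ - z)| < a * (1 / (2 * a)) := by gcongr
        _ = 1 / 2 := by field_simp
  have h1 := (hu m le_rfl).1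
  have h2 : (1 : ℝ) ≤ |(d : ℝ) * (θ - z)| := by
    have e : (d : ℝ) * (θ - z) = ((b - d * z : ℤ) : ℝ) := by
      rw [mul_sub, hb]; push_cast; ring
    rw [e]
    have : b - d * z ≠ 0 := by
      intro h
      rw [h, Int.cast_zero] at e
      have hd' : (d : ℝ) ≠ 0 := by positivity
      exact hθ z (by linarith [(mul_eq_zero.1 e).resolve_left hd'])
    exact_mod_cast Int.one_le_abs this
  have h3 : |(d : ℝ) * (θ - z)| ≤ |(a : ℝ) ^ m * (θ - z)| := by
    rw [abs_mul, abs_mul, abs_of_nonneg (by positivity : (0 : ℝ) ≤ d),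
      abs_of_pos (by positivity : (0 : ℝ) < (a : ℝ) ^ m)]
    refine mul_le_mul_of_nonneg_right ?_ (abs_nonneg _)
    exact_mod_cast hd
  linarith

variable {a : ℕ} {μ : Measure ℤ} [IsProbabilityMeasure μ]

lemma ft_law_add (hfin : (atoms μ).Finite) (m n : ℕ) (θ : ℝ) :
    ft (law a μ (m + n)) θ = ft (law a μ m) θ * ft (law a μ n) ((a : ℝ) ^ m * θ) := by
  rw [law_add, ft_conv (finite_atoms_law hfin m) (finite_atoms_dilate (finite_atoms_law hfin n)),
    ft_dilate]
  push_cast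
  rfl

lemma norm_ft_law_le_of_lt (hfin : (atoms μ).Finite) {j m : ℕ} (hj : j < m) (θ : ℝ) :
    ‖ft (law a μ m) θ‖ ≤ ‖ft μ ((a : ℝ) ^ j * θ)‖ := by
  obtain ⟨l, rfl⟩ : ∃ l, m = j + (1 + l) := ⟨m - j - 1, by omega⟩
  rw [ft_law_add hfin, ft_law_add hfin, law_one, norm_mul, norm_mul]
  have h1 := norm_ft_le_one (law a μ j) θ
  have h2 := norm_ft_le_one (law a μ l) ((a : ℝ) ^ 1 * ((a : ℝ) ^ j * θ))
  calc _ ≤ 1 * (‖ft μ ((a : ℝ) ^ j * θ)‖ * 1) := by gcongr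
    _ = _ := by ring

/-- By Bézout, θ is an integer combination of dθ and Nθ. -/
lemma coprime_mul_ne_int {d N : ℕ} (hdN : Nat.Coprime d N) {θ : ℝ} {b : ℤ}
    (hb : (d : ℝ) * θ = b) (hθ : ∀ z : ℤ, θ ≠ z) (z : ℤ) : (N : ℝ) * θ ≠ z := by
  intro h
  have hbez := Nat.gcd_eq_gcd_ab d N
  rw [hdN] at hbez
  apply hθ (b * d.gcdA N + z * d.gcdB N)
  have : ((1 : ℕ) : ℝ) = d * (d.gcdA N : ℝ) + N * (d.gcdB N : ℝ) := by exact_mod_cast hbez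
  push_cast at this ⊢
  calc θ = 1 * θ := (one_mul _).symm
    _ = (d * θ) * (d.gcdA N : ℝ) + (N * θ) * (d.gcdB N : ℝ) := by rw [this]; ring
    _ = _ := by rw [hb, h]

/-- Exponential decay of the Fourier transform of `μ_w` at nontrivial fractions whose denominators
are at most `a^m` and coprime to `a`. -/
lemma norm_ft_law_le (ha : 1 < a) (hfin : (atoms μ).Finite) {r : ℝ} (hr0 : 0 < r)
    (hr : ∀ θ : ℝ, 1 / (2 * a : ℝ) ≤ Int.fract θ → Int.fract θ ≤ 1 - 1 / (2 * a : ℝ) →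
      ‖ft μ θ‖ ≤ r) {m d : ℕ} (hd0 : 0 < d) (hd : d ≤ a ^ m) (hda : Nat.Coprime d a) (l : ℕ) :
    ∀ (θ : ℝ) (b : ℤ), (d : ℝ) * θ = b → (∀ z : ℤ, θ ≠ z) → ∀ w, m * l ≤ w →
      ‖ft (law a μ w) θ‖ ≤ r ^ l := by
  induction l with
  | zero => intro θ _ _ _ w _; simpa using norm_ft_le_one _ θ
  | succ l ih =>
    intro θ b hb hθ w hw
    -- One window of m digits is peeled off and yields one factor r. What remains is evaluated at
    -- a^m θ, which is again a nontrivial fraction of denominator d because d is prime to a.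
    obtain ⟨w', rfl⟩ : ∃ w', w = m + w' := ⟨w - m, by
      have : m * (l + 1) = m * l + m := by ring
      omega⟩
    rw [ft_law_add hfin, norm_mul, pow_succ']
    obtain ⟨j, hj, h1, h2⟩ := exists_far_from_int ha hd0 hd hb hθ
    have h3 := (norm_ft_law_le_of_lt (a := a) hfin hj θ).trans (hr _ h1 h2)
    have h4 := ih ((a : ℝ) ^ m * θ) ((a : ℤ) ^ m * b) (by push_cast; rw [← hb]; ring)
      (by
        have := coprime_mul_ne_int (hda.pow_right m) hb hθ
        push_cast at this
        exact this) w' (by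
        have : m * (l + 1) = m * l + m := by ring
        omega)
    gcongr

end Window

/-! ### The large sieve inequality. -/

section LargeSieve

/-- Duality principle combined with Schur's test. -/
lemma sum_norm_sq_le_of_gram {ι : Type*} (T : Finset ι) (L : ℕ) (e : ι → ℕ → ℂ) (c : ℕ → ℂ) {B : ℝ}
    (hB0 : 0 ≤ B) (hB : ∀ r ∈ T, ∑ s ∈ T, ‖∑ n ∈ Finset.range L, (starRingEnd ℂ) (e r n) * e s n‖ ≤ B) :
    ∑ r ∈ T, ‖∑ n ∈ Finset.range L, c n * e r n‖ ^ 2 ≤ B * ∑ n ∈ Finset.range L, ‖c n‖ ^ 2 := by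
  set S : ι → ℂ := fun r => ∑ n ∈ Finset.range L, c n * e r n with hS
  set X : ℝ := ∑ r ∈ T, ‖S r‖ ^ 2 with hX
  set G : ι → ι → ℂ := fun r s => ∑ n ∈ Finset.range L, (starRingEnd ℂ) (e r n) * e s n with hG
  set U : ℕ → ℂ := fun n => ∑ r ∈ T, (starRingEnd ℂ) (S r) * e r n with hU
  have hGsymm : ∀ r s, ‖G r s‖ = ‖G s r‖ := by
    intro r s
    rw [← Complex.norm_conj (G s r)]
    congr 1
    simp only [hG, map_sum, map_mul, Complex.conj_conj]
    exact Finset.sum_congr rfl fun n _ => mul_comm _ _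
  -- Duality: X is the pairing of c with the dual sum U. Cauchy–Schwarz gives X² ≤ ‖c‖² ‖U‖², and
  -- ‖U‖² ≤ BX then allows division by X.
  have hX1 : (X : ℂ) = ∑ n ∈ Finset.range L, c n * U n := by
    have : (X : ℂ) = ∑ r ∈ T, (starRingEnd ℂ) (S r) * S r := by
      rw [hX]; push_cast
      exact Finset.sum_congr rfl fun r _ => by rw [mul_comm, Complex.mul_conj']
    rw [this]
    simp only [hU, Finset.mul_sum]
    rw [Finset.sum_comm]
    refine Finset.sum_congr rfl fun r _ => ?_
    conv_lhs => rw [hS]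
    simp only [Finset.mul_sum]
    refine Finset.sum_congr rfl fun n _ => ?_
    ring
  have hX0 : 0 ≤ X := Finset.sum_nonneg fun r _ => by positivity
  have hc0 : 0 ≤ ∑ n ∈ Finset.range L, ‖c n‖ ^ 2 := Finset.sum_nonneg fun n _ => by positivity
  have hX2 : X ^ 2 ≤ (∑ n ∈ Finset.range L, ‖c n‖ ^ 2) * ∑ n ∈ Finset.range L, ‖U n‖ ^ 2 := by
    have h1 : X ≤ ∑ n ∈ Finset.range L, ‖c n‖ * ‖U n‖ := by
      have : X = ‖(X : ℂ)‖ := by simp [abs_of_nonneg hX0]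
      rw [this, hX1]
      exact (norm_sum_le _ _).trans (Finset.sum_le_sum fun n _ => (norm_mul _ _).le)
    calc X ^ 2 ≤ (∑ n ∈ Finset.range L, ‖c n‖ * ‖U n‖) ^ 2 := by gcongr
      _ ≤ _ := Finset.sum_mul_sq_le_sq_mul_sq _ _ _
  -- Schur's test: expanding |U|² produces the Gram matrix G, and 2|S_r S_s| ≤ |S_r|² + |S_s|²
  -- reduces the double sum to row sums, by the symmetry of |G|.
  have hU1 : ∑ n ∈ Finset.range L, ‖U n‖ ^ 2 ≤ B * X := by
    have h1 : ((∑ n ∈ Finset.range L, ‖U n‖ ^ 2 : ℝ) : ℂ) =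
        ∑ r ∈ T, ∑ s ∈ T, S r * (starRingEnd ℂ) (S s) * G r s := by
      push_cast
      have : ∀ n, ((‖U n‖ : ℂ)) ^ 2 = ∑ r ∈ T, ∑ s ∈ T,
          S r * (starRingEnd ℂ) (S s) * ((starRingEnd ℂ) (e r n) * e s n) := by
        intro n
        rw [← Complex.conj_mul']
        simp only [hU, map_sum, map_mul, Complex.conj_conj]
        rw [Finset.sum_mul_sum]
        refine Finset.sum_congr rfl fun r _ => Finset.sum_congr rfl fun s _ => ?_
        ring
      simp only [this, hG, Finset.mul_sum]
      rw [Finset.sum_comm]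
      refine Finset.sum_congr rfl fun r _ => ?_
      rw [Finset.sum_comm]
    have h2 : ∑ n ∈ Finset.range L, ‖U n‖ ^ 2 ≤
        ∑ r ∈ T, ∑ s ∈ T, (‖S r‖ ^ 2 / 2 * ‖G r s‖ + ‖S s‖ ^ 2 / 2 * ‖G r s‖) := by
      have h0 : 0 ≤ ∑ n ∈ Finset.range L, ‖U n‖ ^ 2 := Finset.sum_nonneg fun n _ => by positivity
      calc ∑ n ∈ Finset.range L, ‖U n‖ ^ 2
          = ‖((∑ n ∈ Finset.range L, ‖U n‖ ^ 2 : ℝ) : ℂ)‖ := by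
            rw [Complex.norm_real, Real.norm_of_nonneg h0]
        _ ≤ ∑ r ∈ T, ∑ s ∈ T, ‖S r * (starRingEnd ℂ) (S s) * G r s‖ := by
            rw [h1]
            exact (norm_sum_le _ _).trans (Finset.sum_le_sum fun r _ => norm_sum_le _ _)
        _ ≤ _ := by
            refine Finset.sum_le_sum fun r _ => Finset.sum_le_sum fun s _ => ?_
            rw [norm_mul, norm_mul, Complex.norm_conj, ← add_mul]
            gcongr
            nlinarith [sq_nonneg (‖S r‖ - ‖S s‖)]
    refine h2.trans ?_
    simp only [Finset.sum_add_distrib]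
    have h3 : ∑ r ∈ T, ∑ s ∈ T, ‖S s‖ ^ 2 / 2 * ‖G r s‖ =
        ∑ r ∈ T, ∑ s ∈ T, ‖S r‖ ^ 2 / 2 * ‖G r s‖ := by
      rw [Finset.sum_comm]
      exact Finset.sum_congr rfl fun r _ => Finset.sum_congr rfl fun s _ => by rw [hGsymm]
    rw [h3, ← two_mul, hX, Finset.mul_sum, Finset.mul_sum]
    refine Finset.sum_le_sum fun r hr => ?_
    rw [← Finset.mul_sum]
    have := hB r hr
    calc 2 * (‖S r‖ ^ 2 / 2 * ∑ s ∈ T, ‖G r s‖) = ‖S r‖ ^ 2 * ∑ s ∈ T, ‖G r s‖ := by ring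
      _ ≤ ‖S r‖ ^ 2 * B := by gcongr
      _ = B * ‖S r‖ ^ 2 := mul_comm _ _
  rcases hX0.eq_or_lt with h0 | h0
  · rw [← h0]
    positivity
  · have : X * X ≤ (B * ∑ n ∈ Finset.range L, ‖c n‖ ^ 2) * X := by
      calc X * X = X ^ 2 := (sq X).symm
        _ ≤ _ := hX2
        _ ≤ (∑ n ∈ Finset.range L, ‖c n‖ ^ 2) * (B * X) := by gcongr
        _ = _ := by ring
    exact le_of_mul_le_mul_right this h0

/-- The geometric sum is at most 2/|e(t) - 1|, and sin(πf) ≥ 2 min(f, 1 - f) on [0,1]. The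
reciprocal of the minimum is relaxed to a sum over t and -t, so that `sum_inv_fract_le` applies to
each part. -/
lemma norm_geom_expi_le (L : ℕ) {t : ℝ} (ht : 0 < Int.fract t) :
    ‖∑ n ∈ Finset.range L, expi (n * t)‖ ≤ 1 / (2 * Int.fract t) + 1 / (2 * Int.fract (-t)) := by
  have hneg : Int.fract (-t) = 1 - Int.fract t := Int.fract_neg ht.ne'
  rw [hneg]
  set f := Int.fract t with hf
  have hf1 : f < 1 := Int.fract_lt_one t
  have h1 : ‖∑ n ∈ Finset.range L, expi (n * t)‖ * ‖expi t - 1‖ ≤ 2 := by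
    rw [← norm_mul]
    simp only [expi_natCast_mul]
    rw [geom_sum_mul]
    calc ‖expi t ^ L - 1‖ ≤ ‖expi t ^ L‖ + ‖(1 : ℂ)‖ := norm_sub_le _ _
      _ = 2 := by rw [norm_pow, norm_expi]; norm_num
  have h2 : ‖expi t - 1‖ = 2 * Real.sin (Real.pi * f) := by
    rw [← expi_fract, ← hf]
    have : expi f = Complex.exp (Complex.I * ((2 * Real.pi * f : ℝ) : ℂ)) := by
      rw [expi]; congr 1; push_cast; ring
    rw [this, Complex.norm_exp_I_mul_ofReal_sub_one]
    have h3 : 0 ≤ Real.sin (Real.pi * f) := Real.sin_nonneg_of_nonneg_of_le_pi (by positivity)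
      (by nlinarith [Real.pi_pos])
    rw [show 2 * Real.pi * f / 2 = Real.pi * f by ring, Real.norm_of_nonneg (by positivity)]
  have h4 : 2 * min f (1 - f) ≤ Real.sin (Real.pi * f) := by
    have hpi := Real.pi_pos
    rcases le_total f (1 / 2) with h | h
    · have := Real.mul_le_sin (x := Real.pi * f) (by positivity) (by nlinarith)
      calc 2 * min f (1 - f) ≤ 2 * f := by gcongr; exact min_le_left _ _
        _ = 2 / Real.pi * (Real.pi * f) := by field_simp
        _ ≤ _ := this
    · have := Real.mul_le_sin (x := Real.pi * (1 - f)) (by nlinarith) (by nlinarith)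
      calc 2 * min f (1 - f) ≤ 2 * (1 - f) := by gcongr; exact min_le_right _ _
        _ = 2 / Real.pi * (Real.pi * (1 - f)) := by field_simp
        _ ≤ _ := this
        _ = Real.sin (Real.pi * f) := by
          rw [← Real.sin_pi_sub]; congr 1; ring
  have hm : 0 < min f (1 - f) := lt_min ht (by linarith)
  have h5 : ‖∑ n ∈ Finset.range L, expi (n * t)‖ ≤ 1 / (2 * min f (1 - f)) := by
    rw [le_div_iff₀ (by positivity)]
    rw [h2] at h1
    nlinarith [norm_nonneg (∑ n ∈ Finset.range L, expi (n * t))]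
  refine h5.trans ?_
  have : 0 < 1 - f := by linarith
  rcases le_total f (1 - f) with h | h
  · rw [min_eq_left h]; have : 0 ≤ 1 / (2 * (1 - f)) := by positivity
    linarith
  · rw [min_eq_right h]; have : 0 ≤ 1 / (2 * f) := by positivity
    linarith

/-- The separation puts the fractional parts into different cells ⌊K{x}⌋, and the cell 0 is empty.
Replacing each fractional part by the left end of its cell gives a harmonic sum. -/
lemma sum_inv_fract_le {ι : Type*} (T : Finset ι) (x : ι → ℝ) {K : ℕ} (hK : 0 < K)
    (h0 : ∀ s ∈ T, 1 / (K : ℝ) ≤ Int.fract (x s))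
    (hsep : ∀ r ∈ T, ∀ s ∈ T, r ≠ s → ∀ m : ℤ, 1 / (K : ℝ) ≤ |x r - x s - m|) :
    ∑ s ∈ T, 1 / Int.fract (x s) ≤ K * (1 + Real.log K) := by
  have hK' : (0 : ℝ) < K := by exact_mod_cast hK
  set j : ι → ℕ := fun s => ⌊K * Int.fract (x s)⌋₊ with hj
  have hle : ∀ s, (j s : ℝ) ≤ K * Int.fract (x s) := fun s =>
    Nat.floor_le (mul_nonneg hK'.le (Int.fract_nonneg _))
  have hlt : ∀ s, K * Int.fract (x s) < j s + 1 := fun s => Nat.lt_floor_add_one _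
  have hj1 : ∀ s ∈ T, 1 ≤ j s := by
    intro s hs
    rw [hj, Nat.one_le_floor_iff]
    have := h0 s hs
    rw [div_le_iff₀ hK'] at this
    linarith
  have hjK : ∀ s ∈ T, j s ∈ Finset.Icc 1 K := by
    intro s hs
    rw [Finset.mem_Icc]
    refine ⟨hj1 s hs, ?_⟩
    have h1 : (j s : ℝ) ≤ K := (hle s).trans (by
      have := (Int.fract_lt_one (x s)).le
      nlinarith)
    exact_mod_cast h1
  have hinj : Set.InjOn j T := by
    intro r hr s hs hrs
    by_contra hne
    have h1 := hsep r hr s hs hne (⌊x r⌋ - ⌊x s⌋)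
    have h2 : x r - x s - ((⌊x r⌋ - ⌊x s⌋ : ℤ) : ℝ) = Int.fract (x r) - Int.fract (x s) := by
      rw [Int.fract, Int.fract]; push_cast; ring
    rw [h2, div_le_iff₀ hK'] at h1
    have h3 : |Int.fract (x r) - Int.fract (x s)| * K < 1 := by
      rw [← abs_of_pos hK', ← abs_mul, abs_lt]
      have a1 := hle r; have a2 := hle s; have a3 := hlt r; have a4 := hlt s
      rw [hrs] at a1 a3
      constructor <;> nlinarith
    linarith
  calc ∑ s ∈ T, 1 / Int.fract (x s) ≤ ∑ s ∈ T, (K : ℝ) * (1 / (j s : ℝ)) := by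
        refine Finset.sum_le_sum fun s hs => ?_
        have hp : (0 : ℝ) < j s := by exact_mod_cast hj1 s hs
        have hf : 0 < Int.fract (x s) := lt_of_lt_of_le (by positivity) (h0 s hs)
        rw [mul_one_div, div_le_div_iff₀ hf hp]
        linarith [hle s]
    _ = ∑ i ∈ T.image j, (K : ℝ) * (1 / (i : ℝ)) := by rw [Finset.sum_image hinj]
    _ ≤ ∑ i ∈ Finset.Icc 1 K, (K : ℝ) * (1 / (i : ℝ)) := by
        refine Finset.sum_le_sum_of_subset_of_nonneg ?_ fun _ _ _ => by positivity
        intro i hi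
        obtain ⟨s, hs, rfl⟩ := Finset.mem_image.1 hi
        exact hjK s hs
    _ = K * (harmonic K : ℝ) := by
        rw [← Finset.mul_sum, harmonic_eq_sum_Icc]; push_cast; simp
    _ ≤ _ := by
        gcongr
        exact harmonic_le_one_add_log K

/-- A large sieve inequality, with a logarithmic loss. -/
lemma large_sieve {ι : Type*} (T : Finset ι) (θ : ι → ℝ) {K : ℕ} (hK : 0 < K)
    (hsep : ∀ r ∈ T, ∀ s ∈ T, r ≠ s → ∀ m : ℤ, 1 / (K : ℝ) ≤ |θ r - θ s - m|)
    (L : ℕ) (c : ℕ → ℂ) :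
    ∑ r ∈ T, ‖∑ n ∈ Finset.range L, c n * expi (n * θ r)‖ ^ 2 ≤
      (L + K * (1 + Real.log K)) * ∑ n ∈ Finset.range L, ‖c n‖ ^ 2 := by
  classical
  have hK' : (0 : ℝ) < K := by exact_mod_cast hK
  have hlog : 0 ≤ Real.log K := Real.log_natCast_nonneg K
  refine sum_norm_sq_le_of_gram T L (fun r n => expi (n * θ r)) c (by positivity) fun r hr => ?_
  have hgram : ∀ s, ∑ n ∈ Finset.range L, (starRingEnd ℂ) (expi (n * θ r)) * expi (n * θ s) =
      ∑ n ∈ Finset.range L, expi (n * (θ s - θ r)) := by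
    intro s
    refine Finset.sum_congr rfl fun n _ => ?_
    rw [conj_expi, ← expi_add]; congr 1; ring
  simp only [hgram]
  rw [← Finset.add_sum_erase T _ hr]
  have hfr : ∀ r ∈ T, ∀ s ∈ T, r ≠ s → 1 / (K : ℝ) ≤ Int.fract (θ r - θ s) := by
    intro r hr s hs hrs
    have := hsep r hr s hs hrs ⌊θ r - θ s⌋
    rwa [Int.self_sub_floor, abs_of_nonneg (Int.fract_nonneg _)] at this
  have h1 : ‖∑ n ∈ Finset.range L, expi (n * (θ r - θ r))‖ ≤ L := by
    simp [expi_zero]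
  have h2 : ∑ s ∈ T.erase r, 1 / Int.fract (θ s - θ r) ≤ K * (1 + Real.log K) := by
    refine sum_inv_fract_le (T.erase r) (fun s => θ s - θ r) hK ?_ ?_
    · intro s hs
      rw [Finset.mem_erase] at hs
      exact hfr s hs.2 r hr hs.1
    · intro s hs s' hs' hne m
      have := hsep s (Finset.mem_of_mem_erase hs) s' (Finset.mem_of_mem_erase hs') hne m
      rwa [show θ s - θ r - (θ s' - θ r) = θ s - θ s' by ring]
  have h3 : ∑ s ∈ T.erase r, 1 / Int.fract (θ r - θ s) ≤ K * (1 + Real.log K) := by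
    refine sum_inv_fract_le (T.erase r) (fun s => θ r - θ s) hK ?_ ?_
    · intro s hs
      rw [Finset.mem_erase] at hs
      exact hfr r hr s hs.2 hs.1.symm
    · intro s hs s' hs' hne m
      have := hsep s' (Finset.mem_of_mem_erase hs') s (Finset.mem_of_mem_erase hs) hne.symm m
      rwa [show θ r - θ s - (θ r - θ s') = θ s' - θ s by ring]
  have h4 : ∑ s ∈ T.erase r, ‖∑ n ∈ Finset.range L, expi (n * (θ s - θ r))‖ ≤
      ∑ s ∈ T.erase r, (1 / 2 * (1 / Int.fract (θ s - θ r)) +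
        1 / 2 * (1 / Int.fract (θ r - θ s))) := by
    refine Finset.sum_le_sum fun s hs => ?_
    rw [Finset.mem_erase] at hs
    have hp : 0 < Int.fract (θ s - θ r) :=
      lt_of_lt_of_le (by positivity) (hfr s hs.2 r hr hs.1)
    have := norm_geom_expi_le L hp
    rw [neg_sub] at this
    refine this.trans (le_of_eq ?_)
    rw [one_div_mul_one_div, one_div_mul_one_div]
  rw [Finset.sum_add_distrib, ← Finset.mul_sum, ← Finset.mul_sum] at h4
  linarith

/-- The large sieve inequality for measures on an interval. -/
lemma large_sieve_measure {ι : Type*} (T : Finset ι) (θ : ι → ℝ) {K : ℕ} (hK : 0 < K)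
    (hsep : ∀ r ∈ T, ∀ s ∈ T, r ≠ s → ∀ m : ℤ, 1 / (K : ℝ) ≤ |θ r - θ s - m|)
    {ρ : Measure ℤ} [IsProbabilityMeasure ρ] {N : ℕ} (hN : ∀ x ∈ atoms ρ, |x| ≤ N)
    {B : ℝ} (hB : ∀ x, ρ.real {x} ≤ B) :
    ∑ r ∈ T, ‖ft ρ (θ r)‖ ^ 2 ≤ (2 * N + 1 + K * (1 + Real.log K)) * B := by
  -- Translating [-N, N] to {0, …, 2N} only changes the transform by a phase.
  set sh : ℕ → ℤ := fun n => (n : ℤ) - N with hsh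
  have hinj : Function.Injective sh := fun m n h => by simpa [hsh] using h
  have hsub : atoms ρ ⊆ ((Finset.range (2 * N + 1)).image sh : Finset ℤ) := by
    intro x hx
    have := abs_le.1 (hN x hx)
    simp only [Finset.coe_image, Set.mem_image, Finset.coe_range, Set.mem_Iio, hsh]
    exact ⟨(x + N).toNat, by omega, by omega⟩
  have h1 : ∀ t, ‖ft ρ t‖ = ‖∑ n ∈ Finset.range (2 * N + 1), (ρ.real {sh n} : ℂ) * expi (n * t)‖ := by
    intro t
    rw [ft_eq_sum hsub, Finset.sum_image hinj.injOn]
    have : ∀ n : ℕ, (ρ.real {sh n} : ℂ) * expi (sh n * t) =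
        expi (-(N * t)) * ((ρ.real {sh n} : ℂ) * expi (n * t)) := by
      intro n
      have : expi (sh n * t) = expi (-(N * t)) * expi (n * t) := by
        rw [← expi_add, hsh]; congr 1; push_cast; ring
      rw [this]; ring
    simp only [this]
    rw [← Finset.mul_sum, norm_mul, norm_expi, one_mul]
  simp only [h1]
  refine (large_sieve T θ hK hsep (2 * N + 1) _).trans ?_
  have hlog : 0 ≤ Real.log K := Real.log_natCast_nonneg K
  push_cast
  gcongr
  have hs1 : ∑ n ∈ Finset.range (2 * N + 1), ρ.real {sh n} = 1 := by
    rw [← Finset.sum_image (f := fun x => ρ.real {x}) hinj.injOn]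
    exact sum_real_eq_one hsub
  calc ∑ n ∈ Finset.range (2 * N + 1), ‖(ρ.real {sh n} : ℂ)‖ ^ 2
      ≤ ∑ n ∈ Finset.range (2 * N + 1), B * ρ.real {sh n} := by
        refine Finset.sum_le_sum fun n _ => ?_
        rw [Complex.norm_real, Real.norm_of_nonneg measureReal_nonneg, sq]
        exact mul_le_mul_of_nonneg_right (hB _) measureReal_nonneg
    _ = B := by rw [← Finset.mul_sum, hs1, mul_one]

end LargeSieve

/-! ### From residues modulo q to sums over Farey fractions. -/

section Reduction

lemma real_unif (q : ℕ) [NeZero q] (x : ZMod q) : (unif q).real {x} = 1 / q := by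
  rw [unif, Measure.real, ProbabilityTheory.uniformOn_univ]
  simp [ZMod.card]

lemma sum_range_zmod {M : Type*} [AddCommMonoid M] (q : ℕ) [NeZero q] (g : ZMod q → M) :
    ∑ b ∈ Finset.range q, g (b : ZMod q) = ∑ b : ZMod q, g b := by
  refine Finset.sum_nbij' (fun b => (b : ZMod q)) (fun z => z.val) ?_ ?_ ?_ ?_ ?_
  · simp
  · intro z _; simpa using ZMod.val_lt z
  · intro b hb; exact ZMod.val_cast_of_lt (by simpa using hb)
  · intro z _; exact ZMod.natCast_zmod_val z
  · simp

lemma ft_div_eq_sum (q : ℕ) [NeZero q] (lam : Measure ℤ) [IsProbabilityMeasure lam] (b : ℕ) :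
    ft lam ((b : ℝ) / q) =
      ∑ z : ZMod q, ((modq q lam).real {z} : ℂ) * ZMod.stdAddChar ((b : ZMod q) * z) := by
  have : IsProbabilityMeasure (modq q lam) :=
    Measure.isProbabilityMeasure_map (measurable_of_countable _).aemeasurable
  have h1 := integral_eq_sum (μ := modq q lam) (s := Finset.univ) (by simp)
    (fun z : ZMod q => (ZMod.stdAddChar ((b : ZMod q) * z) : ℂ))
  rw [modq, integral_map_countable] at h1
  simp only [Complex.real_smul] at h1
  rw [modq, ← h1, ft]
  congr 1; ext x
  have : (b : ZMod q) * (x : ZMod q) = (((b : ℤ) * x : ℤ) : ZMod q) := by push_cast; rfl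
  rw [this, ZMod.stdAddChar_coe, expi]
  congr 1; push_cast; ring

/-- Parseval's formula on `ℤ / qℤ`. -/
lemma mul_l2DistSq_eq (q : ℕ) [NeZero q] (lam : Measure ℤ) [IsProbabilityMeasure lam] :
    (q : ℝ) * l2DistSq (modq q lam) (unif q) =
      ∑ b ∈ Finset.Ioo 0 q, ‖ft lam ((b : ℝ) / q)‖ ^ 2 := by
  have : IsProbabilityMeasure (modq q lam) :=
    Measure.isProbabilityMeasure_map (measurable_of_countable _).aemeasurable
  set p : ZMod q → ℝ := fun z => (modq q lam).real {z} with hp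
  have hq : (q : ℝ) ≠ 0 := by exact_mod_cast NeZero.ne q
  have hp1 : ∑ z, p z = 1 := sum_real_eq_one (by simp)
  have h1 : (q : ℝ) * l2DistSq (modq q lam) (unif q) = q * ∑ z, p z ^ 2 - 1 := by
    rw [l2DistSq, tsum_fintype]
    simp only [real_unif, sub_sq, Finset.sum_add_distrib, Finset.sum_sub_distrib]
    rw [← Finset.sum_mul, ← Finset.mul_sum, hp1]
    simp only [Finset.sum_const, Finset.card_univ, ZMod.card, nsmul_eq_mul]
    field_simp
    ring
  have h2 : ∑ b ∈ Finset.range q, ‖ft lam ((b : ℝ) / q)‖ ^ 2 = q * ∑ z, p z ^ 2 := by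
    have h3 : ((∑ b ∈ Finset.range q, ‖ft lam ((b : ℝ) / q)‖ ^ 2 : ℝ) : ℂ) =
        ((q * ∑ z, p z ^ 2 : ℝ) : ℂ) := by
      have h4 : ∀ b : ℕ, ((‖ft lam ((b : ℝ) / q)‖ : ℂ)) ^ 2 = ∑ z, ∑ w,
          (p z * p w : ℂ) * ZMod.stdAddChar ((b : ZMod q) * (w - z)) := by
        intro b
        rw [← Complex.conj_mul', ft_div_eq_sum, map_sum, Finset.sum_mul_sum]
        refine Finset.sum_congr rfl fun z _ => Finset.sum_congr rfl fun w _ => ?_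
        rw [map_mul, Complex.conj_ofReal, ← AddChar.map_neg_eq_conj, mul_mul_mul_comm,
          ← AddChar.map_add_eq_mul]
        congr 2; ring
      push_cast
      simp only [h4]
      rw [sum_range_zmod q (fun b => ∑ z, ∑ w,
          (p z * p w : ℂ) * ZMod.stdAddChar (b * (w - z))), Finset.sum_comm, Finset.mul_sum]
      refine Finset.sum_congr rfl fun z _ => ?_
      rw [Finset.sum_comm]
      simp only [← Finset.mul_sum, AddChar.sum_mulShift _ (ZMod.isPrimitive_stdAddChar q)]
      simp only [sub_eq_zero, ZMod.card]
      simp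
      ring
    exact_mod_cast h3
  rw [h1, ← h2]
  -- The zero frequency contributes exactly 1, which is what subtracting the uniform measure
  -- removes.
  have h0 : ‖ft lam (((0 : ℕ) : ℝ) / q)‖ ^ 2 = 1 := by simp [ft, expi_zero]
  have : Finset.range q = insert 0 (Finset.Ioo 0 q) := by
    ext b; simp only [Finset.mem_range, Finset.mem_insert, Finset.mem_Ioo]
    have := NeZero.pos q
    omega
  rw [this, Finset.sum_insert (by simp), h0]; ring

/-- Rationals in `(0, 1)` with denominator at most `N` and coprime to `a`. -/
def fareySet (a N : ℕ) : Finset ℚ :=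
  (((Finset.Icc 1 N) ×ˢ (Finset.range (N + 1))).image (fun p : ℕ × ℕ => (p.2 : ℚ) / p.1)).filter
    (fun r => 0 < r ∧ r < 1 ∧ r.den ≤ N ∧ Nat.Coprime r.den a)

lemma mem_fareySet {a N : ℕ} {r : ℚ} :
    r ∈ fareySet a N ↔ 0 < r ∧ r < 1 ∧ r.den ≤ N ∧ Nat.Coprime r.den a := by
  rw [fareySet, Finset.mem_filter, and_iff_right_iff_imp]
  rintro ⟨h0, h1, h2, -⟩
  rw [Finset.mem_image]
  have hnum : 0 < r.num := Rat.num_pos.2 h0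
  have hlt : r.num < r.den := by rwa [← Rat.num_lt_denom_iff] at h1
  refine ⟨(r.den, r.num.natAbs), ?_, ?_⟩
  · simp only [Finset.mem_product, Finset.mem_Icc, Finset.mem_range]
    have := r.pos
    omega
  · have : ((r.num.natAbs : ℕ) : ℚ) = r.num := by
      rw [Nat.cast_natAbs, abs_of_pos hnum]
    simp only [this]
    exact Rat.num_div_den r

lemma card_fareySet_le (a N : ℕ) : (fareySet a N).card ≤ N * (N + 1) := by
  refine (Finset.card_filter_le _ _).trans (Finset.card_image_le.trans ?_)
  simp

/-- If b/q = r, then q is a multiple of the denominator of r and q determines b. So r occurs at most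
N / r.den times. -/
lemma sum_reduction_le_farey (a N : ℕ) (F : ℝ → ℝ) (hF : ∀ t, 0 ≤ F t) :
    ∑ q ∈ Finset.Icc 1 N with Nat.Coprime q a, ∑ b ∈ Finset.Ioo 0 q, F ((b : ℝ) / q) ≤
      ∑ r ∈ fareySet a N, ((N : ℝ) / r.den) * F r := by
  classical
  rw [Finset.sum_sigma']
  set A := ((Finset.Icc 1 N).filter (Nat.Coprime · a)).sigma (fun q => Finset.Ioo 0 q) with hA
  have hmem : ∀ p ∈ A, 1 ≤ p.1 ∧ p.1 ≤ N ∧ Nat.Coprime p.1 a ∧ 0 < p.2 ∧ p.2 < p.1 := by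
    intro p hp
    simp only [hA, Finset.mem_sigma, Finset.mem_filter, Finset.mem_Icc, Finset.mem_Ioo] at hp
    tauto
  have hden : ∀ p : (_ : ℕ) × ℕ, ((p.2 : ℚ) / p.1).den ∣ p.1 := by
    intro p
    have := Rat.den_dvd (p.2 : ℤ) (p.1 : ℤ)
    rw [Rat.divInt_eq_div, Int.cast_natCast, Int.cast_natCast] at this
    exact Int.natCast_dvd_natCast.1 this
  have hmaps : ∀ p ∈ A, (p.2 : ℚ) / p.1 ∈ fareySet a N := by
    intro p hp
    obtain ⟨h1, h2, h3, h4, h5⟩ := hmem p hp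
    have hq : (0 : ℚ) < p.1 := by exact_mod_cast h1
    rw [mem_fareySet]
    refine ⟨by positivity, ?_, ?_, ?_⟩
    · rw [div_lt_one hq]; exact_mod_cast h5
    · exact (Nat.le_of_dvd h1 (hden p)).trans h2
    · exact Nat.Coprime.coprime_dvd_left (hden p) h3
  rw [← Finset.sum_fiberwise_of_maps_to hmaps]
  refine Finset.sum_le_sum fun r hr => ?_
  have hconst : ∀ p ∈ A.filter (fun p => (p.2 : ℚ) / p.1 = r), F ((p.2 : ℝ) / p.1) = F r := by
    intro p hp
    rw [← (Finset.mem_filter.1 hp).2]; push_cast; rfl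
  rw [Finset.sum_congr rfl hconst, Finset.sum_const, nsmul_eq_mul]
  refine mul_le_mul_of_nonneg_right ?_ (hF _)
  have hcard : (A.filter (fun p => (p.2 : ℚ) / p.1 = r)).card ≤ N / r.den := by
    rw [← Nat.Ioc_filter_dvd_card_eq_div]
    refine Finset.card_le_card_of_injOn (fun p => p.1) ?_ ?_
    · intro p hp
      rw [Finset.mem_coe, Finset.mem_filter] at hp
      obtain ⟨h1, h2, -⟩ := hmem p hp.1
      rw [Finset.mem_coe, Finset.mem_filter, Finset.mem_Ioc]
      refine ⟨⟨h1, h2⟩, ?_⟩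
      rw [← hp.2]
      exact hden p
    · intro p hp p' hp' h
      rw [Finset.mem_coe, Finset.mem_filter] at hp hp'
      obtain ⟨h1, -⟩ := hmem p hp.1
      have hq : (p.1 : ℚ) ≠ 0 := by
        have : p.1 ≠ 0 := by omega
        exact_mod_cast this
      simp only at h
      have h3 := hp.2.trans hp'.2.symm
      rw [← h, div_left_inj' hq] at h3
      have h4 : p.2 = p'.2 := by exact_mod_cast h3
      obtain ⟨q, b⟩ := p
      obtain ⟨q', b'⟩ := p'
      simp only at h h4
      subst h; subst h4; rfl
  calc _ ≤ ((N / r.den : ℕ) : ℝ) := by exact_mod_cast hcard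
    _ ≤ _ := Nat.cast_div_le

lemma sum_modq_le_farey (a N : ℕ) (lam : Measure ℤ) [IsProbabilityMeasure lam] :
    ∑ q ∈ Finset.Icc 1 N with Nat.Coprime q a, (q : ℝ) * l2DistSq (modq q lam) (unif q) ≤
      ∑ r ∈ fareySet a N, ((N : ℝ) / r.den) * ‖ft lam r‖ ^ 2 := by
  refine le_trans (le_of_eq ?_)
    (sum_reduction_le_farey a N (fun t => ‖ft lam t‖ ^ 2) fun t => by positivity)
  refine Finset.sum_congr rfl fun q hq => ?_
  have : NeZero q := ⟨by
    have := (Finset.mem_Icc.1 (Finset.mem_filter.1 hq).1).1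
    omega⟩
  exact mul_l2DistSq_eq q lam

end Reduction

/-! ### Entropy of the laws μ_n and variance of their information content. -/

section Entropy

open ProbabilityTheory

/-- The information content `-log μ({x})`. -/
def info (μ : Measure ℤ) (x : ℤ) : ℝ := -Real.log (μ.real {x})

lemma entropy_eq_integral {μ : Measure ℤ} [IsProbabilityMeasure μ] (h : (atoms μ).Finite) :
    entropy μ = ∫ x, info μ x ∂μ := by
  obtain ⟨s, hs⟩ := exists_finset_atoms h
  rw [integral_eq_sum hs.le, entropy, tsum_eq_sum (s := s)]
  · exact Finset.sum_congr rfl fun x _ => by simp [Real.negMulLog, info]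
  · intro x hx
    have : x ∉ atoms μ := by rw [hs]; exact hx
    rw [real_eq_zero_of_notMem this, Real.negMulLog_zero]

lemma entropy_nonneg (μ : Measure ℤ) [IsProbabilityMeasure μ] : 0 ≤ entropy μ :=
  tsum_nonneg fun _ => Real.negMulLog_nonneg measureReal_nonneg measureReal_le_one

lemma prod_le_conv_dilate {μ ν : Measure ℤ} [IsProbabilityMeasure μ] [IsProbabilityMeasure ν]
    (b : ℕ) (x y : ℤ) : μ.real {x} * ν.real {y} ≤ (μ.conv (dilate b ν)).real {x + b * y} := by
  rw [Measure.conv, map_measureReal_apply (measurable_of_countable _) (measurableSet_singleton _)]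
  have h1 : ν.real {y} ≤ (dilate b ν).real {(b : ℤ) * y} := by
    rw [dilate, map_measureReal_apply (measurable_of_countable _) (measurableSet_singleton _)]
    exact measureReal_mono (by simp)
  calc μ.real {x} * ν.real {y} ≤ μ.real {x} * (dilate b ν).real {(b : ℤ) * y} := by gcongr
    _ = (μ.prod (dilate b ν)).real {(x, b * y)} := (prod_real_singleton _ _ _ _).symm
    _ ≤ _ := measureReal_mono (by simp)

/-- Each z counts once for every representation z = x + by. Since |x| ≤ Mb, the value y is confined
to an interval of 4M + 1 integers, and y determines x. -/
lemma sum_fiber_le {μ ν : Measure ℤ} [IsProbabilityMeasure μ] [IsProbabilityMeasure ν] {b M : ℕ}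
    (hb : 0 < b) {s t : Finset ℤ} (hs : atoms μ = s) (ht : atoms ν = t)
    (hM : ∀ x ∈ s, |x| ≤ M * b) :
    ∑ p ∈ s ×ˢ t, (μ.conv (dilate b ν)).real {p.1 + b * p.2} ≤ 4 * M + 1 := by
  classical
  set c := μ.conv (dilate b ν)
  set g : ℤ × ℤ → ℤ := fun p => p.1 + b * p.2 with hg
  have hc : atoms c ⊆ ((s ×ˢ t).image g : Finset ℤ) := by
    intro z hz
    rw [show c = μ.conv (dilate b ν) from rfl, atoms_conv, atoms_dilate] at hz
    obtain ⟨⟨x, w⟩, ⟨hx, ⟨y, hy, rfl⟩⟩, rfl⟩ := hz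
    rw [Finset.coe_image]
    refine ⟨(x, y), ?_, rfl⟩
    rw [hs] at hx; rw [ht] at hy
    simp only [Finset.coe_product, Set.mem_prod]
    exact ⟨hx, hy⟩
  have hsum := sum_real_eq_one hc
  have hcard : ∀ z ∈ (s ×ˢ t).image g, ((s ×ˢ t).filter (fun p => g p = z)).card ≤ 4 * M + 1 := by
    intro z hz
    obtain ⟨p₀, hp₀, rfl⟩ := Finset.mem_image.1 hz
    have hI : (Finset.Icc (p₀.2 - 2 * M) (p₀.2 + 2 * M) : Finset ℤ).card = 4 * M + 1 := by
      rw [Int.card_Icc]; omega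
    rw [← hI]
    refine Finset.card_le_card_of_injOn (fun p => p.2) ?_ ?_
    · intro p hp
      rw [Finset.mem_coe, Finset.mem_filter, Finset.mem_product] at hp
      rw [Finset.mem_product] at hp₀
      have h1 := abs_le.1 (hM _ hp.1.1)
      have h2 := abs_le.1 (hM _ hp₀.1)
      have h3 : p.1 + b * p.2 = p₀.1 + b * p₀.2 := hp.2
      have hb' : (0 : ℤ) < b := by exact_mod_cast hb
      rw [Finset.mem_coe, Finset.mem_Icc]
      constructor <;> nlinarith
    · intro p hp p' hp' h
      rw [Finset.mem_coe, Finset.mem_filter] at hp hp'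
      have h3 : p.1 + b * p.2 = p'.1 + b * p'.2 := hp.2.trans hp'.2.symm
      have h4 : p.2 = p'.2 := h
      ext
      · rw [h4] at h3; linarith
      · exact h4
  calc ∑ p ∈ s ×ˢ t, c.real {p.1 + b * p.2}
      = ∑ z ∈ (s ×ˢ t).image g, ∑ p ∈ (s ×ˢ t).filter (fun p => g p = z), c.real {g p} :=
        (Finset.sum_fiberwise_of_maps_to (fun p hp => Finset.mem_image_of_mem g hp) _).symm
    _ ≤ ∑ z ∈ (s ×ˢ t).image g, (4 * M + 1 : ℝ) * c.real {z} := by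
        refine Finset.sum_le_sum fun z hz => ?_
        rw [Finset.sum_congr rfl (g := fun _ => c.real {z})
          (fun p hp => by rw [(Finset.mem_filter.1 hp).2]), Finset.sum_const, nsmul_eq_mul]
        have := hcard z hz
        have : (((s ×ˢ t).filter (fun p => g p = z)).card : ℝ) ≤ 4 * M + 1 := by exact_mod_cast this
        gcongr
    _ = 4 * M + 1 := by rw [← Finset.mul_sum, hsum, mul_one]

/-- With u = p^(1/4), u² |log p| = 4u² |log u| ≤ 4u(1 - u) ≤ 1; then square. -/
lemma mul_log_sq_le_one {p : ℝ} (h0 : 0 < p) (h1 : p ≤ 1) : p * Real.log p ^ 2 ≤ 1 := by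
  have hs : 0 < Real.sqrt p := Real.sqrt_pos.2 h0
  have h2 : Real.log p = 2 * Real.log (Real.sqrt p) := by
    rw [Real.log_sqrt h0.le]; ring
  have hs' : 0 < Real.sqrt (Real.sqrt p) := Real.sqrt_pos.2 hs
  have h4 : Real.log p = 4 * Real.log (Real.sqrt (Real.sqrt p)) := by
    rw [h2, Real.log_sqrt hs.le]; ring
  have h5 : 1 - 1 / Real.sqrt (Real.sqrt p) ≤ Real.log (Real.sqrt (Real.sqrt p)) := by
    have := Real.one_sub_inv_le_log_of_pos hs'
    simpa using this
  have h6 : Real.log (Real.sqrt (Real.sqrt p)) ≤ 0 :=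
    Real.log_nonpos hs'.le (Real.sqrt_le_one.2 (Real.sqrt_le_one.2 h1))
  set u := Real.sqrt (Real.sqrt p) with hu
  have hp : p = u ^ 4 := by
    rw [show u ^ 4 = (u ^ 2) ^ 2 by ring, hu, Real.sq_sqrt hs.le, Real.sq_sqrt h0.le]
  have h7 : |u ^ 2 * Real.log p| ≤ 1 := by
    rw [h4, abs_of_nonpos (by nlinarith [sq_nonneg u])]
    have : -Real.log u ≤ 1 / u - 1 := by linarith
    have h8 : u ^ 2 * (-Real.log u) ≤ u ^ 2 * (1 / u - 1) := by gcongr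
    have h9 : u ^ 2 * (1 / u - 1) = u - u ^ 2 := by field_simp
    nlinarith [sq_nonneg (u - 1 / 2)]
  calc p * Real.log p ^ 2 = (u ^ 2 * Real.log p) ^ 2 := by rw [mul_pow]; rw [hp]; ring
    _ ≤ 1 := by rw [sq_le_one_iff_abs_le_one]; exact h7

/-- The information lost when passing from independent `x`, `y` to `x + b y`. -/
def infoGap (μ ν : Measure ℤ) (b : ℕ) (p : ℤ × ℤ) : ℝ :=
  info μ p.1 + info ν p.2 - info (μ.conv (dilate b ν)) (p.1 + b * p.2)

variable {μ ν : Measure ℤ} [IsProbabilityMeasure μ] [IsProbabilityMeasure ν]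

lemma infoGap_eq {b : ℕ} {p : ℤ × ℤ} (h1 : p.1 ∈ atoms μ) (h2 : p.2 ∈ atoms ν) :
    infoGap μ ν b p = -Real.log (μ.real {p.1} * ν.real {p.2} /
      (μ.conv (dilate b ν)).real {p.1 + b * p.2}) := by
  have p1 := mem_atoms_iff_pos.1 h1
  have p2 := mem_atoms_iff_pos.1 h2
  have p3 := lt_of_lt_of_le (mul_pos p1 p2) (prod_le_conv_dilate b p.1 p.2)
  rw [Real.log_div (by positivity) p3.ne', Real.log_mul p1.ne' p2.ne', infoGap, info, info, info]
  ring

lemma infoGap_nonneg {b : ℕ} {p : ℤ × ℤ} (h1 : p.1 ∈ atoms μ) (h2 : p.2 ∈ atoms ν) :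
    0 ≤ infoGap μ ν b p := by
  have p1 := mem_atoms_iff_pos.1 h1
  have p2 := mem_atoms_iff_pos.1 h2
  have p3 := lt_of_lt_of_le (mul_pos p1 p2) (prod_le_conv_dilate b p.1 p.2)
  rw [infoGap_eq h1 h2, neg_nonneg]
  exact Real.log_nonpos (by positivity) ((div_le_one p3).2 (prod_le_conv_dilate b p.1 p.2))

lemma finite_atoms_prod (hμ : (atoms μ).Finite) (hν : (atoms ν).Finite) :
    (atoms (μ.prod ν)).Finite := by
  rw [atoms_prod]; exact hμ.prod hν

lemma entropy_conv_dilate_le (hμ : (atoms μ).Finite) (hν : (atoms ν).Finite) (b : ℕ) :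
    entropy (μ.conv (dilate b ν)) ≤ entropy μ + entropy ν := by
  have h1 : ∫ z, info (μ.conv (dilate b ν)) z ∂(μ.conv (dilate b ν)) =
      ∫ p, info (μ.conv (dilate b ν)) (p.1 + b * p.2) ∂(μ.prod ν) := by
    rw [integral_conv_atoms hμ (finite_atoms_dilate hν),
      integral_prod _ (integrable_of_atoms (finite_atoms_prod hμ hν) _)]
    congr 1; ext x
    rw [integral_dilate]
  have h2 : ∫ p, (info μ p.1 + info ν p.2) ∂(μ.prod ν) = entropy μ + entropy ν := by
    rw [integral_add (integrable_of_atoms (finite_atoms_prod hμ hν) _)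
      (integrable_of_atoms (finite_atoms_prod hμ hν) _), integral_fun_fst (f := info μ),
      integral_fun_snd (f := info ν), entropy_eq_integral hμ, entropy_eq_integral hν]
    simp
  rw [entropy_eq_integral (finite_atoms_conv hμ (finite_atoms_dilate hν)), h1, ← h2]
  refine integral_mono_atoms (finite_atoms_prod hμ hν) fun p hp => ?_
  rw [atoms_prod] at hp
  have := infoGap_nonneg (b := b) hp.1 hp.2
  rw [infoGap] at this
  linarith

/-- Let P be the mass of a pair and R ≥ P that of its image. Then P log²(P/R) = R · (P/R) log²(P/R)
≤ R, and the sum of R over all pairs is controlled by `sum_fiber_le`. -/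
lemma integral_infoGap_sq_le (hμ : (atoms μ).Finite) (hν : (atoms ν).Finite) {b M : ℕ} (hb : 0 < b)
    (hM : ∀ x ∈ atoms μ, |x| ≤ M * b) :
    ∫ p, infoGap μ ν b p ^ 2 ∂(μ.prod ν) ≤ 4 * M + 1 := by
  obtain ⟨s, hs⟩ := exists_finset_atoms hμ
  obtain ⟨t, ht⟩ := exists_finset_atoms hν
  have hst : atoms (μ.prod ν) ⊆ (s ×ˢ t : Finset (ℤ × ℤ)) := by
    rw [atoms_prod, hs, ht, Finset.coe_product]
  rw [integral_eq_sum hst]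
  refine le_trans (Finset.sum_le_sum fun p hp => ?_)
    (sum_fiber_le (μ := μ) (ν := ν) hb hs ht (by rw [hs] at hM; exact hM))
  rw [Finset.mem_product] at hp
  have h1 : p.1 ∈ atoms μ := by rw [hs]; exact hp.1
  have h2 : p.2 ∈ atoms ν := by rw [ht]; exact hp.2
  have p1 := mem_atoms_iff_pos.1 h1
  have p2 := mem_atoms_iff_pos.1 h2
  have p3 := prod_le_conv_dilate (μ := μ) (ν := ν) b p.1 p.2
  have p4 := lt_of_lt_of_le (mul_pos p1 p2) p3
  rw [infoGap_eq h1 h2, neg_sq, show p = (p.1, p.2) from rfl, prod_real_singleton, smul_eq_mul]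
  simp only
  set R := (μ.conv (dilate b ν)).real {p.1 + b * p.2}
  set P := μ.real {p.1} * ν.real {p.2}
  have hP : 0 < P := mul_pos p1 p2
  have := mul_log_sq_le_one (p := P / R) (by positivity) ((div_le_one p4).2 p3)
  calc P * Real.log (P / R) ^ 2 = R * (P / R * Real.log (P / R) ^ 2) := by field_simp
    _ ≤ R * 1 := by gcongr
    _ = R := mul_one R

/-- The triangle inequality for standard deviations; Cauchy–Schwarz for the covariance comes from
the discriminant of t ↦ Var(tX + Y). -/
lemma sqrt_variance_sub_le {Ω : Type*} [MeasurableSpace Ω] {P : Measure Ω} [IsProbabilityMeasure P]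
    {X Y : Ω → ℝ} (hX : MemLp X 2 P) (hY : MemLp Y 2 P) :
    √(Var[fun ω => X ω - Y ω; P]) ≤ √(Var[X; P]) + √(Var[Y; P]) := by
  have hcs : cov[X, Y; P] ^ 2 ≤ Var[X; P] * Var[Y; P] := by
    have h : ∀ t : ℝ, 0 ≤ Var[X; P] * (t * t) + 2 * cov[X, Y; P] * t + Var[Y; P] := by
      intro t
      have h1 := variance_nonneg (t • X + Y) P
      rw [variance_add (hX.const_smul t) hY, variance_smul, covariance_smul_left] at h1
      linarith
    have := discrim_le_zero h
    rw [discrim] at this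
    linarith
  have hVX := variance_nonneg X P
  have hVY := variance_nonneg Y P
  refine Real.sqrt_le_iff.2 ⟨by positivity, ?_⟩
  rw [variance_fun_sub hX hY, add_sq, Real.sq_sqrt hVX, Real.sq_sqrt hVY]
  have h2 : |cov[X, Y; P]| ≤ √(Var[X; P]) * √(Var[Y; P]) := by
    rw [← Real.sqrt_mul hVX, ← Real.sqrt_sq_eq_abs]
    exact Real.sqrt_le_sqrt hcs
  linarith [neg_abs_le (cov[X, Y; P])]

/-- The information of x + by is that of x plus that of y minus the gap. The first two are
independent, so their variances add, and the gap is bounded in L². -/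
lemma sqrt_variance_info_conv_le (hμ : (atoms μ).Finite) (hν : (atoms ν).Finite) {b M : ℕ}
    (hb : 0 < b) (hM : ∀ x ∈ atoms μ, |x| ≤ M * b) :
    √(Var[info (μ.conv (dilate b ν)); μ.conv (dilate b ν)]) ≤
      √(Var[info μ; μ] + Var[info ν; ν]) + √(4 * M + 1) := by
  have hfin := finite_atoms_prod hμ hν
  have hmap : μ.conv (dilate b ν) = (μ.prod ν).map (fun p : ℤ × ℤ => p.1 + b * p.2) := by
    refine Measure.ext_of_measureReal_singleton fun z => ?_
    rw [← integral_indicator_one (measurableSet_singleton z),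
      ← integral_indicator_one (measurableSet_singleton z),
      integral_conv_atoms hμ (finite_atoms_dilate hν), integral_map_countable,
      integral_prod _ (integrable_of_atoms hfin _)]
    congr 1; ext x
    rw [integral_dilate]
  have h1 : Var[info (μ.conv (dilate b ν)); μ.conv (dilate b ν)] =
      Var[fun p : ℤ × ℤ => (info μ p.1 + info ν p.2) - infoGap μ ν b p; μ.prod ν] := by
    conv_lhs => rw [hmap]
    rw [variance_map (measurable_of_countable _).aemeasurable (measurable_of_countable _).aemeasurable]
    congr 1
    ext p
    simp only [Function.comp, infoGap, hmap]
    ring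
  rw [h1, ← variance_add_prod (memLp_of_atoms hμ _) (memLp_of_atoms hν _)]
  refine (sqrt_variance_sub_le (memLp_of_atoms hfin _) (memLp_of_atoms hfin _)).trans ?_
  gcongr
  refine (variance_le_expectation_sq
    (memLp_of_atoms hfin (infoGap μ ν b)).aestronglyMeasurable).trans ?_
  exact integral_infoGap_sq_le hμ hν hb hM

lemma entropy_law_add_le (a : ℕ) (hμ : (atoms μ).Finite) (m n : ℕ) :
    entropy (law a μ (m + n)) ≤ entropy (law a μ m) + entropy (law a μ n) := by
  rw [law_add]
  exact entropy_conv_dilate_le (finite_atoms_law hμ m) (finite_atoms_law hμ n) _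

/-- By Fekete's lemma the limit exists and is the infimum of H(μ_n)/n. -/
lemma entropyRate_mul_le (a : ℕ) (hμ : (atoms μ).Finite) (n : ℕ) :
    entropyRate a μ * n ≤ entropy (law a μ n) := by
  have hsub : Subadditive fun n => entropy (law a μ n) := entropy_law_add_le a hμ
  have hbdd : BddBelow (Set.range fun n : ℕ => entropy (law a μ n) / n) :=
    ⟨0, by rintro _ ⟨n, rfl⟩; exact div_nonneg (entropy_nonneg _) n.cast_nonneg⟩
  rcases Nat.eq_zero_or_pos n with rfl | hn
  · simpa using entropy_nonneg (law a μ 0)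
  · have h1 : entropyRate a μ = hsub.lim := (hsub.tendsto_lim hbdd).limUnder_eq
    have := hsub.lim_le_div hbdd hn.ne'
    rw [h1]
    rwa [le_div_iff₀ (by exact_mod_cast hn)] at this

/-- The variance of the information content of `μ_n` grows at most linearly. -/
lemma exists_variance_info_le {a : ℕ} (ha : 1 < a) (hμ : (atoms μ).Finite) :
    ∃ V : ℝ, 0 < V ∧ ∀ n : ℕ, 1 ≤ n → Var[info (law a μ n); law a μ n] ≤ V * n := by
  obtain ⟨M, hM⟩ := exists_bound_atoms hμ
  set σ : ℕ → ℝ := fun n => √(Var[info (law a μ n); law a μ n]) with hσ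
  have hstep : ∀ m n, σ (m + n) ≤ √(σ m ^ 2 + σ n ^ 2) + √(4 * M + 1) := by
    intro m n
    simp only [hσ]
    rw [Real.sq_sqrt (variance_nonneg _ _), Real.sq_sqrt (variance_nonneg _ _), law_add]
    refine sqrt_variance_info_conv_le (finite_atoms_law hμ m) (finite_atoms_law hμ n)
      (pow_pos (by omega) m) fun x hx => ?_
    refine (abs_le_of_mem_atoms_law ha hM m x hx).trans ?_
    push_cast
    nlinarith
  have hσ0 : ∀ n, 0 ≤ σ n := fun n => Real.sqrt_nonneg _
  set β := √(4 * M + 1 : ℝ) with hβ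
  have hβ0 : 0 < β := Real.sqrt_pos.2 (by positivity)
  have h2 : (1 : ℝ) < √2 := by rw [Real.lt_sqrt] <;> norm_num
  set γ := 2 * β + σ 1 with hγ
  have hγ0 : 0 < γ := by have := hσ0 1; positivity
  -- D solves √2 D - γ = D, so the bound (σ 1 + D)√n - D reproduces itself under the recursion σ(n)
  -- ≤ √2 σ(⌊n/2⌋) + γ.
  set D := γ / (√2 - 1) with hD
  have hD1 : D * (√2 - 1) = γ := by
    rw [hD]; exact div_mul_cancel₀ _ (by linarith)
  have hD0 : 0 < D := div_pos hγ0 (by linarith)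
  have hdouble : ∀ k, σ (2 * k) ≤ √2 * σ k + β := by
    intro k
    have := hstep k k
    rw [← two_mul, ← two_mul, Real.sqrt_mul (by norm_num), Real.sqrt_sq (hσ0 k)] at this
    exact this
  have hodd : ∀ k, σ (2 * k + 1) ≤ √2 * σ k + γ := by
    intro k
    have h3 := hstep (2 * k) 1
    have h4 : √(σ (2 * k) ^ 2 + σ 1 ^ 2) ≤ σ (2 * k) + σ 1 := by
      rw [Real.sqrt_le_iff]
      have := hσ0 (2 * k); have := hσ0 1
      exact ⟨by positivity, by nlinarith⟩
    have := hdouble k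
    linarith
  have hmain : ∀ n : ℕ, 1 ≤ n → σ n ≤ (σ 1 + D) * √n - D := by
    intro n
    induction n using Nat.strong_induction_on with
    | _ n ih =>
      intro hn
      rcases Nat.lt_or_ge n 2 with h | h
      · obtain rfl : n = 1 := by omega
        simp
      · have hk : σ n ≤ √2 * σ (n / 2) + γ := by
          rcases Nat.even_or_odd' n with ⟨k, rfl | rfl⟩
          · have := hdouble k
            rw [Nat.mul_div_cancel_left _ (by norm_num)]
            have := hσ0 1
            linarith
          · have := hodd k
            rwa [show (2 * k + 1) / 2 = k by omega]
        have ih' := ih (n / 2) (by omega) (by omega)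
        have h5 : √2 * √(n / 2 : ℕ) ≤ √n := by
          rw [← Real.sqrt_mul (by norm_num)]
          refine Real.sqrt_le_sqrt ?_
          have : 2 * (n / 2) ≤ n := by omega
          exact_mod_cast this
        have h6 := hσ0 1
        calc σ n ≤ √2 * ((σ 1 + D) * √(n / 2 : ℕ) - D) + γ := by
              refine hk.trans ?_
              gcongr
          _ = (σ 1 + D) * (√2 * √(n / 2 : ℕ)) - D := by rw [← hD1]; ring
          _ ≤ _ := by gcongr
  refine ⟨(σ 1 + D) ^ 2, by have := hσ0 1; positivity, fun n hn => ?_⟩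
  have h7 : σ n ≤ (σ 1 + D) * √n := by linarith [hmain n hn]
  calc Var[info (law a μ n); law a μ n] = σ n ^ 2 := (Real.sq_sqrt (variance_nonneg _ _)).symm
    _ ≤ ((σ 1 + D) * √n) ^ 2 := by
      have := hσ0 n
      gcongr
    _ = _ := by rw [mul_pow, Real.sq_sqrt n.cast_nonneg]

end Entropy

/-! ### The l¹ distance under convolution and dilation. -/

section Distance

lemma l1Dist_eq_sum {μ ν : Measure ℤ} [IsProbabilityMeasure μ] [IsProbabilityMeasure ν]
    {s : Finset ℤ} (hμ : atoms μ ⊆ s) (hν : atoms ν ⊆ s) :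
    l1Dist μ ν = ∑ x ∈ s, |μ.real {x} - ν.real {x}| := by
  rw [l1Dist, tsum_eq_sum]
  intro x hx
  rw [real_eq_zero_of_notMem fun h => hx (hμ h), real_eq_zero_of_notMem fun h => hx (hν h)]
  simp

lemma exists_common_finset {μ ν : Measure ℤ} (hμ : (atoms μ).Finite) (hν : (atoms ν).Finite) :
    ∃ s : Finset ℤ, atoms μ ⊆ s ∧ atoms ν ⊆ s :=
  ⟨(hμ.union hν).toFinset, by simp, by simp⟩

variable {μ ν μ' ν' : Measure ℤ} [IsProbabilityMeasure μ] [IsProbabilityMeasure ν]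
  [IsProbabilityMeasure μ'] [IsProbabilityMeasure ν']

lemma integral_sub_integral_le_l1Dist (hμ : (atoms μ).Finite) (hν : (atoms ν).Finite) {f : ℤ → ℝ}
    (hf : ∀ x, |f x| ≤ 1) : ∫ x, f x ∂μ - ∫ x, f x ∂ν ≤ l1Dist μ ν := by
  obtain ⟨s, h1, h2⟩ := exists_common_finset hμ hν
  rw [integral_eq_sum h1, integral_eq_sum h2, l1Dist_eq_sum h1 h2, ← Finset.sum_sub_distrib]
  refine Finset.sum_le_sum fun x _ => ?_
  rw [smul_eq_mul, smul_eq_mul, ← sub_mul]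
  refine (le_abs_self _).trans ?_
  rw [abs_mul]
  exact mul_le_of_le_one_right (abs_nonneg _) (hf x)

/-- The sign of μ - ν is an extremal test function. The distance is thus a dual norm, and
convolution and dilation can be moved onto the test function. -/
lemma exists_l1Dist_eq (hμ : (atoms μ).Finite) (hν : (atoms ν).Finite) :
    ∃ f : ℤ → ℝ, (∀ x, |f x| ≤ 1) ∧ l1Dist μ ν = ∫ x, f x ∂μ - ∫ x, f x ∂ν := by
  obtain ⟨s, h1, h2⟩ := exists_common_finset hμ hν
  refine ⟨fun x => if ν.real {x} ≤ μ.real {x} then 1 else -1, fun x => ?_, ?_⟩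
  · dsimp only
    split_ifs <;> simp
  · rw [integral_eq_sum h1, integral_eq_sum h2, l1Dist_eq_sum h1 h2, ← Finset.sum_sub_distrib]
    refine Finset.sum_congr rfl fun x _ => ?_
    rw [smul_eq_mul, smul_eq_mul, ← sub_mul]
    split_ifs with h
    · rw [abs_of_nonneg (by linarith)]; ring
    · rw [abs_of_neg (by linarith)]; ring

lemma l1Dist_conv_le (hμ : (atoms μ).Finite) (hν : (atoms ν).Finite) (hμ' : (atoms μ').Finite)
    (hν' : (atoms ν').Finite) :
    l1Dist (μ.conv ν) (μ'.conv ν') ≤ l1Dist μ μ' + l1Dist ν ν' := by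
  obtain ⟨f, hf, hfe⟩ := exists_l1Dist_eq (finite_atoms_conv hμ hν) (finite_atoms_conv hμ' hν')
  rw [hfe, integral_conv_atoms hμ hν, integral_conv_atoms hμ' hν']
  have h1 : ∫ x, ∫ y, f (x + y) ∂ν ∂μ ≤ ∫ x, (∫ y, f (x + y) ∂ν' + l1Dist ν ν') ∂μ := by
    refine integral_mono_atoms hμ fun x _ => ?_
    have := integral_sub_integral_le_l1Dist hν hν' (f := fun y => f (x + y)) fun y => hf _
    linarith
  have h2 : ∫ x, (∫ y, f (x + y) ∂ν' + l1Dist ν ν') ∂μ =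
      ∫ x, ∫ y, f (x + y) ∂ν' ∂μ + l1Dist ν ν' := by
    rw [integral_add (integrable_of_atoms hμ _) (integrable_const _)]
    simp
  have h3 := integral_sub_integral_le_l1Dist hμ hμ' (f := fun x => ∫ y, f (x + y) ∂ν') fun x => by
    have := norm_integral_le_of_norm_le_const (μ := ν') (f := fun y => f (x + y)) (C := 1)
      (Eventually.of_forall fun y => hf _)
    simpa using this
  linarith

lemma l1Dist_dilate_le (hμ : (atoms μ).Finite) (hν : (atoms ν).Finite) (b : ℕ) :
    l1Dist (dilate b μ) (dilate b ν) ≤ l1Dist μ ν := by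
  obtain ⟨f, hf, hfe⟩ := exists_l1Dist_eq (finite_atoms_dilate (b := b) hμ)
    (finite_atoms_dilate (b := b) hν)
  rw [hfe, integral_dilate, integral_dilate]
  exact integral_sub_integral_le_l1Dist hμ hν fun x => hf _

lemma l1Dist_self (μ : Measure ℤ) : l1Dist μ μ = 0 := by simp [l1Dist]

end Distance

/-! ### Existence of truncations and of margins. -/

section Truncation

open ProbabilityTheory

lemma log_sq_le_self {x : ℝ} (hx : 1 ≤ x) : Real.log x ^ 2 ≤ x := by
  have h0 : 0 < x := by linarith
  have h := mul_log_sq_le_one (p := x⁻¹) (by positivity) (inv_le_one_of_one_le₀ hx)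
  rw [Real.log_inv, neg_sq, inv_mul_le_iff₀ h0, mul_one] at h
  exact h

lemma real_cond_singleton (μ : Measure ℤ) (G : Set ℤ) [DecidablePred (· ∈ G)] (x : ℤ) :
    (μ[|G]).real {x} = if x ∈ G then μ.real {x} / μ.real G else 0 := by
  rw [measureReal_def, cond_apply (MeasurableSet.of_discrete), ENNReal.toReal_mul,
    ENNReal.toReal_inv]
  split_ifs with h
  · rw [Set.inter_eq_right.2 (by simpa using h), div_eq_inv_mul]; rfl
  · have : G ∩ {x} = ∅ := by simpa using h
    rw [this]; simp

/-- Conditioning removes the mass outside G and adds the same amount inside. -/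
lemma l1Dist_cond {μ : Measure ℤ} [IsProbabilityMeasure μ] (hμ : (atoms μ).Finite) {G : Set ℤ}
    (hG : 0 < μ.real G) : l1Dist μ (μ[|G]) = 2 * (1 - μ.real G) := by
  classical
  obtain ⟨s, hs⟩ := exists_finset_atoms hμ
  have hG' : μ G ≠ 0 := by
    intro h; simp [measureReal_def, h] at hG
  have := cond_isProbabilityMeasure hG'
  have hP1 : μ.real G ≤ 1 := measureReal_le_one
  have hsub : atoms (μ[|G]) ⊆ s := by
    intro x hx
    rw [← hs]
    rw [mem_atoms_iff_real] at hx ⊢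
    intro h
    rw [real_cond_singleton, h] at hx
    simp at hx
  have hsumG : ∑ x ∈ s, (if x ∈ G then μ.real {x} else 0) = μ.real G := by
    have h1 := integral_eq_sum hs.le (G.indicator (1 : ℤ → ℝ))
    rw [integral_indicator_one MeasurableSet.of_discrete] at h1
    rw [h1]
    refine Finset.sum_congr rfl fun x _ => ?_
    by_cases h : x ∈ G <;> simp [h]
  rw [l1Dist_eq_sum hs.le hsub]
  have hterm : ∀ x ∈ s, |μ.real {x} - (μ[|G]).real {x}| =
      μ.real {x} + (if x ∈ G then μ.real {x} else 0) * (1 / μ.real G - 2) := by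
    intro x _
    have hp : 0 ≤ μ.real {x} := measureReal_nonneg
    rw [real_cond_singleton]
    split_ifs with h
    · have : μ.real {x} ≤ μ.real {x} / μ.real G := le_div_self hp hG hP1
      rw [abs_of_nonpos (by linarith)]; ring
    · rw [sub_zero, abs_of_nonneg hp]; ring
  rw [Finset.sum_congr rfl hterm, Finset.sum_add_distrib, ← Finset.sum_mul, hsumG,
    sum_real_eq_one hs.le]
  field_simp
  ring

/-- μ_n is conditioned on its information content lying within L n / log n of the entropy. As the
variance is O(n), Chebyshev bounds the discarded mass by O((log n)²/n). -/
lemma exists_isTruncation {a : ℕ} (ha : 1 < a) {μ : Measure ℤ} [IsProbabilityMeasure μ]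
    (hμ : (atoms μ).Finite) : ∃ ν, IsTruncation a μ ν := by
  classical
  obtain ⟨V, hV0, hV⟩ := exists_variance_info_le ha hμ
  -- With L² = 2V the discarded mass is at most (log n)²/(2n) ≤ 1/2, so the conditioning makes sense
  -- for every n ≥ 2.
  set L := √(2 * V) with hL
  have hL0 : 0 < L := Real.sqrt_pos.2 (by positivity)
  have hL2 : L ^ 2 = 2 * V := Real.sq_sqrt (by positivity)
  set G : ℕ → Set ℤ := fun n =>
    {x | |info (law a μ n) x - entropy (law a μ n)| < L * (n / Real.log n)} with hG
  have hfin := fun n => finite_atoms_law (a := a) hμ n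
  have hlog : ∀ n : ℕ, 2 ≤ n → 0 < Real.log n := fun n hn =>
    Real.log_pos (by exact_mod_cast (show 1 < n by omega))
  have htail : ∀ n : ℕ, 2 ≤ n → 1 - (law a μ n).real (G n) ≤ 1 / 2 * (Real.log n ^ 2 / n) := by
    intro n hn
    have hn0 : (0 : ℝ) < n := by exact_mod_cast (show 0 < n by omega)
    have hln := hlog n hn
    have hc : 0 < L * (n / Real.log n) := by positivity
    have h1 := meas_ge_le_variance_div_sq (memLp_of_atoms (hfin n) (info (law a μ n))) hc
    have hcompl : {ω | L * (n / Real.log n) ≤ |info (law a μ n) ω - (law a μ n)[info (law a μ n)]|}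
        = (G n)ᶜ := by
      ext x
      rw [← entropy_eq_integral (hfin n)]
      simp [hG]
    rw [hcompl] at h1
    have h2 : (law a μ n).real (G n)ᶜ ≤
        Var[info (law a μ n); law a μ n] / (L * (n / Real.log n)) ^ 2 :=
      ENNReal.toReal_le_of_le_ofReal (div_nonneg (variance_nonneg _ _) (by positivity)) h1
    rw [measureReal_compl MeasurableSet.of_discrete] at h2
    rw [probReal_univ] at h2
    refine h2.trans ?_
    calc Var[info (law a μ n); law a μ n] / (L * (n / Real.log n)) ^ 2
        ≤ V * n / (L * (n / Real.log n)) ^ 2 := by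
          gcongr; exact hV n (by omega)
      _ = _ := by rw [mul_pow, hL2]; field_simp
  have hhalf : ∀ n : ℕ, 2 ≤ n → 1 / 2 ≤ (law a μ n).real (G n) := by
    intro n hn
    have hn0 : (0 : ℝ) < n := by exact_mod_cast (show 0 < n by omega)
    have h1 : Real.log n ^ 2 / n ≤ 1 := by
      rw [div_le_one hn0]
      exact log_sq_le_self (by exact_mod_cast (show 1 ≤ n by omega))
    have := htail n hn
    linarith
  refine ⟨fun n => if n < 2 then law a μ n else (law a μ n)[|G n], ?_, ?_, ?_⟩
  · intro n
    split_ifs with h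
    · infer_instance
    · have := hhalf n (by omega)
      refine cond_isProbabilityMeasure fun h0 => ?_
      rw [measureReal_def, h0] at this
      norm_num at this
  · intro n x hx
    split_ifs at hx with h
    · exact hx
    · have hreal : (law a μ n)[|G n] {x} ≠ 0 := hx
      intro h0
      exact hreal (cond_absolutelyContinuous h0)
  -- L is the width of the window; the extra 1 pays for the normalisation, since -log μ_n(G n) ≤ 1 ≤
  -- n / log n.
  · refine ⟨L + 1, fun n hn => ?_⟩
    have hn0 : (0 : ℝ) < n := by exact_mod_cast (show 0 < n by omega)
    have hln := hlog n hn
    rw [if_neg (by omega)]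
    have hP := hhalf n hn
    have hP1 : (law a μ n).real (G n) ≤ 1 := measureReal_le_one
    constructor
    · rw [l1Dist_cond (hfin n) (by linarith)]
      have h1 : 0 ≤ Real.log n ^ 2 / n := by positivity
      have h2 := htail n hn
      nlinarith
    · intro x hx
      have h0 : ((law a μ n)[|G n]).real {x} ≠ 0 := by
        rw [measureReal_def, ENNReal.toReal_ne_zero]
        exact ⟨hx, measure_ne_top _ _⟩
      rw [real_cond_singleton] at h0 ⊢
      split_ifs at h0 ⊢ with h
      · have hp : (law a μ n).real {x} ≠ 0 := fun h => h0 (by rw [h, zero_div])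
        rw [Real.log_div hp (by linarith)]
        have h1 : |info (law a μ n) x - entropy (law a μ n)| < L * (n / Real.log n) := h
        rw [info] at h1
        have h2 : Real.log ((law a μ n).real (G n)) ≤ 0 := Real.log_nonpos (by linarith) hP1
        have h3 : -1 ≤ Real.log ((law a μ n).real (G n)) := by
          have := Real.one_sub_inv_le_log_of_pos (show 0 < (law a μ n).real (G n) by linarith)
          have : ((law a μ n).real (G n))⁻¹ ≤ 2 := by
            rw [inv_le_comm₀ (by linarith) (by norm_num)]; linarith
          linarith
        have h4 : 1 ≤ n / Real.log n := by
          rw [le_div_iff₀ hln, one_mul]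
          exact Real.log_le_self hn0.le
        rw [abs_lt] at h1
        rw [abs_le]
        constructor <;> nlinarith
      · exact absurd rfl h0

/-- Atoms of μ_{w-C} are at most M a^(w-C), and with C = 2M one has 2M ≤ a^C. -/
lemma exists_isMargin {a : ℕ} (ha : 1 < a) {μ : Measure ℤ} [IsProbabilityMeasure μ]
    (hμ : (atoms μ).Finite) {ν : ℕ → Measure ℤ} (hν : IsTruncation a μ ν) :
    ∃ C, IsMargin a ν C := by
  obtain ⟨M, hM⟩ := exists_bound_atoms hμ
  refine ⟨2 * M, fun w hw x hx => ?_⟩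
  have h1 := abs_le_of_mem_atoms_law ha hM (w - 2 * M) x (hν.supp _ hx)
  have h2 : |(x : ℝ)| ≤ M * ((a : ℝ) ^ (w - 2 * M) - 1) := by exact_mod_cast h1
  have h3 : (2 * M : ℝ) ≤ (a : ℝ) ^ (2 * M) := by
    have := Nat.lt_pow_self ha (n := 2 * M)
    exact_mod_cast this.le
  have h4 : (a : ℝ) ^ w = (a : ℝ) ^ (w - 2 * M) * (a : ℝ) ^ (2 * M) := by
    rw [← pow_add]; congr 1; omega
  have h5 : (0 : ℝ) ≤ (a : ℝ) ^ (w - 2 * M) := by positivity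
  have h6 : (0 : ℝ) ≤ M := by positivity
  rw [h4]
  nlinarith [mul_le_mul_of_nonneg_left h3 h5]

end Truncation

/-! ### Convolutions of pruned blocks: supports, atoms, Fourier transforms, distance to μ_n. -/

section Blocks

lemma IsTruncation.finite_atoms {a : ℕ} {μ : Measure ℤ} [IsProbabilityMeasure μ]
    (hμ : (atoms μ).Finite) {ν : ℕ → Measure ℤ} (hν : IsTruncation a μ ν) (n : ℕ) :
    (atoms (ν n)).Finite := (finite_atoms_law hμ n).subset (hν.supp n)

/-- The convolution of `(m_{a^{w_1 + ⋯ + w_{j-1}}})_* τ_j` for `j = 1, …, i`. -/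
def blockChain (a : ℕ) (w : ℕ → ℕ) (τ : ℕ → Measure ℤ) : ℕ → Measure ℤ
  | 0 => Measure.dirac 0
  | i + 1 => (blockChain a w τ i).conv (dilate (a ^ (∑ j ∈ Finset.Icc 1 i, w j)) (τ (i + 1)))

lemma sum_Icc_one_succ {M : Type*} [AddCommMonoid M] (f : ℕ → M) (i : ℕ) :
    ∑ j ∈ Finset.Icc 1 (i + 1), f j = ∑ j ∈ Finset.Icc 1 i, f j + f (i + 1) :=
  Finset.sum_Icc_succ_top (by omega) f

lemma isProbabilityMeasure_blockChain (a : ℕ) (w : ℕ → ℕ) {τ : ℕ → Measure ℤ}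
    (hτ : ∀ j, IsProbabilityMeasure (τ j)) (i : ℕ) :
    IsProbabilityMeasure (blockChain a w τ i) := by
  induction i with
  | zero => unfold blockChain; infer_instance
  | succ i ih => unfold blockChain; have := hτ (i + 1); infer_instance

lemma finite_atoms_blockChain (a : ℕ) (w : ℕ → ℕ) {τ : ℕ → Measure ℤ}
    (hτ : ∀ j, IsProbabilityMeasure (τ j)) (hτ' : ∀ j, (atoms (τ j)).Finite) (i : ℕ) :
    (atoms (blockChain a w τ i)).Finite := by
  induction i with
  | zero => rw [blockChain, atoms_dirac_zero]; exact Set.finite_singleton _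
  | succ i ih =>
    have := hτ (i + 1)
    exact finite_atoms_conv ih (finite_atoms_dilate (hτ' _))

lemma abs_le_of_mem_atoms_blockChain {a : ℕ} (ha : 1 < a) {w : ℕ → ℕ} {τ : ℕ → Measure ℤ}
    (hτ : ∀ j, IsProbabilityMeasure (τ j)) (i : ℕ) (hw : ∀ j ∈ Finset.Icc 1 i, 1 ≤ w j)
    (hm : ∀ j ∈ Finset.Icc 1 i, ∀ x ∈ atoms (τ j), |(x : ℝ)| ≤ (a : ℝ) ^ w j / 2) :
    ∀ x ∈ atoms (blockChain a w τ i), |(x : ℝ)| ≤ (a : ℝ) ^ (∑ j ∈ Finset.Icc 1 i, w j) := by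
  induction i with
  | zero => intro x hx; rw [blockChain, atoms_dirac_zero] at hx; simp_all
  | succ i ih =>
    intro x hx
    have := hτ (i + 1)
    have hsub : Finset.Icc 1 i ⊆ Finset.Icc 1 (i + 1) := Finset.Icc_subset_Icc_right (by omega)
    rw [blockChain, atoms_conv, atoms_dilate] at hx
    obtain ⟨⟨u, v⟩, ⟨hu, ⟨y, hy, rfl⟩⟩, rfl⟩ := hx
    have h1 := ih (fun j hj => hw j (hsub hj)) (fun j hj => hm j (hsub hj)) u hu
    have hmem : i + 1 ∈ Finset.Icc 1 (i + 1) := by simp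
    have h2 := hm (i + 1) hmem y hy
    have h3 := hw (i + 1) hmem
    rw [sum_Icc_one_succ, pow_add]
    set S := ∑ j ∈ Finset.Icc 1 i, w j
    have ha2 : (2 : ℝ) ≤ (a : ℝ) ^ w (i + 1) := by
      calc (2 : ℝ) ≤ a := by exact_mod_cast ha
        _ ≤ (a : ℝ) ^ w (i + 1) := le_self_pow₀ (by exact_mod_cast ha.le) (by omega)
    have hS : (0 : ℝ) < (a : ℝ) ^ S := by positivity
    push_cast
    calc |(u : ℝ) + (a : ℝ) ^ S * y| ≤ |(u : ℝ)| + |(a : ℝ) ^ S * y| := abs_add_le _ _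
      _ ≤ (a : ℝ) ^ S + (a : ℝ) ^ S * ((a : ℝ) ^ w (i + 1) / 2) := by
        rw [abs_mul, abs_of_pos hS]; gcongr
      _ ≤ _ := by nlinarith

/-- If z = x + by, then x lies in a fixed class modulo b. The interval [-b/2, b/2] meets such a
class at most twice, twice only at its two ends; this is the factor 2. -/
lemma real_conv_dilate_le {ν τ : Measure ℤ} [IsProbabilityMeasure ν] [IsProbabilityMeasure τ]
    (hν : (atoms ν).Finite) (hτ : (atoms τ).Finite) {b : ℕ} (hb : 0 < b)
    (hm : ∀ x ∈ atoms ν, |(x : ℝ)| ≤ (b : ℝ) / 2) {B M : ℝ} (hB : ∀ x, ν.real {x} ≤ B)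
    (hM : ∀ x, τ.real {x} ≤ M) (z : ℤ) :
    (ν.conv (dilate b τ)).real {z} ≤ 2 * B * M := by
  classical
  obtain ⟨s, hs⟩ := exists_finset_atoms hν
  have hb' : (0 : ℤ) < b := by exact_mod_cast hb
  have hB0 : 0 ≤ B := measureReal_nonneg.trans (hB 0)
  have hM0 : 0 ≤ M := measureReal_nonneg.trans (hM 0)
  have h1 : (ν.conv (dilate b τ)).real {z} =
      ∑ x ∈ s, ν.real {x} * ∫ y, ({z} : Set ℤ).indicator (1 : ℤ → ℝ) (x + b * y) ∂τ := by
    rw [← integral_indicator_one (measurableSet_singleton z),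
      integral_conv_atoms hν (finite_atoms_dilate hτ), integral_eq_sum hs.le]
    simp only [integral_dilate, smul_eq_mul]
  have h2 : ∀ x, ∫ y, ({z} : Set ℤ).indicator (1 : ℤ → ℝ) (x + b * y) ∂τ ≤
      if (b : ℤ) ∣ z - x then M else 0 := by
    intro x
    split_ifs with h
    · obtain ⟨y₀, hy₀⟩ := h
      have : ∀ y : ℤ, ({z} : Set ℤ).indicator (1 : ℤ → ℝ) (x + b * y) =
          ({y₀} : Set ℤ).indicator 1 y := by
        intro y
        simp only [Set.indicator_apply, Set.mem_singleton_iff, Pi.one_apply]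
        congr 1
        rw [eq_iff_iff]
        constructor
        · intro h
          have : (b : ℤ) * y = b * y₀ := by linarith
          exact (mul_right_inj' hb'.ne').1 this
        · rintro rfl; linarith
      simp only [this]
      rw [integral_indicator_one (measurableSet_singleton _)]
      exact hM y₀
    · have : ∀ y : ℤ, ({z} : Set ℤ).indicator (1 : ℤ → ℝ) (x + b * y) = 0 := by
        intro y
        rw [Set.indicator_of_notMem]
        intro hy
        apply h
        rw [Set.mem_singleton_iff] at hy
        exact ⟨y, by linarith⟩
      simp [this]
  have hcard : (s.filter (fun x => (b : ℤ) ∣ z - x)).card ≤ 2 := by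
    -- Two points of the class that are both positive or both nonpositive differ by less than b,
    -- hence coincide.
    rw [← Fintype.card_bool, ← Finset.card_univ]
    refine Finset.card_le_card_of_injOn (fun x => decide (0 < x))
      (fun _ _ => Finset.mem_coe.2 (Finset.mem_univ _)) ?_
    intro x hx y hy hxy
    rw [Finset.mem_coe, Finset.mem_filter] at hx hy
    have bound : ∀ u ∈ s, 2 * |u| ≤ b := by
      intro u hu
      have := hm u (by rw [hs]; exact hu)
      have h' : 2 * |(u : ℝ)| ≤ b := by linarith
      exact_mod_cast h'
    have b1 := bound x hx.1
    have b2 := bound y hy.1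
    have hdvd : (b : ℤ) ∣ x - y := by
      have := dvd_sub hy.2 hx.2
      rwa [show z - y - (z - x) = x - y by ring] at this
    have hlt : |x - y| < b := by
      have hiff : 0 < x ↔ 0 < y := by simpa using hxy
      rw [abs_lt]
      rcases le_or_gt x 0 with h | h
      · have h' : y ≤ 0 := by by_contra h''; exact absurd (hiff.2 (by omega)) (by omega)
        rw [abs_of_nonpos h] at b1; rw [abs_of_nonpos h'] at b2
        constructor <;> omega
      · have h' := hiff.1 h
        rw [abs_of_pos h] at b1; rw [abs_of_pos h'] at b2
        constructor <;> omega
    have := Int.eq_zero_of_abs_lt_dvd hdvd hlt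
    omega
  rw [h1]
  calc ∑ x ∈ s, ν.real {x} * ∫ y, ({z} : Set ℤ).indicator (1 : ℤ → ℝ) (x + b * y) ∂τ
      ≤ ∑ x ∈ s, if (b : ℤ) ∣ z - x then B * M else 0 := by
        refine Finset.sum_le_sum fun x _ => ?_
        have h3 := h2 x
        have h4 := hB x
        have h5 : 0 ≤ ν.real {x} := measureReal_nonneg
        split_ifs with h
        · rw [if_pos h] at h3
          calc _ ≤ ν.real {x} * M := by gcongr
            _ ≤ B * M := by gcongr
        · rw [if_neg h] at h3
          exact mul_nonpos_of_nonneg_of_nonpos h5 h3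
    _ = (s.filter (fun x => (b : ℤ) ∣ z - x)).card * (B * M) := by
        rw [← Finset.sum_filter, Finset.sum_const, nsmul_eq_mul]
    _ ≤ 2 * (B * M) := by
        have : ((s.filter (fun x => (b : ℤ) ∣ z - x)).card : ℝ) ≤ 2 := by exact_mod_cast hcard
        gcongr
    _ = 2 * B * M := by ring

/-- The pruned blocks interact little: the largest atom of their convolution is at most the
product of the largest atoms, up to a factor `2` for each block. -/
lemma real_blockChain_conv_le {a : ℕ} (ha : 1 < a) {w : ℕ → ℕ} {τ : ℕ → Measure ℤ}
    (hτ : ∀ j, IsProbabilityMeasure (τ j)) (hτ' : ∀ j, (atoms (τ j)).Finite) {B : ℕ → ℝ} (i : ℕ)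
    (hm : ∀ j ∈ Finset.Icc 1 i, ∀ x ∈ atoms (τ j), |(x : ℝ)| ≤ (a : ℝ) ^ w j / 2)
    (hB : ∀ j ∈ Finset.Icc 1 i, ∀ x, (τ j).real {x} ≤ B j) :
    ∀ (σ : Measure ℤ) [IsProbabilityMeasure σ], (atoms σ).Finite → ∀ M, (∀ x, σ.real {x} ≤ M) →
      ∀ x, ((blockChain a w τ i).conv (dilate (a ^ (∑ j ∈ Finset.Icc 1 i, w j)) σ)).real {x} ≤
        (∏ j ∈ Finset.Icc 1 i, 2 * B j) * M := by
  induction i with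
  | zero => intro σ _ _ M hM x; simpa [blockChain, dilate_one] using hM x
  | succ i ih =>
    intro σ _ hσ M hM x
    have hsub : Finset.Icc 1 i ⊆ Finset.Icc 1 (i + 1) := Finset.Icc_subset_Icc_right (by omega)
    have hmem : i + 1 ∈ Finset.Icc 1 (i + 1) := by simp
    have := hτ (i + 1)
    have := isProbabilityMeasure_blockChain a w hτ i
    have hb : 0 < a ^ w (i + 1) := pow_pos (by omega) _
    -- The last block is merged with the tail σ, whose atom bound becomes 2BM; this is why σ is
    -- quantified inside the induction.
    have h1 := real_conv_dilate_le (hτ' (i + 1)) hσ hb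
      (by push_cast; exact hm (i + 1) hmem) (hB (i + 1) hmem) hM
    have h2 := ih (fun j hj => hm j (hsub hj)) (fun j hj => hB j (hsub hj))
      ((τ (i + 1)).conv (dilate (a ^ w (i + 1)) σ))
      (finite_atoms_conv (hτ' _) (finite_atoms_dilate hσ)) _ h1 x
    rw [dilate_conv, dilate_dilate, ← pow_add, ← sum_Icc_one_succ, ← Measure.conv_assoc] at h2
    rw [blockChain]
    refine h2.trans (le_of_eq ?_)
    rw [Finset.prod_Icc_succ_top (by omega)]
    ring

lemma real_blockChain_le {a : ℕ} (ha : 1 < a) {w : ℕ → ℕ} {τ : ℕ → Measure ℤ}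
    (hτ : ∀ j, IsProbabilityMeasure (τ j)) (hτ' : ∀ j, (atoms (τ j)).Finite) {B : ℕ → ℝ} (i : ℕ)
    (hm : ∀ j ∈ Finset.Icc 1 i, ∀ x ∈ atoms (τ j), |(x : ℝ)| ≤ (a : ℝ) ^ w j / 2)
    (hB : ∀ j ∈ Finset.Icc 1 i, ∀ x, (τ j).real {x} ≤ B j) (x : ℤ) :
    (blockChain a w τ i).real {x} ≤ ∏ j ∈ Finset.Icc 1 i, 2 * B j := by
  have := isProbabilityMeasure_blockChain a w hτ i
  have h := real_blockChain_conv_le ha hτ hτ' i hm hB (Measure.dirac 0)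
    (by rw [atoms_dirac_zero]; exact Set.finite_singleton _) 1 (fun _ => measureReal_le_one) x
  rwa [dilate_dirac_zero, Measure.conv_dirac_zero, mul_one] at h

variable {a : ℕ} {μ : Measure ℤ} [IsProbabilityMeasure μ] {ν : ℕ → Measure ℤ}

lemma isProbabilityMeasure_blockProd (hν : ∀ n, IsProbabilityMeasure (ν n)) (C w₀ : ℕ) (w : ℕ → ℕ)
    (i : ℕ) : IsProbabilityMeasure (blockProd a μ ν C w₀ w i) := by
  induction i with
  | zero => unfold blockProd; infer_instance
  | succ i ih => unfold blockProd; have := hν (w (i + 1) - C); infer_instance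

lemma finite_atoms_blockProd (hμ : (atoms μ).Finite) (hν : ∀ n, IsProbabilityMeasure (ν n))
    (hν' : ∀ n, (atoms (ν n)).Finite) (C w₀ : ℕ) (w : ℕ → ℕ) (i : ℕ) :
    (atoms (blockProd a μ ν C w₀ w i)).Finite := by
  induction i with
  | zero => exact finite_atoms_law hμ _
  | succ i ih =>
    have := hν (w (i + 1) - C)
    exact finite_atoms_conv ih (finite_atoms_conv (finite_atoms_dilate (hν' _))
      (finite_atoms_dilate (finite_atoms_law hμ _)))

lemma norm_ft_blockProd_succ_le (hμ : (atoms μ).Finite) (hν : ∀ n, IsProbabilityMeasure (ν n))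
    (hν' : ∀ n, (atoms (ν n)).Finite) (C w₀ : ℕ) (w : ℕ → ℕ) (i : ℕ) (θ : ℝ) :
    ‖ft (blockProd a μ ν C w₀ w (i + 1)) θ‖ ≤ ‖ft (blockProd a μ ν C w₀ w i) θ‖ *
      ‖ft (ν (w (i + 1) - C)) ((a : ℝ) ^ (w₀ + ∑ j ∈ Finset.Icc 1 i, w j) * θ)‖ := by
  have := hν (w (i + 1) - C)
  have := isProbabilityMeasure_blockProd (a := a) (μ := μ) hν C w₀ w i
  rw [blockProd, ft_conv (finite_atoms_blockProd hμ hν hν' C w₀ w i)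
    (finite_atoms_conv (finite_atoms_dilate (hν' _)) (finite_atoms_dilate (finite_atoms_law hμ _))),
    ft_conv (finite_atoms_dilate (hν' _)) (finite_atoms_dilate (finite_atoms_law hμ _)),
    norm_mul, norm_mul, ft_dilate]
  push_cast
  gcongr
  exact mul_le_of_le_one_right (norm_nonneg _) (norm_ft_le_one _ _)

lemma norm_ft_blockProd_antitone (hμ : (atoms μ).Finite) (hν : ∀ n, IsProbabilityMeasure (ν n))
    (hν' : ∀ n, (atoms (ν n)).Finite) (C w₀ : ℕ) (w : ℕ → ℕ) (θ : ℝ) :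
    Antitone fun i => ‖ft (blockProd a μ ν C w₀ w i) θ‖ := by
  refine antitone_nat_of_succ_le fun i => ?_
  have := hν (w (i + 1) - C)
  exact (norm_ft_blockProd_succ_le hμ hν hν' C w₀ w i θ).trans
    (mul_le_of_le_one_right (norm_nonneg _) (norm_ft_le_one _ _))

/-- Dropping μ_{w₀} and all copies of μ_C leaves the chain of truncated blocks dilated by a^{w₀},
that is, the chain at the frequency a^{w₀} θ. -/
lemma norm_ft_blockProd_le_blockChain (hμ : (atoms μ).Finite)
    (hν : ∀ n, IsProbabilityMeasure (ν n)) (hν' : ∀ n, (atoms (ν n)).Finite) (C w₀ : ℕ)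
    (w : ℕ → ℕ) (i : ℕ) (θ : ℝ) :
    ‖ft (blockProd a μ ν C w₀ w i) θ‖ ≤
      ‖ft (blockChain a w (fun j => ν (w j - C)) i) ((a : ℝ) ^ w₀ * θ)‖ := by
  induction i with
  | zero => rw [blockProd, blockChain, ft_dirac, norm_one]; exact norm_ft_le_one _ _
  | succ i ih =>
    have := hν (w (i + 1) - C)
    have := isProbabilityMeasure_blockChain a w (τ := fun j => ν (w j - C)) (fun j => hν _) i
    refine (norm_ft_blockProd_succ_le hμ hν hν' C w₀ w i θ).trans ?_
    rw [blockChain, ft_conv (finite_atoms_blockChain a w (fun j => hν _) (fun j => hν' _) i)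
      (finite_atoms_dilate (hν' _)), norm_mul, ft_dilate]
    push_cast
    rw [pow_add, mul_comm ((a : ℝ) ^ w₀), mul_assoc]
    gcongr

/-- By `law_add`, μ_n is the same product with μ_{w_j - C} in place of ν_{w_j - C}, so the errors of
the blocks add up. -/
lemma l1Dist_law_blockProd_le (hμ : (atoms μ).Finite) (hν : ∀ n, IsProbabilityMeasure (ν n))
    (hν' : ∀ n, (atoms (ν n)).Finite) (C w₀ : ℕ) (w : ℕ → ℕ) (i : ℕ)
    (hC : ∀ j ∈ Finset.Icc 1 i, C ≤ w j) :
    l1Dist (law a μ (w₀ + ∑ j ∈ Finset.Icc 1 i, w j)) (blockProd a μ ν C w₀ w i) ≤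
      ∑ j ∈ Finset.Icc 1 i, l1Dist (law a μ (w j - C)) (ν (w j - C)) := by
  induction i with
  | zero => simp [blockProd, l1Dist_self]
  | succ i ih =>
    have hsub : Finset.Icc 1 i ⊆ Finset.Icc 1 (i + 1) := Finset.Icc_subset_Icc_right (by omega)
    have hCi := hC (i + 1) (by simp)
    have := hν (w (i + 1) - C)
    have := isProbabilityMeasure_blockProd (a := a) (μ := μ) hν C w₀ w i
    have h1 : law a μ (w₀ + ∑ j ∈ Finset.Icc 1 (i + 1), w j) =
        (law a μ (w₀ + ∑ j ∈ Finset.Icc 1 i, w j)).conv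
          ((dilate (a ^ (w₀ + ∑ j ∈ Finset.Icc 1 i, w j)) (law a μ (w (i + 1) - C))).conv
            (dilate (a ^ (w₀ + ∑ j ∈ Finset.Icc 1 (i + 1), w j - C)) (law a μ C))) := by
      rw [sum_Icc_one_succ, ← add_assoc]
      set S := w₀ + ∑ j ∈ Finset.Icc 1 i, w j
      rw [law_add a μ S]
      conv_lhs => rw [show w (i + 1) = (w (i + 1) - C) + C by omega]
      rw [law_add a μ (w (i + 1) - C), dilate_conv, dilate_dilate, ← pow_add]
      congr 4
      omega
    have hfl := fun n => finite_atoms_law (a := a) hμ n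
    rw [h1, blockProd, sum_Icc_one_succ (fun j => l1Dist (law a μ (w j - C)) (ν (w j - C)))]
    refine (l1Dist_conv_le (hfl _)
      (finite_atoms_conv (finite_atoms_dilate (hfl _)) (finite_atoms_dilate (hfl _)))
      (finite_atoms_blockProd hμ hν hν' C w₀ w i)
      (finite_atoms_conv (finite_atoms_dilate (hν' _)) (finite_atoms_dilate (hfl _)))).trans ?_
    refine add_le_add (ih fun j hj => hC j (hsub hj)) ?_
    refine (l1Dist_conv_le (finite_atoms_dilate (hfl _)) (finite_atoms_dilate (hfl _))
      (finite_atoms_dilate (hν' _)) (finite_atoms_dilate (hfl _))).trans ?_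
    rw [l1Dist_self, add_zero]
    exact l1Dist_dilate_le (hfl _) (hν' _) _

/-- Upper bound for the atoms of the convolution of the first `i` pruned blocks. -/
lemma real_blockChain_truncation_le (ha : 1 < a) (hμ : (atoms μ).Finite) (hν : IsTruncation a μ ν)
    {A : ℝ} (hA : ∀ n : ℕ, 2 ≤ n → ∀ x ∈ atoms (ν n),
      |Real.log ((ν n).real {x}) + entropy (law a μ n)| ≤ A * (n / Real.log n))
    {C : ℕ} (hC : IsMargin a ν C) {w : ℕ → ℕ} {i : ℕ} {η : ℝ}
    (hη : ∀ j ∈ Finset.Icc 1 i, C + 2 ≤ w j ∧ A / Real.log (w j - C : ℕ) ≤ η) (hη0 : 0 ≤ η) (x : ℤ) :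
    (blockChain a w (fun j => ν (w j - C)) i).real {x} ≤
      Real.exp (i * (Real.log 2 + entropyRate a μ * C) -
        (entropyRate a μ - η) * (∑ j ∈ Finset.Icc 1 i, w j : ℕ)) := by
  set H := entropyRate a μ
  have hprob := hν.prob
  have h1 := real_blockChain_le ha (w := w) (τ := fun j => ν (w j - C)) (fun j => hprob _)
    (fun j => hν.finite_atoms hμ _)
    (B := fun j => Real.exp (-(H - η) * (w j - C : ℕ))) i
    (fun j hj x hx => hC (w j) (by have := (hη j hj).1; omega) x hx) ?_ x
  · refine h1.trans ?_
    have h2 : ∀ j ∈ Finset.Icc 1 i, 2 * Real.exp (-(H - η) * (w j - C : ℕ)) ≤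
        Real.exp (Real.log 2 + H * C - (H - η) * w j) := by
      intro j hj
      have hle : C ≤ w j := by have := (hη j hj).1; omega
      rw [show Real.log 2 + H * C - (H - η) * w j = Real.log 2 + (H * C - (H - η) * w j) by ring,
        Real.exp_add, Real.exp_log (by norm_num)]
      gcongr
      rw [Nat.cast_sub hle]
      nlinarith [mul_nonneg hη0 (Nat.cast_nonneg (α := ℝ) C)]
    refine (Finset.prod_le_prod (fun j _ => by positivity) h2).trans (le_of_eq ?_)
    rw [← Real.exp_sum, Finset.sum_sub_distrib, ← Finset.mul_sum, Finset.sum_const, Nat.card_Icc,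
      nsmul_eq_mul]
    push_cast
    rfl
  · intro j hj x
    have hj2 := hη j hj
    have hm2 : 2 ≤ w j - C := by omega
    set m := w j - C
    by_cases hx : x ∈ atoms (ν m)
    · have := hprob m
      have hp := mem_atoms_iff_pos.1 hx
      rw [← Real.log_le_iff_le_exp hp]
      have h3 := (abs_le.1 (hA m hm2 x hx)).2
      -- An atom of ν_m is at most exp(-H(μ_m) + A m / log m), and H(μ_m) ≥ Hm.
      have h4 := entropyRate_mul_le a hμ m
      have h5 : A * (m / Real.log m) ≤ η * m := by
        calc A * (m / Real.log m) = A / Real.log m * m := by ring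
          _ ≤ η * m := by gcongr; exact hj2.2
      linarith
    · have := hprob m
      rw [real_eq_zero_of_notMem hx]
      positivity

end Blocks

/-! ### Existence of block lengths. -/

section Scheme

/-- Partial sums growing geometrically from about `n^0.15` to `n - w₀` in about `(log n)²` steps. -/
def geomSum (n i : ℕ) : ℕ :=
  if i = 0 then 0 else
    ⌊((n - initLen n : ℕ) : ℝ) * Real.exp (-(0.85 * Real.log n / ⌊Real.log n ^ 2⌋₊) *
      ((⌊Real.log n ^ 2⌋₊ : ℝ) - i))⌋₊

lemma geomSum_mono {n : ℕ} (hn : 0 ≤ Real.log n) : Monotone (geomSum n) := by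
  refine monotone_nat_of_le_succ fun i => ?_
  rcases Nat.eq_zero_or_pos i with rfl | hi
  · simp [geomSum]
  · rw [geomSum, geomSum, if_neg (by omega), if_neg (by omega)]
    refine Nat.floor_mono (mul_le_mul_of_nonneg_left (Real.exp_le_exp.2 ?_) (Nat.cast_nonneg _))
    have : 0 ≤ 0.85 * Real.log n / ⌊Real.log n ^ 2⌋₊ :=
      div_nonneg (mul_nonneg (by norm_num) hn) (Nat.cast_nonneg _)
    push_cast
    nlinarith

lemma sum_geomSum_sub {n : ℕ} (hn : 0 ≤ Real.log n) (i : ℕ) :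
    ∑ j ∈ Finset.Icc 1 i, (geomSum n j - geomSum n (j - 1)) = geomSum n i := by
  induction i with
  | zero => simp [geomSum]
  | succ i ih =>
    rw [sum_Icc_one_succ, ih, Nat.add_sub_cancel]
    have := geomSum_mono hn (Nat.le_succ i)
    simp only [Nat.succ_eq_add_one] at this
    omega

lemma initLen_le (n : ℕ) : (initLen n : ℝ) ≤ n / Real.log n :=
  Nat.floor_le (div_nonneg n.cast_nonneg (Real.log_natCast_nonneg n))

lemma initLen_le_self (n : ℕ) (hn : 1 ≤ Real.log n) : initLen n ≤ n := by
  have h1 := initLen_le n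
  have h2 : (n : ℝ) / Real.log n ≤ n := div_le_self (by positivity) hn
  exact_mod_cast h1.trans h2

lemma tendsto_log_natCast : Tendsto (fun n : ℕ => Real.log n) atTop atTop :=
  Real.tendsto_log_atTop.comp tendsto_natCast_atTop_atTop

lemma floor_log_sq_bounds {n : ℕ} (hl : 2 ≤ Real.log n) :
    Real.log n ^ 2 / 2 ≤ ⌊Real.log n ^ 2⌋₊ ∧ (⌊Real.log n ^ 2⌋₊ : ℝ) ≤ Real.log n ^ 2 := by
  refine ⟨?_, Nat.floor_le (by positivity)⟩
  have := Nat.lt_floor_add_one (Real.log n ^ 2)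
  nlinarith

lemma geomRatio_bounds {n : ℕ} (hl : 2 ≤ Real.log n) :
    0.85 / Real.log n ≤ 0.85 * Real.log n / ⌊Real.log n ^ 2⌋₊ ∧
      0.85 * Real.log n / ⌊Real.log n ^ 2⌋₊ ≤ 2 / Real.log n := by
  obtain ⟨h1, h2⟩ := floor_log_sq_bounds hl
  have h3 : 0 < Real.log n ^ 2 / 2 := by positivity
  have h4 : (0 : ℝ) < ⌊Real.log n ^ 2⌋₊ := h3.trans_le h1
  constructor
  · rw [div_le_div_iff₀ (by linarith) h4]; nlinarith
  · rw [div_le_div_iff₀ h4 (by linarith)]; nlinarith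

/-- The increments are at least about n^0.15 times a ratio defect of order 1 / log n; the spare
n^0.05 absorbs the logarithm. -/
lemma geomSum_long : ∀ᶠ n : ℕ in atTop, ∀ i ∈ Finset.Icc 1 ⌊Real.log n ^ 2⌋₊,
    (n : ℝ) ^ (0.1 : ℝ) ≤ ((geomSum n i - geomSum n (i - 1) : ℕ) : ℝ) := by
  have hsmall : ∀ᶠ n : ℕ in atTop, Real.log n ≤ 0.05 * (n : ℝ) ^ (0.05 : ℝ) := by
    have := (isLittleO_log_rpow_atTop (show (0 : ℝ) < 0.05 by norm_num)).bound
      (show (0 : ℝ) < 0.05 by norm_num)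
    filter_upwards [tendsto_natCast_atTop_atTop.eventually this,
      tendsto_log_natCast.eventually_ge_atTop 1] with n h1 h2
    rwa [Real.norm_of_nonneg (by linarith), Real.norm_of_nonneg (by positivity)] at h1
  filter_upwards [hsmall, tendsto_log_natCast.eventually_ge_atTop 2, eventually_ge_atTop 1]
    with n hs hl hn i hi
  rw [Finset.mem_Icc] at hi
  have hn0 : (0 : ℝ) < n := by exact_mod_cast hn
  obtain ⟨hq1, hq2⟩ := geomRatio_bounds hl
  obtain ⟨hk1, hk2⟩ := floor_log_sq_bounds hl
  have hinit := initLen_le n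
  have hinit' := initLen_le_self n (by linarith)
  have hN : (n : ℝ) / 2 ≤ ((n - initLen n : ℕ) : ℝ) := by
    rw [Nat.cast_sub hinit']
    have : (n : ℝ) / Real.log n ≤ n / 2 := by gcongr
    linarith
  rw [geomSum, if_neg (by omega)]
  set k := ⌊Real.log n ^ 2⌋₊ with hk
  set ℓ := Real.log n with hℓ
  set N : ℝ := ((n - initLen n : ℕ) : ℝ) with hNdef
  set q := 0.85 * ℓ / k with hq
  have hk0 : (0 : ℝ) < k := by nlinarith
  have hq0 : 0 < q := by positivity
  have hq3 : q ≤ 1 := hq2.trans (by rw [div_le_one (by linarith)]; exact hl)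
  have hqk : q * k = 0.85 * ℓ := by rw [hq]; field_simp
  have hexpq : q / 2 ≤ 1 - Real.exp (-q) := by
    have h1 : 1 + q ≤ Real.exp q := by linarith [Real.add_one_le_exp q]
    rw [Real.exp_neg]
    have h2 : (Real.exp q)⁻¹ ≤ (1 + q)⁻¹ := inv_anti₀ (by linarith) h1
    have h3 : (1 + q)⁻¹ ≤ 1 - q / 2 := by
      rw [inv_le_iff_one_le_mul₀ (by linarith)]; nlinarith
    linarith
  have hprev : (geomSum n (i - 1) : ℝ) ≤ N * Real.exp (-q * (k - i)) * Real.exp (-q) := by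
    rcases Nat.eq_or_lt_of_le hi.1 with h | h
    · rw [← h]; simp only [geomSum]; simp; positivity
    · rw [geomSum, if_neg (by omega)]
      refine (Nat.floor_le (by positivity)).trans (le_of_eq ?_)
      rw [mul_assoc, ← Real.exp_add]
      congr 2
      rw [Nat.cast_sub hi.1]; push_cast; ring
  have hcur := Nat.lt_floor_add_one (N * Real.exp (-q * (k - i)))
  set E := Real.exp (-q * (k - i)) with hE
  have hElow : (n : ℝ) ^ (-0.85 : ℝ) ≤ E := by
    rw [Real.rpow_def_of_pos hn0, hE, Real.exp_le_exp, ← hℓ]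
    have : (0 : ℝ) ≤ i := by positivity
    nlinarith
  have hdiff : (n : ℝ) ^ (0.1 : ℝ) ≤ (⌊N * E⌋₊ : ℝ) - geomSum n (i - 1) := by
    have h1 : N * E * (q / 2) - 1 ≤ (⌊N * E⌋₊ : ℝ) - geomSum n (i - 1) := by
      have : N * E * (q / 2) ≤ N * E * (1 - Real.exp (-q)) := by gcongr
      linarith
    refine le_trans ?_ h1
    have h2 : (n : ℝ) / 2 * (n : ℝ) ^ (-0.85 : ℝ) * (0.85 / ℓ / 2) ≤ N * E * (q / 2) := by
      gcongr
    have h3 : (n : ℝ) * (n : ℝ) ^ (-0.85 : ℝ) = n ^ (0.1 : ℝ) * n ^ (0.05 : ℝ) := by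
      rw [← Real.rpow_one_add' hn0.le (by norm_num), ← Real.rpow_add hn0]; norm_num
    have h4 : (1 : ℝ) ≤ n ^ (0.1 : ℝ) :=
      Real.one_le_rpow (by exact_mod_cast hn) (by norm_num)
    have h5 : (n : ℝ) / 2 * (n : ℝ) ^ (-0.85 : ℝ) * (0.85 / ℓ / 2) =
        n ^ (0.1 : ℝ) * (0.2125 * (n ^ (0.05 : ℝ) / ℓ)) := by
      have : (n : ℝ) / 2 * (n : ℝ) ^ (-0.85 : ℝ) * (0.85 / ℓ / 2) =
        (n : ℝ) * (n : ℝ) ^ (-0.85 : ℝ) * (0.85 / ℓ / 4) := by ring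
      rw [this, h3]; ring
    have h6 : 20 ≤ (n : ℝ) ^ (0.05 : ℝ) / ℓ := by
      rw [le_div_iff₀ (by linarith)]; linarith
    nlinarith
  have hle : geomSum n (i - 1) ≤ ⌊N * E⌋₊ := by
    have : (0 : ℝ) ≤ n ^ (0.1 : ℝ) := by positivity
    have h : (geomSum n (i - 1) : ℝ) ≤ (⌊N * E⌋₊ : ℝ) := by linarith
    exact_mod_cast h
  rw [Nat.cast_sub hle]
  exact hdiff

lemma geomSum_total : ∀ᶠ n : ℕ in atTop, initLen n +
    ∑ i ∈ Finset.Icc 1 ⌊Real.log n ^ 2⌋₊, (geomSum n i - geomSum n (i - 1)) = n := by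
  filter_upwards [tendsto_log_natCast.eventually_ge_atTop 2] with n hl
  have hk := (floor_log_sq_bounds hl).1
  have hk0 : (0 : ℝ) < ⌊Real.log n ^ 2⌋₊ := by nlinarith
  have hk0' : ⌊Real.log n ^ 2⌋₊ ≠ 0 := by exact_mod_cast hk0.ne'
  rw [sum_geomSum_sub (by linarith), geomSum, if_neg hk0', sub_self, mul_zero, Real.exp_zero,
    mul_one, Nat.floor_natCast]
  have := initLen_le_self n (by linarith)
  omega

/-- Take the last partial sum not exceeding v. Either it is the final one, n - w₀ = (1 - o(1))n, or
the next one exceeds v and is larger only by a factor close to 1. -/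
lemma geomSum_dense (δ : ℝ) (hδ : 0 < δ) : ∀ᶠ n : ℕ in atTop, ∀ v : ℕ,
    (n : ℝ) ^ (0.2 : ℝ) ≤ (v : ℝ) → v ≤ n → ∃ i ∈ Finset.Icc 1 ⌊Real.log n ^ 2⌋₊,
      (1 - δ) * (v : ℝ) ≤ (geomSum n i : ℝ) ∧ geomSum n i ≤ v := by
  have h02 : Tendsto (fun n : ℕ => (n : ℝ) ^ (0.2 : ℝ)) atTop atTop :=
    (tendsto_rpow_atTop (by norm_num)).comp tendsto_natCast_atTop_atTop
  filter_upwards [tendsto_log_natCast.eventually_ge_atTop (max 20 (4 / δ)),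
    h02.eventually_ge_atTop (2 / δ), eventually_ge_atTop 1] with n hl0 hn2 hn v hv hvn
  have hl : 20 ≤ Real.log n := (le_max_left _ _).trans hl0
  have hlδ : 4 / δ ≤ Real.log n := (le_max_right _ _).trans hl0
  have hlδ' : 4 / Real.log n ≤ δ := by
    rw [div_le_iff₀ (by linarith)]; rw [div_le_iff₀ hδ] at hlδ; linarith
  have hn0 : (0 : ℝ) < n := by exact_mod_cast hn
  obtain ⟨hq1, hq2⟩ := geomRatio_bounds (show 2 ≤ Real.log n by linarith)
  obtain ⟨hk1, hk2⟩ := floor_log_sq_bounds (show 2 ≤ Real.log n by linarith)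
  have hinit := initLen_le n
  have hinit' := initLen_le_self n (by linarith)
  have hform : ∀ i, i ≠ 0 → geomSum n i = ⌊((n - initLen n : ℕ) : ℝ) *
    Real.exp (-(0.85 * Real.log n / ⌊Real.log n ^ 2⌋₊) *
    ((⌊Real.log n ^ 2⌋₊ : ℝ) - i))⌋₊ := fun i hi => by rw [geomSum, if_neg hi]
  set k := ⌊Real.log n ^ 2⌋₊ with hk
  set ℓ := Real.log n with hℓ
  set N : ℝ := ((n - initLen n : ℕ) : ℝ) with hNdef
  have hNn : N = n - initLen n := by rw [hNdef, Nat.cast_sub hinit']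
  set q := 0.85 * ℓ / k with hq
  have hk0 : (0 : ℝ) < k := by nlinarith
  have hk0' : 1 ≤ k := by
    have : 0 < k := by exact_mod_cast hk0
    omega
  have hq0 : 0 < q := by positivity
  have hq4 : q ≤ δ / 2 := by
    refine hq2.trans ?_
    calc 2 / ℓ = (4 / ℓ) / 2 := by ring
      _ ≤ _ := by gcongr
  have hqk : q * k = 0.85 * ℓ := by rw [hq]; field_simp
  have hfirst : geomSum n 1 ≤ v := by
    have h1 : (geomSum n 1 : ℝ) ≤ v := by
      refine le_trans ?_ hv
      rw [hform 1 one_ne_zero]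
      refine (Nat.floor_le (by positivity)).trans ?_
      have hNle : N ≤ Real.exp ℓ := by
        rw [hℓ, Real.exp_log hn0, hNn]
        have : (0 : ℝ) ≤ initLen n := by positivity
        linarith
      calc N * Real.exp (-q * (k - (1 : ℕ))) ≤ Real.exp ℓ * Real.exp (-q * (k - (1 : ℕ))) := by
            gcongr
        _ ≤ _ := by
            rw [← Real.exp_add, Real.rpow_def_of_pos hn0, Real.exp_le_exp, ← hℓ]
            -- The first partial sum is at most n^0.15 e^q, and log n ≥ 20 gives e^q ≤ n^0.05.
            have : q ≤ 1 := hq2.trans (by rw [div_le_one (by linarith)]; linarith)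
            push_cast
            nlinarith
    exact_mod_cast h1
  set i := Nat.findGreatest (fun i => geomSum n i ≤ v) k with hi
  have hi1 : 1 ≤ i := Nat.le_findGreatest hk0' hfirst
  have hik : i ≤ k := Nat.findGreatest_le k
  have hiv : geomSum n i ≤ v :=
    Nat.findGreatest_spec (P := fun i => geomSum n i ≤ v) hk0' hfirst
  refine ⟨i, Finset.mem_Icc.2 ⟨hi1, hik⟩, ?_, hiv⟩
  have hv0 : (0 : ℝ) ≤ v := by positivity
  rcases hik.eq_or_lt with h | h
  · rw [h, hform k (by omega), sub_self, mul_zero, Real.exp_zero, mul_one, hNdef,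
      Nat.floor_natCast, ← hNdef, hNn]
    have h1 : (v : ℝ) ≤ n := by exact_mod_cast hvn
    have h2 : (n : ℝ) / ℓ ≤ δ * n := by
      rw [div_eq_mul_inv, mul_comm]
      gcongr
      refine le_trans ?_ hlδ'
      rw [inv_eq_one_div]
      gcongr
      norm_num
    by_cases hδ1 : δ ≤ 1
    · nlinarith
    · have : (1 - δ) * v ≤ 0 := mul_nonpos_of_nonpos_of_nonneg (by linarith) hv0
      have h3 : (initLen n : ℝ) ≤ n := by exact_mod_cast hinit'
      linarith
  · have h1 : ¬ geomSum n (i + 1) ≤ v :=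
      Nat.findGreatest_is_greatest (P := fun i => geomSum n i ≤ v) (Nat.lt_succ_self _) h
    have h2 : (v : ℝ) ≤ geomSum n (i + 1) := by exact_mod_cast (not_le.1 h1).le
    have h3 : (geomSum n (i + 1) : ℝ) ≤ N * Real.exp (-q * (k - i)) * Real.exp q := by
      rw [hform _ (by omega)]
      refine (Nat.floor_le (by positivity)).trans (le_of_eq ?_)
      rw [mul_assoc, ← Real.exp_add]
      congr 2
      push_cast; ring
    have h4 : N * Real.exp (-q * (k - i)) < geomSum n i + 1 := by
      rw [hform i (by omega)]
      exact Nat.lt_floor_add_one _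
    have h5 : (v : ℝ) * Real.exp (-q) ≤ geomSum n i + 1 := by
      rw [Real.exp_neg, ← div_eq_mul_inv, div_le_iff₀ (Real.exp_pos q)]
      calc (v : ℝ) ≤ N * Real.exp (-q * (k - i)) * Real.exp q := h2.trans h3
        _ ≤ _ := by gcongr
    have h6 : 1 - q ≤ Real.exp (-q) := by linarith [Real.add_one_le_exp (-q)]
    have h7 : 1 ≤ δ / 2 * v := by
      have := hn2.trans hv
      rw [div_le_iff₀ hδ] at this
      linarith
    nlinarith [mul_le_mul_of_nonneg_left h6 hv0, mul_le_mul_of_nonneg_left hq4 hv0]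

lemma exists_isBlockScheme : ∃ k w, IsBlockScheme k w := by
  refine ⟨fun n => ⌊Real.log n ^ 2⌋₊, fun n i => geomSum n i - geomSum n (i - 1), ?_,
    geomSum_long, geomSum_total, fun δ hδ => ?_⟩
  · have h : Tendsto (fun n : ℕ => Real.log n ^ 2) atTop atTop :=
      (tendsto_pow_atTop (by norm_num)).comp tendsto_log_natCast
    exact isEquivalent_nat_floor.comp_tendsto h
  · filter_upwards [geomSum_dense δ hδ, tendsto_log_natCast.eventually_ge_atTop 2] with n h hl
    simpa only [sum_geomSum_sub (show 0 ≤ Real.log n by linarith)] using h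

end Scheme

/-! ### Closeness of μ_n and π_n. -/

section Pruning

variable {k : ℕ → ℕ} {w : ℕ → ℕ → ℕ}

lemma IsBlockScheme.count_le (h : IsBlockScheme k w) :
    ∃ K : ℝ, 0 < K ∧ ∀ᶠ n : ℕ in atTop, (k n : ℝ) ≤ K * Real.log n ^ 2 := by
  obtain ⟨K, hK0, hK⟩ := h.count.isBigO.exists_pos
  refine ⟨K, hK0, ?_⟩
  filter_upwards [hK.bound] with n hn
  rwa [Real.norm_of_nonneg (by positivity), Real.norm_of_nonneg (by positivity)] at hn

lemma tendsto_natCast_rpow {s : ℝ} (hs : 0 < s) :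
    Tendsto (fun n : ℕ => (n : ℝ) ^ s) atTop atTop :=
  (tendsto_rpow_atTop hs).comp tendsto_natCast_atTop_atTop

lemma IsBlockScheme.block_ge (h : IsBlockScheme k w) (C : ℕ) :
    ∀ᶠ n : ℕ in atTop, ∀ j ∈ Finset.Icc 1 (k n), C + 2 ≤ w n j ∧
      (n : ℝ) ^ (0.1 : ℝ) / 2 ≤ (w n j - C : ℕ) ∧
      0.05 * Real.log n ≤ Real.log (w n j - C : ℕ) := by
  filter_upwards [h.long, (tendsto_natCast_rpow (show (0 : ℝ) < 0.1 by norm_num)).eventually_ge_atTop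
    (2 * C + 4 : ℝ), (tendsto_natCast_rpow (show (0 : ℝ) < 0.05 by norm_num)).eventually_ge_atTop 2,
    eventually_ge_atTop 1] with n h1 h2 h3 hn j hj
  have hn0 : (0 : ℝ) < n := by exact_mod_cast hn
  have h4 := h1 j hj
  have h5 : (2 * C + 4 : ℝ) ≤ w n j := h2.trans h4
  have h6 : 2 * C + 4 ≤ w n j := by exact_mod_cast h5
  have h7 : (n : ℝ) ^ (0.1 : ℝ) / 2 ≤ (w n j - C : ℕ) := by
    rw [Nat.cast_sub (by omega)]
    linarith
  refine ⟨by omega, h7, ?_⟩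
  rw [← Real.log_rpow hn0]
  refine Real.log_le_log (by positivity) (le_trans ?_ h7)
  have h8 : (n : ℝ) ^ (0.1 : ℝ) = (n : ℝ) ^ (0.05 : ℝ) * (n : ℝ) ^ (0.05 : ℝ) := by
    rw [← Real.rpow_add hn0]; norm_num
  rw [h8]
  nlinarith

lemma IsBlockScheme.block_le (h : IsBlockScheme k w) :
    ∀ᶠ n : ℕ in atTop, ∀ j ∈ Finset.Icc 1 (k n), w n j ≤ n := by
  filter_upwards [h.total] with n hn j hj
  have := Finset.single_le_sum (f := fun i => w n i) (fun _ _ => Nat.zero_le _) hj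
  omega

lemma IsTruncation.exists_const {a : ℕ} {μ : Measure ℤ} {ν : ℕ → Measure ℤ}
    (h : IsTruncation a μ ν) : ∃ A : ℝ, 0 < A ∧ ∀ n : ℕ, 2 ≤ n →
    l1Dist (law a μ n) (ν n) ≤ A * (Real.log n ^ 2 / n) ∧
    ∀ x ∈ atoms (ν n),
      |Real.log ((ν n).real {x}) + entropy (law a μ n)| ≤ A * (n / Real.log n) := by
  obtain ⟨A, hA⟩ := h.asymp
  refine ⟨max A 1, by positivity, fun n hn => ⟨(hA n hn).1.trans ?_,
    fun x hx => ((hA n hn).2 x hx).trans ?_⟩⟩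
  · gcongr; exact le_max_left _ _
  · have := Real.log_natCast_nonneg n
    gcongr; exact le_max_left _ _

/-- The pruned product measure is close to `μ_n`. -/
lemma l1Dist_law_prunedLaw_le {a : ℕ} {μ : Measure ℤ} [IsProbabilityMeasure μ]
    (hμ : (atoms μ).Finite) {ν : ℕ → Measure ℤ} (hν : IsTruncation a μ ν) (C : ℕ)
    (h : IsBlockScheme k w) {δ : ℝ} (hδ : 0 < δ) :
    ∀ᶠ n : ℕ in atTop, l1Dist (law a μ n) (prunedLaw a μ ν C k w n) ≤
      (n : ℝ) ^ (-(0.1 : ℝ) + δ) := by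
  obtain ⟨A, hA0, hA⟩ := hν.exists_const
  obtain ⟨K, hK0, hK⟩ := h.count_le
  -- Of the four logarithms, two come from the number of blocks and two from the truncation error of
  -- each.
  have hlog := (isLittleO_log_rpow_rpow_atTop (4 : ℕ) hδ).bound
    (show (0 : ℝ) < 1 / (2 * A * K) by positivity)
  filter_upwards [hK, h.block_ge C, h.block_le, h.total, tendsto_natCast_atTop_atTop.eventually hlog,
    eventually_ge_atTop 1] with n h1 h2 h3 h4 h5 hn
  have hn0 : (0 : ℝ) < n := by exact_mod_cast hn
  have hl0 : 0 ≤ Real.log n := Real.log_natCast_nonneg n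
  have hdist := l1Dist_law_blockProd_le (a := a) hμ hν.prob (hν.finite_atoms hμ) C (initLen n) (w n) (k n)
    (fun j hj => by have := (h2 j hj).1; omega)
  rw [h4] at hdist
  rw [prunedLaw]
  refine hdist.trans ?_
  have hterm : ∀ j ∈ Finset.Icc 1 (k n), l1Dist (law a μ (w n j - C)) (ν (w n j - C)) ≤
      2 * A * Real.log n ^ 2 * (n : ℝ) ^ (-(0.1 : ℝ)) := by
    intro j hj
    obtain ⟨h6, h7, -⟩ := h2 j hj
    have h8 := h3 j hj
    refine (hA _ (by omega)).1.trans ?_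
    have hm : (w n j - C : ℕ) ≤ n := by omega
    set m := w n j - C
    have hm1 : (1 : ℝ) ≤ m := by exact_mod_cast (show 1 ≤ m by omega)
    have h9 : Real.log m ≤ Real.log n := Real.log_le_log (by linarith) (by exact_mod_cast hm)
    have h10 : 0 ≤ Real.log m := Real.log_nonneg hm1
    calc A * (Real.log m ^ 2 / m) ≤ A * (Real.log n ^ 2 / ((n : ℝ) ^ (0.1 : ℝ) / 2)) := by gcongr
      _ = _ := by rw [Real.rpow_neg hn0.le]; field_simp
  refine (Finset.sum_le_sum hterm).trans ?_
  rw [Finset.sum_const, Nat.card_Icc, nsmul_eq_mul, Nat.add_sub_cancel, Real.rpow_add hn0]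
  rw [Real.rpow_natCast, Real.norm_of_nonneg (by positivity), Real.norm_of_nonneg (by positivity),
    div_mul_eq_mul_div, le_div_iff₀ (by positivity)] at h5
  have hp : 0 < (n : ℝ) ^ (-(0.1 : ℝ)) := by positivity
  calc (k n : ℝ) * (2 * A * Real.log n ^ 2 * (n : ℝ) ^ (-(0.1 : ℝ)))
      ≤ (K * Real.log n ^ 2) * (2 * A * Real.log n ^ 2 * (n : ℝ) ^ (-(0.1 : ℝ))) := by gcongr
    _ = (n : ℝ) ^ (-(0.1 : ℝ)) * (Real.log n ^ 4 * (2 * A * K)) := by ring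
    _ ≤ (n : ℝ) ^ (-(0.1 : ℝ)) * (n : ℝ) ^ δ := by gcongr; linarith

end Pruning

/-! ### Small denominators, by the decay of the initial block. -/

section SmallDenominators

variable {a : ℕ} {μ : Measure ℤ} [IsProbabilityMeasure μ] {k : ℕ → ℕ} {w : ℕ → ℕ → ℕ}

lemma eventually_log_le_rpow {s c : ℝ} (hs : 0 < s) (hc : 0 < c) :
    ∀ᶠ n : ℕ in atTop, Real.log n ≤ c * (n : ℝ) ^ s := by
  filter_upwards [tendsto_natCast_atTop_atTop.eventually ((isLittleO_log_rpow_atTop hs).bound hc)]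
    with n h
  rwa [Real.norm_of_nonneg (Real.log_natCast_nonneg n), Real.norm_of_nonneg (by positivity)] at h

lemma rat_ne_int {r : ℚ} (h0 : 0 < r) (h1 : r < 1) (z : ℤ) : (r : ℝ) ≠ z := by
  intro h
  have h2 : r = z := by exact_mod_cast h
  rw [h2] at h0 h1
  have h3 : (0 : ℤ) < z := by exact_mod_cast h0
  have h4 : z < 1 := by exact_mod_cast h1
  omega

lemma den_mul_cast (r : ℚ) : (r.den : ℝ) * r = (r.num : ℤ) := by
  have := Rat.den_mul_eq_num r
  exact_mod_cast this

/-- The number of windows is about n^0.51 / log n, and n^0.02 beats log n. Of the 3n^0.49, two parts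
offset the number of fractions and one is the saving. -/
lemma exists_block_count_bound {c κ : ℝ} (hc : 0 < c) (hκ : 0 < κ) :
    ∀ᶠ n : ℕ in atTop, ∀ m : ℕ, 0 < m → (m : ℝ) ≤ κ * (n : ℝ) ^ (0.49 : ℝ) →
      3 * (n : ℝ) ^ (0.49 : ℝ) + Real.log 2 ≤ c * (initLen n / m : ℕ) := by
  have hK : 0 < 4 * κ / c := by positivity
  filter_upwards [eventually_log_le_rpow (show (0 : ℝ) < 0.02 by norm_num) (inv_pos.2 hK),
    (tendsto_natCast_rpow (show (0 : ℝ) < 0.49 by norm_num)).eventually_ge_atTop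
      (max (2 * c + Real.log 2) (1 / κ)), tendsto_log_natCast.eventually_ge_atTop 1,
    eventually_ge_atTop 1] with n h1 h2 hl hn m hm0 hm
  have hn0 : (0 : ℝ) < n := by exact_mod_cast hn
  set N := (n : ℝ) ^ (0.49 : ℝ) with hN
  have hN0 : 0 < N := by positivity
  have h3 : 2 * c + Real.log 2 ≤ N := (le_max_left _ _).trans h2
  have h4 : 1 ≤ κ * N := by
    have := (le_max_right _ _).trans h2
    rwa [div_le_iff₀ hκ, mul_comm] at this
  have hsplit : (n : ℝ) = N * N * (n : ℝ) ^ (0.02 : ℝ) := by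
    rw [hN, ← Real.rpow_add hn0, ← Real.rpow_add hn0]; norm_num
  have h5 : 4 * κ / c * (N * N) ≤ (n : ℝ) / Real.log n := by
    rw [le_div_iff₀ (by linarith)]
    rw [← div_eq_inv_mul, le_div_iff₀ hK] at h1
    conv_rhs => rw [hsplit]
    calc 4 * κ / c * (N * N) * Real.log n = N * N * (Real.log n * (4 * κ / c)) := by ring
      _ ≤ _ := by gcongr
  have h6 : (n : ℝ) / Real.log n < initLen n + 1 := Nat.lt_floor_add_one _
  have hm' : (0 : ℝ) < m := by exact_mod_cast hm0
  have h7 : (initLen n : ℝ) < m * ((initLen n / m : ℕ) + 1) := by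
    have := Nat.lt_mul_div_succ (initLen n) hm0
    exact_mod_cast this
  have h8 : 4 * κ / c * (N * N) ≤ κ * N * ((initLen n / m : ℕ) + 2) := by
    have : (m : ℝ) * ((initLen n / m : ℕ) + 1) ≤ κ * N * ((initLen n / m : ℕ) + 1) := by gcongr
    nlinarith
  have h9 : 4 * N ≤ c * ((initLen n / m : ℕ) + 2) := by
    have e : 4 * κ / c * (N * N) = κ * N * (4 * N / c) := by ring
    rw [e] at h8
    have := le_of_mul_le_mul_left h8 (by positivity)
    rw [div_le_iff₀ hc] at this
    linarith
  linarith

/-- The contribution of denominators at most `exp (n^0.49)` is controlled by the initial block. -/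
lemma sum_small_den_le (ha : 1 < a) (hμ : (atoms μ).Finite) (hgcd : GcdOne μ)
    {ν : ℕ → Measure ℤ} (hν : IsTruncation a μ ν) (C : ℕ) :
    ∀ᶠ n : ℕ in atTop, ∀ N : ℕ,
      ∑ r ∈ fareySet a N with (r.den : ℝ) ≤ Real.exp ((n : ℝ) ^ (0.49 : ℝ)),
        ((N : ℝ) / r.den) * ‖ft (prunedLaw a μ ν C k w n) r‖ ^ 2 ≤
      N * Real.exp (-(n : ℝ) ^ (0.49 : ℝ)) := by
  obtain ⟨r₀, hr0, hr1, hr⟩ := exists_norm_ft_le hμ hgcd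
    (show (0 : ℝ) < 1 / (2 * a : ℝ) by positivity)
  have hc : 0 < -Real.log r₀ := by have := Real.log_neg hr0 hr1; linarith
  have hla : 0 < Real.log a := Real.log_pos (by exact_mod_cast ha)
  filter_upwards [exists_block_count_bound hc (show 0 < 1 / Real.log a + 1 by positivity),
    eventually_ge_atTop 1] with n h1 hn N
  have hn1 : (1 : ℝ) ≤ n := by exact_mod_cast hn
  set X := (n : ℝ) ^ (0.49 : ℝ) with hX
  have hX1 : 1 ≤ X := Real.one_le_rpow hn1 (by norm_num)
  -- The shortest window length with a^m ≥ e^X, hence covering all denominators concerned.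
  set m := ⌈X / Real.log a⌉₊ with hm
  have hXa : 0 < X / Real.log a := by positivity
  have hm0 : 0 < m := Nat.ceil_pos.2 hXa
  have hmle : (m : ℝ) ≤ (1 / Real.log a + 1) * X := by
    have := (Nat.ceil_lt_add_one hXa.le).le
    calc (m : ℝ) ≤ X / Real.log a + 1 := this
      _ ≤ X / Real.log a + X := by gcongr
      _ = _ := by ring
  have ham : Real.exp X ≤ (a : ℝ) ^ m := by
    have h2 : X ≤ m * Real.log a := by
      have := Nat.le_ceil (X / Real.log a)
      rwa [div_le_iff₀ hla] at this
    rw [← Real.log_le_log_iff (Real.exp_pos _) (by positivity), Real.log_exp, Real.log_pow]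
    exact h2
  set l := initLen n / m with hl
  have h2 := h1 m hm0 hmle
  have hterm : ∀ r ∈ (fareySet a N).filter (fun r => (r.den : ℝ) ≤ Real.exp X),
      ((N : ℝ) / r.den) * ‖ft (prunedLaw a μ ν C k w n) r‖ ^ 2 ≤ N * r₀ ^ l := by
    intro r hr'
    obtain ⟨hrF, hrD⟩ := Finset.mem_filter.1 hr'
    obtain ⟨g0, g1, g2, g3⟩ := mem_fareySet.1 hrF
    have hden : r.den ≤ a ^ m := by
      have := hrD.trans ham
      exact_mod_cast this
    have h3 : ‖ft (prunedLaw a μ ν C k w n) r‖ ≤ r₀ ^ l := by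
      refine (norm_ft_blockProd_antitone hμ hν.prob (hν.finite_atoms hμ) C (initLen n) (w n) r
        (Nat.zero_le (k n))).trans ?_
      exact norm_ft_law_le ha hμ hr0 hr r.pos hden g3 l r r.num (den_mul_cast r)
        (rat_ne_int g0 g1) _ (Nat.mul_div_le _ _)
    have h4 : r₀ ^ l ≤ 1 := pow_le_one₀ hr0.le hr1.le
    have h5 : ‖ft (prunedLaw a μ ν C k w n) r‖ ^ 2 ≤ r₀ ^ l := by
      have := norm_nonneg (ft (prunedLaw a μ ν C k w n) r)
      nlinarith
    have h6 : (N : ℝ) / r.den ≤ N := div_le_self (by positivity) (by exact_mod_cast r.pos)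
    calc _ ≤ (N : ℝ) * r₀ ^ l := by gcongr
      _ = _ := rfl
  have hcard : (((fareySet a N).filter (fun r => (r.den : ℝ) ≤ Real.exp X)).card : ℝ) ≤
      2 * Real.exp X ^ 2 := by
    set M := ⌊Real.exp X⌋₊ with hM
    have h3 : ((fareySet a N).filter (fun r => (r.den : ℝ) ≤ Real.exp X)).card ≤ M * (M + 1) := by
      refine le_trans (Finset.card_le_card ?_) (card_fareySet_le a M)
      intro r hr'
      obtain ⟨hrF, hrD⟩ := Finset.mem_filter.1 hr'
      obtain ⟨g0, g1, g2, g3⟩ := mem_fareySet.1 hrF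
      exact mem_fareySet.2 ⟨g0, g1, Nat.le_floor hrD, g3⟩
    have h4 : (M : ℝ) ≤ Real.exp X := Nat.floor_le (Real.exp_pos _).le
    have h5 : 1 ≤ Real.exp X := Real.one_le_exp (by linarith)
    have h6 : (((fareySet a N).filter (fun r => (r.den : ℝ) ≤ Real.exp X)).card : ℝ) ≤
        M * (M + 1) := by exact_mod_cast h3
    have h7 : (0 : ℝ) ≤ M := by positivity
    nlinarith
  refine (Finset.sum_le_sum hterm).trans ?_
  rw [Finset.sum_const, nsmul_eq_mul]
  have hpow : r₀ ^ l = Real.exp (Real.log r₀ * l) := by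
    rw [mul_comm, ← Real.log_pow, Real.exp_log (by positivity)]
  calc _ ≤ 2 * Real.exp X ^ 2 * (N * r₀ ^ l) := by gcongr
    _ = N * Real.exp (Real.log 2 + 2 * X + Real.log r₀ * l) := by
      rw [hpow, Real.exp_add, Real.exp_add, Real.exp_log (by norm_num),
        show (2 : ℝ) * X = X + X by ring, Real.exp_add]
      ring
    _ ≤ _ := by
      gcongr
      linarith

end SmallDenominators

/-! ### Large denominators, by the large sieve. -/

section LargeDenominators

variable {a : ℕ} {μ : Measure ℤ} [IsProbabilityMeasure μ] {k : ℕ → ℕ} {w : ℕ → ℕ → ℕ}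

/-- The fractions `a^s r`, `r` in a Farey set of denominators coprime to `a`, are well spaced. -/
lemma farey_separation {N s D : ℕ} {r r' : ℚ} (hr : r ∈ fareySet a N) (hr' : r' ∈ fareySet a N)
    (hD : r.den ≤ D) (hD' : r'.den ≤ D) (hne : r ≠ r') (m : ℤ) :
    1 / ((D ^ 2 : ℕ) : ℝ) ≤ |(a : ℝ) ^ s * r - (a : ℝ) ^ s * r' - m| := by
  obtain ⟨g0, g1, -, g3⟩ := mem_fareySet.1 hr
  obtain ⟨g0', g1', -, g3'⟩ := mem_fareySet.1 hr'
  have hd := den_mul_cast r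
  have hd' := den_mul_cast r'
  have hcop : Nat.Coprime (r.den * r'.den) (a ^ s) := (Nat.Coprime.mul_left g3 g3').pow_right s
  have hint : ((r.den * r'.den : ℕ) : ℝ) * ((r : ℝ) - r') =
      ((r.num * r'.den - r'.num * r.den : ℤ) : ℝ) := by
    push_cast at hd hd' ⊢
    calc (r.den : ℝ) * r'.den * (r - r') = (r.den * r) * r'.den - (r'.den * r') * r.den := by ring
      _ = _ := by rw [hd, hd']
  -- Both fractions lie in (0,1), so their difference is in (-1,1) and nonzero. Multiplication by
  -- a^s keeps it nonintegral, as the denominators are prime to a; clearing denominators then leaves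
  -- a nonzero integer.
  have hnot : ∀ z : ℤ, (r : ℝ) - r' ≠ z := by
    intro z hz
    have h1 : r - r' = z := by exact_mod_cast hz
    have h2 : (-1 : ℚ) < z := by rw [← h1]; linarith
    have h3 : (z : ℚ) < 1 := by rw [← h1]; linarith
    have h4 : -1 < z := by exact_mod_cast h2
    have h5 : z < 1 := by exact_mod_cast h3
    have h6 : z = 0 := by omega
    rw [h6, Int.cast_zero, sub_eq_zero] at h1
    exact hne h1
  have hx : (a : ℝ) ^ s * r - (a : ℝ) ^ s * r' - m ≠ 0 := by
    have := coprime_mul_ne_int hcop hint hnot m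
    push_cast at this
    intro h
    apply this
    linarith
  have hp : (0 : ℝ) < ((r.den * r'.den : ℕ) : ℝ) := by
    exact_mod_cast Nat.mul_pos r.pos r'.pos
  have hone : 1 ≤ ((r.den * r'.den : ℕ) : ℝ) * |(a : ℝ) ^ s * r - (a : ℝ) ^ s * r' - m| := by
    rw [← abs_of_pos hp, ← abs_mul]
    have e : ((r.den * r'.den : ℕ) : ℝ) * ((a : ℝ) ^ s * r - (a : ℝ) ^ s * r' - m) =
        (((a : ℤ) ^ s * (r.num * r'.den - r'.num * r.den) - (r.den * r'.den : ℕ) * m : ℤ) : ℝ) := by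
      calc _ = (a : ℝ) ^ s * (((r.den * r'.den : ℕ) : ℝ) * ((r : ℝ) - r')) -
            ((r.den * r'.den : ℕ) : ℝ) * m := by ring
        _ = _ := by rw [hint]; push_cast; ring
    have hne0 := mul_ne_zero hp.ne' hx
    rw [e] at hne0 ⊢
    have h0 : (a : ℤ) ^ s * (r.num * r'.den - r'.num * r.den) - (r.den * r'.den : ℕ) * m ≠ 0 := by
      exact_mod_cast hne0
    exact_mod_cast Int.one_le_abs h0
  have hle : ((r.den * r'.den : ℕ) : ℝ) ≤ ((D ^ 2 : ℕ) : ℝ) := by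
    have : r.den * r'.den ≤ D ^ 2 := by rw [sq]; exact Nat.mul_le_mul hD hD'
    exact_mod_cast this
  rw [div_le_iff₀ (hp.trans_le hle), mul_comm]
  exact hone.trans (by gcongr)

/-- Large sieve bound for the fractions with denominators in `[D / 2, D]`, using the first `i`
pruned blocks. -/
lemma sum_dyadic_le_of_atoms (ha : 1 < a) (hμ : (atoms μ).Finite) {ν : ℕ → Measure ℤ}
    (hν : IsTruncation a μ ν) {C : ℕ} (hC : IsMargin a ν C) {n i N D : ℕ} (hik : i ≤ k n)
    (hw : ∀ j ∈ Finset.Icc 1 i, C + 2 ≤ w n j) {B : ℝ}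
    (hB : ∀ x, (blockChain a (w n) (fun j => ν (w n j - C)) i).real {x} ≤ B) (hD : 0 < D)
    (hS : (a : ℝ) ^ (∑ j ∈ Finset.Icc 1 i, w n j) ≤ (D : ℝ) ^ 2) :
    ∑ r ∈ fareySet a N with (D : ℝ) ≤ 2 * r.den ∧ r.den ≤ D,
        ((N : ℝ) / r.den) * ‖ft (prunedLaw a μ ν C k w n) r‖ ^ 2 ≤
      N * ((8 + 4 * Real.log D) * D * B) := by
  set T := (fareySet a N).filter (fun r => (D : ℝ) ≤ 2 * r.den ∧ r.den ≤ D) with hT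
  have hprob := hν.prob
  have hchain := isProbabilityMeasure_blockChain a (w n) (τ := fun j => ν (w n j - C))
    (fun j => hprob _) i
  set ρ := blockChain a (w n) (fun j => ν (w n j - C)) i with hρ
  have hD' : (0 : ℝ) < D := by exact_mod_cast hD
  have hD1 : (1 : ℝ) ≤ D := by exact_mod_cast hD
  have hB0 : 0 ≤ B := measureReal_nonneg.trans (hB 0)
  have hlogD : 0 ≤ Real.log D := Real.log_natCast_nonneg D
  have hls := large_sieve_measure T (fun r : ℚ => (a : ℝ) ^ initLen n * r) (K := D ^ 2)
    (by positivity) (fun r hr r' hr' hne m => farey_separation (Finset.mem_filter.1 hr).1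
      (Finset.mem_filter.1 hr').1 (Finset.mem_filter.1 hr).2.2 (Finset.mem_filter.1 hr').2.2 hne m)
    (ρ := ρ) (N := a ^ (∑ j ∈ Finset.Icc 1 i, w n j)) (fun x hx => by
      have h1 := abs_le_of_mem_atoms_blockChain ha (τ := fun j => ν (w n j - C))
        (fun j => hprob _) i (fun j hj => by have := hw j hj; omega)
        (fun j hj x hx => hC (w n j) (by have := hw j hj; omega) x hx) x hx
      exact_mod_cast h1) hB
  have hbound : (2 * ((a ^ (∑ j ∈ Finset.Icc 1 i, w n j) : ℕ) : ℝ) + 1 +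
      ((D ^ 2 : ℕ) : ℝ) * (1 + Real.log ((D ^ 2 : ℕ) : ℝ))) * B ≤
      (D : ℝ) ^ 2 * (4 + 2 * Real.log D) * B := by
    push_cast
    rw [Real.log_pow]
    gcongr
    push_cast
    nlinarith
  calc ∑ r ∈ T, ((N : ℝ) / r.den) * ‖ft (prunedLaw a μ ν C k w n) r‖ ^ 2
      ≤ ∑ r ∈ T, (2 * N / D : ℝ) * ‖ft ρ ((a : ℝ) ^ initLen n * r)‖ ^ 2 := by
        refine Finset.sum_le_sum fun r hr => ?_
        obtain ⟨-, h1, -⟩ := Finset.mem_filter.1 hr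
        have hd : (0 : ℝ) < r.den := by exact_mod_cast r.pos
        have h2 : (N : ℝ) / r.den ≤ 2 * N / D := by
          rw [div_le_div_iff₀ hd hD']
          nlinarith [Nat.cast_nonneg (α := ℝ) N]
        have h3 : ‖ft (prunedLaw a μ ν C k w n) r‖ ≤ ‖ft ρ ((a : ℝ) ^ initLen n * r)‖ :=
          (norm_ft_blockProd_antitone hμ hprob (hν.finite_atoms hμ) C (initLen n) (w n) r hik).trans
            (norm_ft_blockProd_le_blockChain hμ hprob (hν.finite_atoms hμ) C (initLen n) (w n) i r)
        gcongr
    _ ≤ (2 * N / D : ℝ) * ((D : ℝ) ^ 2 * (4 + 2 * Real.log D) * B) := by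
        rw [← Finset.mul_sum]
        gcongr
        exact hls.trans hbound
    _ = _ := by field_simp; ring

/-- With lam = log a and Λ = log D, v = min(⌊2Λ/lam⌋, n) is the longest available length with a^v ≤
D². The last bound uses `hHl` if the first entry is the smaller, with a loss of at most H from the
floor, and `hb` otherwise. -/
lemma exists_block_length {ε H lam b Λ : ℝ} {n : ℕ} (hlam : 0 < lam) (hH : 0 < H)
    (hHl : (1 + ε) * lam ≤ 2 * H) (hΛ : 0 ≤ Λ) (hb : (1 + ε) * Λ - b ≤ H * n) :
    ∃ v : ℕ, v ≤ n ∧ (v = n ∨ 2 * Λ / lam - 1 ≤ v) ∧ lam * v ≤ 2 * Λ ∧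
      (1 + ε) * Λ - max b H ≤ H * v := by
  have hx : 0 ≤ 2 * Λ / lam := by positivity
  have hfl := Nat.floor_le hx
  have hfl' := Nat.lt_floor_add_one (2 * Λ / lam)
  refine ⟨min ⌊2 * Λ / lam⌋₊ n, min_le_right _ _, ?_, ?_, ?_⟩
  · rcases le_total ⌊2 * Λ / lam⌋₊ n with h | h
    · rw [min_eq_left h]; right; linarith
    · rw [min_eq_right h]; left; rfl
  · have h1 : ((min ⌊2 * Λ / lam⌋₊ n : ℕ) : ℝ) ≤ 2 * Λ / lam :=
      le_trans (by exact_mod_cast min_le_left _ _) hfl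
    rw [le_div_iff₀ hlam] at h1
    linarith
  · rcases le_total ⌊2 * Λ / lam⌋₊ n with h | h
    · rw [min_eq_left h]
      have h1 : H * (2 * Λ / lam - 1) ≤ H * ⌊2 * Λ / lam⌋₊ := by gcongr; linarith
      have h2 : (1 + ε) * Λ ≤ H * (2 * Λ / lam) := by
        rw [mul_div_assoc', le_div_iff₀ hlam]
        nlinarith
      have := le_max_right b H
      linarith
    · rw [min_eq_right h]
      have := le_max_left b H
      linarith

lemma eventually_const_add_log_sq_le {ε K : ℝ} (hε : 0 < ε) (B₁ : ℝ) (hK : 0 ≤ K) :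
    ∀ᶠ n : ℕ in atTop, B₁ + K * Real.log n ^ 2 ≤ ε / 8 * (n : ℝ) ^ (0.49 : ℝ) := by
  have h1 := (isLittleO_log_rpow_rpow_atTop (2 : ℕ) (show (0 : ℝ) < 0.49 by norm_num)).bound
    (show 0 < ε / (16 * (K + 1)) by positivity)
  filter_upwards [tendsto_natCast_atTop_atTop.eventually h1,
    (tendsto_natCast_rpow (show (0 : ℝ) < 0.49 by norm_num)).eventually_ge_atTop (16 * B₁ / ε)]
    with n h2 h3
  rw [Real.rpow_natCast, Real.norm_of_nonneg (by positivity), Real.norm_of_nonneg (by positivity),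
    div_mul_eq_mul_div, le_div_iff₀ (by positivity)] at h2
  rw [div_le_iff₀ hε] at h3
  nlinarith [sq_nonneg (Real.log n)]

lemma eventually_rpow_le_sub_one {lam : ℝ} (hlam : 0 < lam) :
    ∀ᶠ n : ℕ in atTop, (n : ℝ) ^ (0.2 : ℝ) ≤ 2 / lam * (n : ℝ) ^ (0.49 : ℝ) - 1 := by
  filter_upwards [(tendsto_natCast_rpow (show (0 : ℝ) < 0.29 by norm_num)).eventually_ge_atTop lam,
    eventually_ge_atTop 1] with n h1 hn
  have hn0 : (0 : ℝ) < n := by exact_mod_cast hn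
  have h2 : (n : ℝ) ^ (0.49 : ℝ) = (n : ℝ) ^ (0.29 : ℝ) * (n : ℝ) ^ (0.2 : ℝ) := by
    rw [← Real.rpow_add hn0]; norm_num
  have h3 : (1 : ℝ) ≤ (n : ℝ) ^ (0.2 : ℝ) :=
    Real.one_le_rpow (by exact_mod_cast hn) (by norm_num)
  have h4 : lam * (n : ℝ) ^ (0.2 : ℝ) ≤ (n : ℝ) ^ (0.49 : ℝ) := by rw [h2]; gcongr
  have h5 : 2 / lam * (lam * (n : ℝ) ^ (0.2 : ℝ)) ≤ 2 / lam * (n : ℝ) ^ (0.49 : ℝ) := by gcongr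
  have h6 : 2 / lam * (lam * (n : ℝ) ^ (0.2 : ℝ)) = 2 * (n : ℝ) ^ (0.2 : ℝ) := by field_simp
  linarith

lemma linear_le_exp {ε t : ℝ} (hε : 0 < ε) (ht : 0 ≤ t) :
    8 + 4 * t ≤ Real.exp (Real.log (8 + 32 / ε) + ε / 8 * t) := by
  have h1 := Real.add_one_le_exp (ε / 8 * t)
  have h2 : 0 ≤ ε / 8 * t := by positivity
  rw [Real.exp_add, Real.exp_log (by positivity)]
  have h3 : 32 / ε * (ε / 8 * t) = 4 * t := by field_simp; ring
  have h4 : 0 < 32 / ε := by positivity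
  nlinarith [mul_le_mul_of_nonneg_left h1 h4.le]

/-- The budget: of the gain εΛ, a quarter pays for η and δ, an eighth for the factor linear in log
D, and an eighth for the constants and the factor of each block. Half is left, and Λ ≥ X. -/
lemma block_exponent_le {ε lam H η δ Λ X v S b B₁ L Y Z : ℝ} (hε : 0 < ε) (hδ0 : 0 < δ)
    (hδ : δ * H ≤ ε * lam / 16) (hη0 : 0 < η) (hηH : η ≤ H) (hη : η ≤ ε * lam / 16)
    (hXΛ : X ≤ Λ) (hv0 : 0 ≤ v) (hv2 : lam * v ≤ 2 * Λ) (hv3 : (1 + ε) * Λ - b ≤ H * v)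
    (hS : (1 - δ) * v ≤ S) (hB₁ : B₁ = b + L) (hYZ : Y ≤ Z) (hZ : B₁ + Z ≤ ε / 8 * X) :
    L + ε / 8 * Λ + Λ + (Y - (H - η) * S) ≤ -(ε / 2) * X := by
  have hSv : (H - η) * ((1 - δ) * v) ≤ (H - η) * S :=
    mul_le_mul_of_nonneg_left hS (by linarith)
  have hloss : (η + δ * H) * v ≤ ε / 4 * Λ := by
    calc (η + δ * H) * v ≤ (ε * lam / 16 + ε * lam / 16) * v := by gcongr
      _ = ε / 8 * (lam * v) := by ring
      _ ≤ ε / 8 * (2 * Λ) := by gcongr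
      _ = _ := by ring
  have hcross : 0 ≤ δ * η * v := by positivity
  have hεX : ε * X ≤ ε * Λ := by gcongr
  have hSlow : (1 + ε) * Λ - b - ε / 4 * Λ ≤ (H - η) * S := by
    have : (H - η) * ((1 - δ) * v) = H * v - (η + δ * H) * v + δ * η * v := by ring
    linarith
  linarith

set_option maxHeartbeats 1600000 in
/-- The contribution of each dyadic range of denominators beyond `exp (n^0.49)`. -/
lemma sum_dyadic_le (ha : 1 < a) (hμ : (atoms μ).Finite) {ε : ℝ} (hε : 0 < ε)
    (hH : (1 + ε) * Real.log a ≤ 2 * entropyRate a μ) {ν : ℕ → Measure ℤ}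
    (hν : IsTruncation a μ ν) {C : ℕ} (hC : IsMargin a ν C) (hkw : IsBlockScheme k w) :
    ∀ᶠ n : ℕ in atTop, ∀ N : ℕ, (1 + ε) * Real.log N ≤ entropyRate a μ * n →
      ∀ D : ℕ, Real.exp ((n : ℝ) ^ (0.49 : ℝ)) ≤ D →
      ∑ r ∈ fareySet a N with (D : ℝ) ≤ 2 * r.den ∧ r.den ≤ D,
        ((N : ℝ) / r.den) * ‖ft (prunedLaw a μ ν C k w n) r‖ ^ 2 ≤
      N * Real.exp (-(ε / 2) * (n : ℝ) ^ (0.49 : ℝ)) := by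
  set H := entropyRate a μ with hHdef
  set lam := Real.log a with hlamdef
  have hlam : 0 < lam := Real.log_pos (by exact_mod_cast ha)
  have hH0 : 0 < H := by
    have : 0 < (1 + ε) * lam := by positivity
    linarith
  obtain ⟨A, hA0, hA⟩ := hν.exists_const
  obtain ⟨K, hK0, hK⟩ := hkw.count_le
  -- δH and η are at most ε lam/16 and v ≤ 2Λ/lam, so together they lose at most εΛ/4.
  set δ := ε * lam / (16 * H) with hδdef
  have hδ0 : 0 < δ := by positivity
  have hδ2 : δ * H ≤ ε * lam / 16 := by
    rw [hδdef]
    field_simp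
    rfl
  set η := min H (ε * lam / 16) with hηdef
  have hη0 : 0 < η := by positivity
  have hηH : η ≤ H := min_le_left _ _
  have hη2 : η ≤ ε * lam / 16 := min_le_right _ _
  set c₁ := Real.log 2 + H * C with hc₁
  have hc₁0 : 0 ≤ c₁ := by
    have := Real.log_nonneg (show (1 : ℝ) ≤ 2 by norm_num)
    positivity
  set b := (1 + ε) * Real.log 2 with hb
  set B₁ := max b H + Real.log (8 + 32 / ε) with hB₁
  have hlogX := eventually_const_add_log_sq_le hε B₁ (K := K * c₁) (by positivity)
  have hvlarge := eventually_rpow_le_sub_one hlam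
  filter_upwards [hK, hkw.block_ge C, hkw.dense δ hδ0, hlogX, hvlarge,
    tendsto_log_natCast.eventually_ge_atTop (max 1 (20 * A / η)), eventually_ge_atTop 1]
    with n hKn hblock hdense hlogn hvn hl0 hn N hN D hD
  have hn1 : (1 : ℝ) ≤ n := by exact_mod_cast hn
  set X := (n : ℝ) ^ (0.49 : ℝ) with hX
  have hl1 : 1 ≤ Real.log n := (le_max_left _ _).trans hl0
  have hlη : 20 * A / η ≤ Real.log n := (le_max_right _ _).trans hl0
  -- A nonempty range forces D ≤ 2N, which turns the hypothesis on log N into one on log D, up to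
  -- the constant b.
  rcases ((fareySet a N).filter (fun r : ℚ => (D : ℝ) ≤ 2 * r.den ∧ r.den ≤ D)).eq_empty_or_nonempty
    with he | ⟨r, hr⟩
  · rw [he, Finset.sum_empty]; positivity
  obtain ⟨hrF, hr1, -⟩ := Finset.mem_filter.1 hr
  have hrN := (mem_fareySet.1 hrF).2.2.1
  have hD' : (0 : ℝ) < D := (Real.exp_pos _).trans_le hD
  have hD0 : 0 < D := by exact_mod_cast hD'
  set Λ := Real.log D with hΛ
  have hXΛ : X ≤ Λ := by rw [hΛ, Real.le_log_iff_exp_le hD']; exact hD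
  have hX0 : 0 ≤ X := by positivity
  have hΛN : Λ ≤ Real.log 2 + Real.log N := by
    have hN0 : (0 : ℝ) < N := by exact_mod_cast r.pos.trans_le hrN
    rw [← Real.log_mul (by norm_num) hN0.ne']
    refine Real.log_le_log hD' (hr1.trans ?_)
    have : (r.den : ℝ) ≤ N := by exact_mod_cast hrN
    linarith
  obtain ⟨v, hvle, hv1, hv2, hv3⟩ := exists_block_length (n := n) (b := b) hlam hH0 hH
    (hX0.trans hXΛ) (by rw [hb]; nlinarith)
  have hv02 : (n : ℝ) ^ (0.2 : ℝ) ≤ v := by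
    rcases hv1 with h | h
    · rw [h]
      calc (n : ℝ) ^ (0.2 : ℝ) ≤ (n : ℝ) ^ (1 : ℝ) :=
            Real.rpow_le_rpow_of_exponent_le hn1 (by norm_num)
        _ = n := Real.rpow_one _
    · have : 2 / lam * X ≤ 2 * Λ / lam := by
        rw [div_mul_eq_mul_div]; gcongr
      linarith
  obtain ⟨i, hi, hS1, hS2⟩ := hdense v hv02 hvle
  have hik : i ≤ k n := (Finset.mem_Icc.1 hi).2
  have hsub : Finset.Icc 1 i ⊆ Finset.Icc 1 (k n) := Finset.Icc_subset_Icc_right hik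
  have hatoms := real_blockChain_truncation_le ha hμ hν (fun m hm => (hA m hm).2) hC (w := w n)
    (i := i) (η := η) (fun j hj => ⟨(hblock j (hsub hj)).1, by
      have h1 := (hblock j (hsub hj)).2.2
      have h2 : 0 < 0.05 * Real.log n := by linarith
      rw [div_le_iff₀ (h2.trans_le h1)]
      rw [div_le_iff₀ hη0] at hlη
      calc A ≤ η * (0.05 * Real.log n) := by linarith
        _ ≤ η * Real.log (w n j - C : ℕ) := by gcongr⟩) hη0.le
  have hS3 : ((∑ j ∈ Finset.Icc 1 i, w n j : ℕ) : ℝ) ≤ v := by exact_mod_cast hS2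
  have hpow : (a : ℝ) ^ (∑ j ∈ Finset.Icc 1 i, w n j) ≤ (D : ℝ) ^ 2 := by
    have ha0 : (0 : ℝ) < a := by exact_mod_cast (show 0 < a by omega)
    rw [← Real.log_le_log_iff (by positivity) (by positivity), Real.log_pow, Real.log_pow,
      Nat.cast_ofNat]
    calc ((∑ j ∈ Finset.Icc 1 i, w n j : ℕ) : ℝ) * lam ≤ v * lam := by gcongr
      _ = lam * v := mul_comm _ _
      _ ≤ 2 * Λ := hv2
  refine (sum_dyadic_le_of_atoms ha hμ hν hC hik (fun j hj => (hblock j (hsub hj)).1) hatoms hD0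
    hpow).trans ?_
  gcongr
  set S := ((∑ j ∈ Finset.Icc 1 i, w n j : ℕ) : ℝ) with hSdef
  rw [← hHdef, ← hc₁]
  have hpoly := linear_le_exp hε (hX0.trans hXΛ)
  have hDexp : (D : ℝ) = Real.exp Λ := by rw [hΛ, Real.exp_log hD']
  calc (8 + 4 * Λ) * D * Real.exp (i * c₁ - (H - η) * S)
      ≤ Real.exp (Real.log (8 + 32 / ε) + ε / 8 * Λ) * Real.exp Λ *
        Real.exp (i * c₁ - (H - η) * S) := by rw [← hDexp]; gcongr
    _ = Real.exp (Real.log (8 + 32 / ε) + ε / 8 * Λ + Λ + (i * c₁ - (H - η) * S)) := by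
        rw [← Real.exp_add, ← Real.exp_add]
    _ ≤ _ := by
        rw [Real.exp_le_exp]
        have hi1 : (i : ℝ) * c₁ ≤ K * c₁ * Real.log n ^ 2 := by
          have h1 : (i : ℝ) ≤ k n := by exact_mod_cast hik
          calc (i : ℝ) * c₁ ≤ (K * Real.log n ^ 2) * c₁ := by
                gcongr; exact h1.trans hKn
            _ = _ := by ring
        exact block_exponent_le hε hδ0 hδ2 hη0 hηH hη2 hXΛ (by positivity) hv2 hv3 hS1 hB₁ hi1 hlogn

end LargeDenominators

/-! ### Dyadic decomposition and assembly. -/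

section Main

variable {a : ℕ} {μ : Measure ℤ} [IsProbabilityMeasure μ] {k : ℕ → ℕ} {w : ℕ → ℕ → ℕ}

lemma sum_farey_split_le (a N : ℕ) (X : ℝ) {f : ℚ → ℝ} {M₀ M₁ : ℝ}
    (h0 : ∑ r ∈ fareySet a N with (r.den : ℝ) ≤ Real.exp X, f r ≤ M₀)
    (hf : ∀ r, 0 ≤ f r)
    (h1 : ∀ D : ℕ, Real.exp X ≤ D →
      ∑ r ∈ fareySet a N with (D : ℝ) ≤ 2 * r.den ∧ r.den ≤ D, f r ≤ M₁) (hM₁ : 0 ≤ M₁) :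
    ∑ r ∈ fareySet a N, f r ≤ M₀ + (Nat.log 2 N + 1 : ℕ) * M₁ := by
  classical
  rw [← Finset.sum_filter_add_sum_filter_not _ (fun r : ℚ => (r.den : ℝ) ≤ Real.exp X)]
  refine add_le_add h0 ?_
  set T := (fareySet a N).filter (fun r => ¬ (r.den : ℝ) ≤ Real.exp X) with hT
  have hmaps : ∀ r ∈ T, Nat.log 2 r.den ∈ Finset.range (Nat.log 2 N + 1) := by
    intro r hr
    have := (mem_fareySet.1 (Finset.mem_filter.1 hr).1).2.2.1
    rw [Finset.mem_range]
    exact Nat.lt_succ_of_le (Nat.log_mono_right this)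
  rw [← Finset.sum_fiberwise_of_maps_to hmaps]
  have hfib : ∀ j ∈ Finset.range (Nat.log 2 N + 1),
      ∑ r ∈ T.filter (fun r => Nat.log 2 r.den = j), f r ≤ M₁ := by
    intro j _
    have hpow : ∀ r ∈ T.filter (fun r => Nat.log 2 r.den = j),
        2 ^ j ≤ r.den ∧ r.den < 2 ^ (j + 1) := by
      intro r hr
      rw [← (Finset.mem_filter.1 hr).2]
      exact ⟨Nat.pow_log_le_self 2 r.pos.ne', Nat.lt_pow_succ_log_self (by norm_num) _⟩
    by_cases hX : Real.exp X ≤ ((2 ^ (j + 1) : ℕ) : ℝ)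
    -- Denominators in [2^j, 2^(j+1)) belong to the range D = 2^(j+1).
    · refine le_trans (Finset.sum_le_sum_of_subset_of_nonneg ?_ fun r _ _ => hf r) (h1 _ hX)
      intro r hr
      obtain ⟨h2, h3⟩ := hpow r hr
      refine Finset.mem_filter.2 ⟨(Finset.mem_filter.1 (Finset.mem_filter.1 hr).1).1, ?_, h3.le⟩
      have : 2 ^ (j + 1) ≤ 2 * r.den := by rw [pow_succ]; omega
      exact_mod_cast this
    · have : T.filter (fun r => Nat.log 2 r.den = j) = ∅ := by
        rw [Finset.eq_empty_iff_forall_notMem]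
        intro r hr
        have h2 := (Finset.mem_filter.1 (Finset.mem_filter.1 hr).1).2
        have h3 : (r.den : ℝ) < ((2 ^ (j + 1) : ℕ) : ℝ) := by exact_mod_cast (hpow r hr).2
        linarith
      rw [this, Finset.sum_empty]
      exact hM₁
  refine (Finset.sum_le_sum hfib).trans (le_of_eq ?_)
  rw [Finset.sum_const, Finset.card_range, nsmul_eq_mul]

lemma eventually_linear_le_exp {A c : ℝ} (hA : 0 < A) (hc : 0 < c) :
    ∀ᶠ n : ℕ in atTop, A * n ≤ Real.exp (c * (n : ℝ) ^ (0.49 : ℝ)) := by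
  filter_upwards [eventually_log_le_rpow (show (0 : ℝ) < 0.49 by norm_num) (half_pos hc),
    (tendsto_natCast_rpow (show (0 : ℝ) < 0.49 by norm_num)).eventually_ge_atTop
      (Real.log A / (c / 2)), eventually_ge_atTop 1] with n h1 h2 hn
  have hn0 : (0 : ℝ) < n := by exact_mod_cast hn
  rw [div_le_iff₀ (half_pos hc)] at h2
  rw [← Real.log_le_iff_le_exp (by positivity), Real.log_mul hA.ne' hn0.ne']
  linarith

lemma sum_modq_prunedLaw_le (ha : 1 < a) (hμ : (atoms μ).Finite) (hgcd : GcdOne μ) {ε : ℝ}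
    (hε : 0 < ε) (hH : (1 + ε) * Real.log a ≤ 2 * entropyRate a μ) {ν : ℕ → Measure ℤ}
    (hν : IsTruncation a μ ν) {C : ℕ} (hC : IsMargin a ν C) (hkw : IsBlockScheme k w) :
    ∀ᶠ n : ℕ in atTop, ∀ N : ℕ, 1 ≤ N → (1 + ε) * Real.log N ≤ entropyRate a μ * n →
      ∑ q ∈ Finset.Icc 1 N with Nat.Coprime q a,
          (q : ℝ) * l2DistSq (modq q (prunedLaw a μ ν C k w n)) (unif q) ≤
        N * Real.exp (-(min 1 ε / 4) * (n : ℝ) ^ (0.49 : ℝ)) := by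
  set H := entropyRate a μ with hHdef
  have hlam : 0 < Real.log a := Real.log_pos (by exact_mod_cast ha)
  have hH0 : 0 < H := by
    have : 0 < (1 + ε) * Real.log a := by positivity
    linarith
  have hlog2 : 0 < Real.log 2 := Real.log_pos (by norm_num)
  -- Both contributions decay like exp(-2cX); half of this is spent on the O(n) dyadic ranges.
  set c := min 1 ε / 4 with hc
  have hc0 : 0 < c := by positivity
  have hc1 : 2 * c ≤ 1 := by have := min_le_left 1 ε; rw [hc]; linarith
  have hc2 : 2 * c ≤ ε / 2 := by have := min_le_right 1 ε; rw [hc]; linarith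
  filter_upwards [sum_small_den_le (k := k) (w := w) ha hμ hgcd hν C,
    sum_dyadic_le ha hμ hε hH hν hC hkw,
    eventually_linear_le_exp (show 0 < 2 + H / Real.log 2 by positivity) hc0,
    eventually_ge_atTop 1] with n h1 h2 h3 hn N hN1 hN
  have hn1 : (1 : ℝ) ≤ n := by exact_mod_cast hn
  have hprob : IsProbabilityMeasure (prunedLaw a μ ν C k w n) :=
    isProbabilityMeasure_blockProd (a := a) (μ := μ) hν.prob C (initLen n) (w n) (k n)
  set X := (n : ℝ) ^ (0.49 : ℝ) with hX
  have hX0 : 0 ≤ X := by positivity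
  have hN0 : (0 : ℝ) < N := by exact_mod_cast hN1
  have h4 := sum_farey_split_le a N X (f := fun r =>
    ((N : ℝ) / r.den) * ‖ft (prunedLaw a μ ν C k w n) r‖ ^ 2) (h1 N) (fun r => by positivity)
    (h2 N hN) (by positivity)
  have hlogN : (Nat.log 2 N : ℝ) ≤ H / Real.log 2 * n := by
    have h5 : ((2 ^ Nat.log 2 N : ℕ) : ℝ) ≤ N := by
      exact_mod_cast Nat.pow_log_le_self 2 (by omega : N ≠ 0)
    have h6 := Real.log_le_log (by positivity) h5
    push_cast at h6
    rw [Real.log_pow] at h6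
    have h7 : 0 ≤ Real.log N := Real.log_natCast_nonneg N
    rw [div_mul_eq_mul_div, le_div_iff₀ hlog2]
    nlinarith
  have hE1 : Real.exp (-X) ≤ Real.exp (-(2 * c) * X) := by
    rw [Real.exp_le_exp]; nlinarith
  have hE2 : Real.exp (-(ε / 2) * X) ≤ Real.exp (-(2 * c) * X) := by
    rw [Real.exp_le_exp]; nlinarith
  refine ((sum_modq_le_farey a N (prunedLaw a μ ν C k w n)).trans h4).trans ?_
  calc (N : ℝ) * Real.exp (-X) + (Nat.log 2 N + 1 : ℕ) * (N * Real.exp (-(ε / 2) * X))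
      ≤ N * Real.exp (-(2 * c) * X) + (H / Real.log 2 * n + n) * (N * Real.exp (-(2 * c) * X)) := by
        push_cast
        gcongr
    _ = N * ((1 + (1 + H / Real.log 2) * n) * Real.exp (-(2 * c) * X)) := by ring
    _ ≤ N * (Real.exp (c * X) * Real.exp (-(2 * c) * X)) := by
        gcongr
        linarith
    _ = N * Real.exp (-c * X) := by
        rw [← Real.exp_add]; congr 2; ring

end Main

end CDG

end

theorem proposition6p3 (a : ℕ) (ha : 1 < a) (μ : Measure ℤ) [IsProbabilityMeasure μ]
    (hfin : (CDG.atoms μ).Finite) (hgcd : CDG.GcdOne μ)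
    (ε : ℝ) (hε : 0 < ε) (hH : (1 + ε) * Real.log a ≤ 2 * CDG.entropyRate a μ) :
    -- the choices that enter the definition of `π_n` can be made
    (∃ (ν : ℕ → Measure ℤ) (C : ℕ) (k : ℕ → ℕ) (w : ℕ → ℕ → ℕ),
      CDG.IsTruncation a μ ν ∧ CDG.IsMargin a ν C ∧ CDG.IsBlockScheme k w) ∧
    -- and the bound holds, with a constant that depends on `a`, `μ`, `ε` only, for all of them
    ∃ c : ℝ, 0 < c ∧
      ∀ (ν : ℕ → Measure ℤ) (C : ℕ) (k : ℕ → ℕ) (w : ℕ → ℕ → ℕ),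
        CDG.IsTruncation a μ ν → CDG.IsMargin a ν C → CDG.IsBlockScheme k w →
        (∀ δ : ℝ, 0 < δ → ∀ᶠ n : ℕ in atTop,
          CDG.l1Dist (CDG.law a μ n) (CDG.prunedLaw a μ ν C k w n) ≤
            (n : ℝ) ^ (-(0.1 : ℝ) + δ)) ∧
        ∀ᶠ n : ℕ in atTop, ∀ Q : ℝ, 1 ≤ Q →
          (1 + ε) * Real.log Q ≤ CDG.entropyRate a μ * n →
          ∑ q ∈ Finset.Icc 1 ⌊Q⌋₊ with Nat.Coprime q a,
              (q : ℝ) * CDG.l2DistSq (CDG.modq q (CDG.prunedLaw a μ ν C k w n)) (CDG.unif q)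
            ≤ Q * Real.exp (-c * (Real.log Q) ^ (0.49 : ℝ)) := by
  have hν := CDG.exists_isTruncation ha hfin
  refine ⟨?_, ?_⟩
  · obtain ⟨ν, hν⟩ := hν
    obtain ⟨C, hC⟩ := CDG.exists_isMargin ha hfin hν
    obtain ⟨k, w, hkw⟩ := CDG.exists_isBlockScheme
    exact ⟨ν, C, k, w, hν, hC, hkw⟩
  have hlam : 0 < Real.log a := Real.log_pos (by exact_mod_cast ha)
  have hH0 : 0 < CDG.entropyRate a μ := by
    have : 0 < (1 + ε) * Real.log a := by positivity
    linarith
  set H := CDG.entropyRate a μ with hHdef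
  set c₀ := min 1 ε / 4 with hc₀
  have hc₀0 : 0 < c₀ := by positivity
  -- Since log Q ≤ Hn, dividing by H^0.49 turns decay in n^0.49 into decay in (log Q)^0.49.
  refine ⟨c₀ / H ^ (0.49 : ℝ), by positivity, fun ν C k w hν hC hkw =>
    ⟨fun δ hδ => CDG.l1Dist_law_prunedLaw_le hfin hν C hkw hδ, ?_⟩⟩
  filter_upwards [CDG.sum_modq_prunedLaw_le ha hfin hgcd hε hH hν hC hkw] with n hn Q hQ hQH
  have hN1 : 1 ≤ ⌊Q⌋₊ := by rwa [Nat.one_le_floor_iff]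
  have hNQ : (⌊Q⌋₊ : ℝ) ≤ Q := Nat.floor_le (by linarith)
  have hN0 : (0 : ℝ) < ⌊Q⌋₊ := by exact_mod_cast hN1
  have hlogQ : 0 ≤ Real.log Q := Real.log_nonneg hQ
  have hlog : Real.log ⌊Q⌋₊ ≤ Real.log Q := Real.log_le_log hN0 hNQ
  refine (hn ⌊Q⌋₊ hN1 ((by gcongr : _ ≤ (1 + ε) * Real.log Q).trans hQH)).trans ?_
  have hpow : Real.log Q ^ (0.49 : ℝ) ≤ H ^ (0.49 : ℝ) * (n : ℝ) ^ (0.49 : ℝ) := by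
    rw [← Real.mul_rpow hH0.le (Nat.cast_nonneg n)]
    refine Real.rpow_le_rpow hlogQ ?_ (by norm_num)
    nlinarith
  have hexp : c₀ / H ^ (0.49 : ℝ) * Real.log Q ^ (0.49 : ℝ) ≤ c₀ * (n : ℝ) ^ (0.49 : ℝ) := by
    calc c₀ / H ^ (0.49 : ℝ) * Real.log Q ^ (0.49 : ℝ)
        ≤ c₀ / H ^ (0.49 : ℝ) * (H ^ (0.49 : ℝ) * (n : ℝ) ^ (0.49 : ℝ)) := by gcongr
      _ = c₀ * (n : ℝ) ^ (0.49 : ℝ) := by field_simp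
  refine mul_le_mul hNQ (Real.exp_le_exp.2 ?_) (Real.exp_pos _).le (by linarith)
  rw [neg_mul, neg_mul]
  exact neg_le_neg hexp
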